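/- **Setting.** Let $X$ be a complex Banach space, $\alpha\in(0,1)$, and for $\theta>0$ put $\Sigma_\theta=\{\lambda\in\mathbb C\setminus\{0\}: |\arg\lambda|<\pi/2+\theta\}$. Let $A:D(A)\subset X\to X$ be a closed, densely defined linear operator which is sectorial: for some $\theta_0\in(0,\pi/2]$ and $C>0$, every $\lambda\in\Sigma_{\theta_0}$ lies in the resolvent set of $A$ and $\|(\lambda-A)^{-1}\|\le C/|\lambda|$. Put $\theta_1=\min\{\frac{\pi(1-\alpha)+2\theta_0}{2\alpha},\frac\pi2\}$; powers $\lambda^\alpha$ are principal. Consider an $s$-stage Runge–Kutta method ($s\ge1$) with real coefficients $\mathcal A=(a_{ij})$, $b^T=(b_j)$, $c=(c_i)$, and put $q(z)=b^T(\mathrm{Id}-z\mathcal A)^{-1}$, $r(z)=1+z\,q(z)\mathbb 1$, where $\mathbb 1=(1,\dots,1)^T$. Assume that the method is $L$-stable ($|r(z)|\le1$ for $\operatorname{Re}z\le0$, and $r(z)\to0$ as $\operatorname{Re}z\to-\infty$), that $b^T$ is the last row of $\mathcal A$, that $\mathcal A$ is invertible, and that all eigenvalues of $\mathcal A$ have positive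 real part. Let $h>0$. Let $\Gamma\subset\Sigma_{\theta_1}$ be a (piecewise $C^1$) contour which comes from infinity in the lower half-plane and goes to infinity in the upper half-plane, its tangent direction converging at either end to that of a ray which makes an acute angle with the negative real half-axis, and which satisfies $h\Gamma\cap\sigma(\mathcal A^{-1})=\emptyset$. For $g:\mathbb R\to X$ let $G_n=(g(nh+c_kh))_{k=1}^s\in X^s$. For $\lambda\in\Gamma$ let $(y_{\lambda,n})_{n\ge0}$ be the result of applying the Runge–Kutta method with step size $h$ to $y'=\lambda y+g(t)$, $y(0)=0$. The Runge–Kutta convolution quadrature approximation at $t_N=Nh$ is $$u_N=\frac1{2\pi i}\int_\Gamma(\lambda^\alpha-A)^{-1}y_{\lambda,N}\,d\lambda .$$ The convolution quadrature weights $W_n$ (bounded operators on $X^s$) are the coefficients of the generating function $$h\sum_{n\ge0}W_n\zeta^n=\Big(\big(\tfrac{\Delta(\zeta)}h\big)^{\alpha}\otimes\mathrm{Id}-\mathrm{Id}_s\otimes A\Big)^{-1},\qquad \Delta(\zeta)=\Big(\mathcal A+\frac{\zeta}{1-\zeta}\mathbb 1b^T\Big)^{-1},$$ for $\zeta$ near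 $0$, with the principal power of matrices. **Proposition.** 1. For every $n\ge0$ the integral $$w_n=\frac1{2\pi i}\int_\Gamma r(h\lambda)^n\,q(h\lambda)\otimes(\lambda^\alpha-A)^{-1}\,d\lambda$$ converges absolutely in the space of bounded operators $X^s\to X$. For every $g$ and every $\lambda\in\Gamma$ the sequence $(y_{\lambda,n})$ exists and is unique; and for every $N\ge0$ the integral defining $u_N$ converges absolutely and $$u_N=h\sum_{n=0}^{N-1}w_n\,G_{N-1-n}.$$ 2. The weights $W_n$ exist and are unique. If, moreover, the points of $h^{-1}\sigma(\mathcal A^{-1})$ lie to the right of $\Gamma$ (each of them can be joined, in the complement of $\Gamma$, to all sufficiently large positive real numbers), then $w_n=(e_s^T\otimes\mathrm{Id})W_n$ for all $n\ge0$, and hence for all $g$ and $N$ $$u_N=h\,(e_s^T\otimes\mathrm{Id})\sum_{n=0}^{N-1}W_n\,G_{N-1-n}=h\sum_{n=0}^{N-1}w_n\,G_{N-1-n}.$$ -/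

import Mathlib

open Filter Topology

noncomputable section

namespace FracCQ

/-! ### Sectors, resolvents, sectorial operators -/

/-- The open sector `{z ≠ 0 : |arg z| < π/2 + θ}`. -/
def sector (θ : ℝ) : Set ℂ := {z | z ≠ 0 ∧ |z.arg| < Real.pi / 2 + θ}

/-- The angle `θ₁ = min {(π(1-α) + 2θ₀)/(2α), π/2}`. -/
def theta1 (α θ₀ : ℝ) : ℝ :=
  min ((Real.pi * (1 - α) + 2 * θ₀) / (2 * α)) (Real.pi / 2)

/-- `R` is a bounded, everywhere defined, two-sided inverse of the (unbounded) operator `T`. -/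
def IsBoundedInverse {E : Type*} [NormedAddCommGroup E] [NormedSpace ℂ E]
    (T : E →ₗ.[ℂ] E) (R : E →L[ℂ] E) : Prop :=
  (∀ y : E, ∃ x : T.domain, (x : E) = R y ∧ T x = y) ∧ ∀ x : T.domain, R (T x) = x

variable {X : Type*} [NormedAddCommGroup X] [NormedSpace ℂ X]

/-- The operator `z - A`, with the domain of `A`. -/
def shiftOp (z : ℂ) (A : X →ₗ.[ℂ] X) : X →ₗ.[ℂ] X where
  domain := A.domain
  toFun := z • A.domain.subtype - A.toFun

open Classical in
/-- The resolvent `(z - A)⁻¹` (with the value `0` if `z` is not in the resolvent set). -/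
def resolventOp (A : X →ₗ.[ℂ] X) (z : ℂ) : X →L[ℂ] X :=
  if h : ∃ R, IsBoundedInverse (shiftOp z A) R then h.choose else 0

/-- `A` is closed and densely defined, the sector of angle `θ₀ ∈ (0, π/2]` lies in its resolvent
set (where the resolvent is then automatically analytic), and `‖(z - A)⁻¹‖ ≤ C / |z|` there. -/
structure IsSectorialOp (A : X →ₗ.[ℂ] X) (θ₀ : ℝ) : Prop where
  closed : A.IsClosed
  dense_domain : Dense (A.domain : Set X)
  angle_pos : 0 < θ₀
  angle_le : θ₀ ≤ Real.pi / 2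
  resolvent_exists : ∀ z ∈ sector θ₀, ∃ R, IsBoundedInverse (shiftOp z A) R
  resolvent_bound : ∃ C : ℝ, 0 < C ∧ ∀ z ∈ sector θ₀, ‖resolventOp A z‖ ≤ C / ‖z‖

/-! ### Runge–Kutta methods -/

/-- The coefficients of an `s`-stage Runge–Kutta method. -/
structure RungeKutta (s : ℕ) where
  a : Matrix (Fin s) (Fin s) ℝ
  b : Fin s → ℝ
  c : Fin s → ℝ

/-- The index of the last stage. -/
def lastStage (s : ℕ) [NeZero s] : Fin s := ⟨s - 1, Nat.sub_one_lt (NeZero.ne s)⟩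

namespace RungeKutta

variable {s : ℕ} (rk : RungeKutta s)

/-- The Runge–Kutta matrix, with complex entries. -/
def mat : Matrix (Fin s) (Fin s) ℂ := rk.a.map Complex.ofReal

/-- The weights, with complex entries. -/
def wt : Fin s → ℂ := fun j => (rk.b j : ℂ)

/-- The row vector `q(z) = bᵀ (1 - z 𝒜)⁻¹`. -/
def q (z : ℂ) : Fin s → ℂ := Matrix.vecMul rk.wt (1 - z • rk.mat)⁻¹

/-- The stability function `r(z) = 1 + z q(z) 𝟙`. -/
def r (z : ℂ) : ℂ := 1 + z * ∑ j, rk.q z j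

/-- `L`-stability: `|r(z)| ≤ 1` for `Re z ≤ 0`, and `r(z) → 0` as `Re z → -∞`. -/
def LStable : Prop :=
  (∀ z : ℂ, z.re ≤ 0 → ‖rk.r z‖ ≤ 1) ∧ Tendsto rk.r (comap Complex.re atBot) (𝓝 0)

/-- The standing assumptions on the method: it is `L`-stable, `bᵀ` is the last row of `𝒜`, and
`𝒜` is invertible with all eigenvalues in the open right half-plane. -/
structure Admissible [NeZero s] : Prop where
  lStable : rk.LStable
  last_row : ∀ j, rk.b j = rk.a (lastStage s) j
  invertible : IsUnit rk.a
  eigenvalues : ∀ z ∈ spectrum ℂ rk.mat, 0 < z.re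

/-- `y` is a sequence produced by the method with step size `h` for the initial value problem
`y' = f(t, y)`, `y(0) = y₀`. -/
def IsTrajectory (f : ℝ → X → X) (y₀ : X) (h : ℝ) (y : ℕ → X) : Prop :=
  y 0 = y₀ ∧ ∀ n : ℕ, ∃ Y : Fin s → X,
    (∀ i, Y i = y n + (h : ℂ) • ∑ j, (rk.a i j : ℂ) • f (n * h + rk.c j * h) (Y j)) ∧
    y (n + 1) = y n + (h : ℂ) • ∑ j, (rk.b j : ℂ) • f (n * h + rk.c j * h) (Y j)

/-- The right-hand side of `y' = z y + g(t)`. -/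
def linearField (g : ℝ → X) (z : ℂ) : ℝ → X → X := fun t v => z • v + g t

open Classical in
/-- The Runge–Kutta approximations `y_{z,n}` for `y' = z y + g(t)`, `y(0) = 0`
(with the value `0` if the method cannot be carried out). -/
def approx (g : ℝ → X) (h : ℝ) (z : ℂ) : ℕ → X :=
  if H : ∃ y, rk.IsTrajectory (linearField g z) 0 h y then H.choose else 0

/-- The vector `G_n = (g(t_n + c_k h))_{k=1..s}`. -/
def G (g : ℝ → X) (h : ℝ) (n : ℕ) : Fin s → X := fun k => g (n * h + rk.c k * h)

/-- `Δ(ζ) = (𝒜 + ζ/(1-ζ) 𝟙 bᵀ)⁻¹`. -/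
def delta (ζ : ℂ) : Matrix (Fin s) (Fin s) ℂ :=
  (rk.mat + (ζ / (1 - ζ)) • Matrix.vecMulVec (fun _ => 1) rk.wt)⁻¹

end RungeKutta

/-! ### Contours -/

/-- `γ` parametrizes a contour in the set `S` which comes from infinity in the lower half-plane and
goes to infinity in the upper half-plane (that is, it runs counter-clockwise around the negative
real half-axis), forming at both ends an acute angle `π/2 - φ` with the negative real half-axis.
The regularity required includes all piecewise `C¹` curves. -/
structure IsContour (S : Set ℂ) (γ : ℝ → ℂ) : Prop where
  mem : ∀ x, γ x ∈ S
  lipschitz : LocallyLipschitz γ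
  piecewise : ∃ F : Set ℝ, F.Finite ∧ ContDiffOn ℝ 1 γ Fᶜ
  top_infinity : Tendsto γ atTop (cocompact ℂ)
  bot_infinity : Tendsto γ atBot (cocompact ℂ)
  top_angle : ∃ φ : ℝ, 0 < φ ∧ φ < Real.pi / 2 ∧
    Tendsto (fun x => deriv γ x / (‖deriv γ x‖ : ℂ)) atTop
      (𝓝 (Complex.exp (((Real.pi / 2 + φ : ℝ) : ℂ) * Complex.I)))
  bot_angle : ∃ φ : ℝ, 0 < φ ∧ φ < Real.pi / 2 ∧
    Tendsto (fun x => deriv γ x / (‖deriv γ x‖ : ℂ)) atBot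
      (𝓝 (-Complex.exp (-((Real.pi / 2 + φ : ℝ) : ℂ) * Complex.I)))

/-- The point `p` lies to the right of the contour: in the complement of the contour it can be
joined to every sufficiently large real number. -/
def RightOf (γ : ℝ → ℂ) (p : ℂ) : Prop :=
  ∃ R : ℝ, ∀ x : ℝ, R ≤ x → JoinedIn (Set.range γ)ᶜ p (x : ℂ)

/-- The integrand of `∫_Γ f(z) dz` in the parametrization `γ`. -/
def pullback {E : Type*} [NormedAddCommGroup E] [NormedSpace ℂ E] (γ : ℝ → ℂ) (f : ℂ → E) :
    ℝ → E := fun x => deriv γ x • f (γ x)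

/-- `(2πi)⁻¹ ∫_Γ f(z) dz`. -/
def contourInt {E : Type*} [NormedAddCommGroup E] [NormedSpace ℂ E] (γ : ℝ → ℂ) (f : ℂ → E) : E :=
  (2 * (Real.pi : ℂ) * Complex.I)⁻¹ • ∫ x : ℝ, pullback γ f x

/-! ### Convolution quadrature -/

/-- `v ⊗ R : X^s → X` for a row vector `v` and a bounded operator `R`: `x ↦ ∑ⱼ vⱼ R xⱼ`. -/
def rowTensor {s : ℕ} (v : Fin s → ℂ) (R : X →L[ℂ] X) : (Fin s → X) →L[ℂ] X :=
  ∑ j, v j • R.comp (ContinuousLinearMap.proj j)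

/-- `P ⊗ Id - Id_s ⊗ A` on `X^s`, with domain `D(A)^s`. -/
def blockShift {s : ℕ} (P : Matrix (Fin s) (Fin s) ℂ) (A : X →ₗ.[ℂ] X) :
    (Fin s → X) →ₗ.[ℂ] (Fin s → X) where
  domain := Submodule.pi Set.univ (fun _ => A.domain)
  toFun := LinearMap.pi fun i =>
    (∑ j, P i j • LinearMap.proj j).comp (Submodule.subtype _) -
      A.toFun.comp (LinearMap.codRestrict A.domain
        ((LinearMap.proj i).comp (Submodule.subtype _)) fun x => x.2 i (Set.mem_univ i))

/-- `P = M^α` (principal branch), as a primary matrix function: `M` has no eigenvalue in `(-∞, 0]`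
and `P = p(M)` for a polynomial `p` which agrees with `z ↦ z^α` to order `s` at each eigenvalue of
the `s × s` matrix `M`. -/
def IsPrincipalPower {s : ℕ} (M : Matrix (Fin s) (Fin s) ℂ) (α : ℝ)
    (P : Matrix (Fin s) (Fin s) ℂ) : Prop :=
  (∀ μ ∈ spectrum ℂ M, μ ∈ Complex.slitPlane) ∧
  ∃ p : Polynomial ℂ, P = Polynomial.aeval M p ∧
    ∀ μ ∈ spectrum ℂ M, ∀ k < s,
      (Polynomial.derivative^[k] p).eval μ = iteratedDeriv k (fun z : ℂ => z ^ (α : ℂ)) μ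

/-- `W` is the sequence of coefficients of the generating function
`h ∑ₙ Wₙ ζⁿ = ((Δ(ζ)/h)^α - A)⁻¹`, in the operator norm, for `ζ` near `0`. -/
def IsCQWeights {s : ℕ} (rk : RungeKutta s) (A : X →ₗ.[ℂ] X) (α h : ℝ)
    (W : ℕ → (Fin s → X) →L[ℂ] (Fin s → X)) : Prop :=
  ∃ ρ : ℝ, 0 < ρ ∧ ∀ ζ : ℂ, ‖ζ‖ < ρ → ∃ P : Matrix (Fin s) (Fin s) ℂ,
    ∃ R : (Fin s → X) →L[ℂ] (Fin s → X),
      IsPrincipalPower ((h : ℂ)⁻¹ • rk.delta ζ) α P ∧ IsBoundedInverse (blockShift P A) R ∧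
      HasSum (fun n : ℕ => ζ ^ n • (h : ℂ) • W n) R

/-- `(e_sᵀ ⊗ Id) W`, the last row of an operator on `X^s`. -/
def lastRow {s : ℕ} [NeZero s] (W : (Fin s → X) →L[ℂ] (Fin s → X)) : (Fin s → X) →L[ℂ] X :=
  (ContinuousLinearMap.proj (lastStage s)).comp W

/-- The integrand `r(hz)ⁿ q(hz) ⊗ (z^α - A)⁻¹`. -/
def weightKernel {s : ℕ} (rk : RungeKutta s) (A : X →ₗ.[ℂ] X) (α h : ℝ) (n : ℕ) (z : ℂ) :
    (Fin s → X) →L[ℂ] X :=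
  rk.r (h * z) ^ n • rowTensor (rk.q (h * z)) (resolventOp A (z ^ (α : ℂ)))

/-- The weight `wₙ = (2πi)⁻¹ ∫_Γ r(hz)ⁿ q(hz) ⊗ (z^α - A)⁻¹ dz`. -/
def weight {s : ℕ} (rk : RungeKutta s) (A : X →ₗ.[ℂ] X) (α h : ℝ) (γ : ℝ → ℂ) (n : ℕ) :
    (Fin s → X) →L[ℂ] X :=
  contourInt γ (weightKernel rk A α h n)

/-- The integrand `(z^α - A)⁻¹ y_{z,N}`, where `y_{z,N}` is the Runge–Kutta approximation at
`t_N = N h` to the solution of `y' = z y + g`, `y(0) = 0`. -/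
def cqKernel {s : ℕ} (rk : RungeKutta s) (A : X →ₗ.[ℂ] X) (α h : ℝ) (g : ℝ → X) (N : ℕ) (z : ℂ) :
    X :=
  resolventOp A (z ^ (α : ℂ)) (rk.approx g h z N)

/-- The Runge–Kutta convolution quadrature approximation
`u_N = (2πi)⁻¹ ∫_Γ (z^α - A)⁻¹ y_{z,N} dz` of
`u(t_N) = (2πi)⁻¹ ∫_Γ (z^α - A)⁻¹ y_z(t_N) dz`. -/
def cqApprox {s : ℕ} (rk : RungeKutta s) (A : X →ₗ.[ℂ] X) (α h : ℝ) (γ : ℝ → ℂ) (g : ℝ → X)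
    (N : ℕ) : X :=
  contourInt γ (cqKernel rk A α h g N)

end FracCQ

end

open FracCQ

/-!
For a stiffly accurate method `bᵀ = e_sᵀ 𝒜`, so that `bᵀ 𝒜⁻¹ = e_sᵀ` and
`Δ(ζ) = 𝒜⁻¹ - ζ 𝒜⁻¹ 𝟙 e_sᵀ` is affine in `ζ`. Put `M = h⁻¹ 𝒜⁻¹` and `E = h⁻¹ 𝒜⁻¹ 𝟙 e_sᵀ`. For `ζ`
near `0` the eigenvalues of `M - ζ E` stay in the sector and to the right of `Γ`, and
`((M - ζ E)^α ⊗ Id - Id_s ⊗ A)⁻¹ = -(2πi)⁻¹ ∫_Γ (z - (M - ζ E))⁻¹ ⊗ (z^α - A)⁻¹ dz`.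
Expanding the matrix resolvent in a Neumann series in `ζ` gives the weights as contour integrals,
and the last row of the `n`-th term is `-h r(hz)ⁿ q(hz)`. Any vertical line with the eigenvalues of
`M` on its right may be used in place of `Γ`, which gives the existence of the weights.

For the integral formula, divide by `z - M`: by Cayley-Hamilton and Hermite interpolation,
`F(z) = Id_s ⊗ (z^α - A)⁻¹` is `Φ + (z - M) Ψ(z)` with `Φ` constant and `Ψ` holomorphic on the
sector, and likewise `z^α = M^α + (z - M) ψ(z)`. By Liouville's theorem the identity
`(z^α - A) F(z) = 1` passes to `M^α` and `Φ`, so `Φ` is the inverse on the left-hand side. In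
`(z - M)⁻¹ F(z) = (z - M)⁻¹ Φ + Ψ(z)` neither term on the right is integrable along `Γ`, but
`(z - M)⁻¹ - z⁻¹` and `Ψ(z) + z⁻¹ Φ` are. The first integrates to `-2πi`, by partial fractions and a
winding number computation; the second has a primitive that vanishes at infinity, obtained by
integration along rays, so its integral is `0`.
-/

namespace FracCQ

open MeasureTheory Set

section Decay

variable {E : Type*} [NormedAddCommGroup E] {K : Set ℂ} {k l : ℝ} {φ ψ : ℂ → E}

/-- `φ` is continuous on `K` and `φ z = O((1 + |z|)^(-k))` there. This is the quantitative form in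
which integrability along contours is established. -/
def HasDecay (K : Set ℂ) (k : ℝ) (φ : ℂ → E) : Prop :=
  ContinuousOn φ K ∧ ∃ C : ℝ, 0 ≤ C ∧ ∀ z ∈ K, ‖φ z‖ ≤ C * (1 + ‖z‖) ^ (-k)

theorem HasDecay.of_le (hφ : HasDecay K k φ) (hl : l ≤ k) : HasDecay K l φ := by
  obtain ⟨hc, C, hC, hb⟩ := hφ
  refine ⟨hc, C, hC, fun z hz => (hb z hz).trans ?_⟩
  gcongr
  linarith [norm_nonneg z]

theorem HasDecay.congr (hφ : HasDecay K k φ) (h : EqOn ψ φ K) : HasDecay K k ψ := by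
  obtain ⟨hc, C, hC, hb⟩ := hφ
  exact ⟨hc.congr h, C, hC, fun z hz => by rw [h hz]; exact hb z hz⟩

theorem hasDecay_const (K : Set ℂ) (c : E) : HasDecay K 0 (fun _ => c) :=
  ⟨continuousOn_const, ‖c‖, norm_nonneg _, fun z _ => by simp⟩

theorem HasDecay.neg (hφ : HasDecay K k φ) : HasDecay K k (fun z => -φ z) := by
  obtain ⟨hc, C, hC, hb⟩ := hφ
  exact ⟨hc.neg, C, hC, fun z hz => by rw [norm_neg]; exact hb z hz⟩

theorem mul_le_of_le_rpow_neg {C C' a b t : ℝ} (ht : 0 < t) (hC : 0 ≤ C) (hb0 : 0 ≤ b)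
    (ha : a ≤ C * t ^ (-k)) (hb : b ≤ C' * t ^ (-l)) : a * b ≤ C * C' * t ^ (-(k + l)) := by
  rw [neg_add, Real.rpow_add ht]
  calc a * b ≤ (C * t ^ (-k)) * (C' * t ^ (-l)) := by gcongr
    _ = _ := by ring

theorem HasDecay.smul [NormedSpace ℂ E] {φ : ℂ → ℂ} (hφ : HasDecay K k φ)
    (hψ : HasDecay K l ψ) : HasDecay K (k + l) (fun z => φ z • ψ z) := by
  obtain ⟨hc, C, hC, hb⟩ := hφ
  obtain ⟨hc', C', hC', hb'⟩ := hψ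
  refine ⟨hc.smul hc', C * C', by positivity, fun z hz => ?_⟩
  rw [norm_smul]
  exact mul_le_of_le_rpow_neg (by positivity) hC (norm_nonneg _) (hb z hz) (hb' z hz)

theorem HasDecay.mul {𝔅 : Type*} [NormedRing 𝔅] {φ ψ : ℂ → 𝔅} (hφ : HasDecay K k φ)
    (hψ : HasDecay K l ψ) : HasDecay K (k + l) (fun z => φ z * ψ z) := by
  obtain ⟨hc, C, hC, hb⟩ := hφ
  obtain ⟨hc', C', hC', hb'⟩ := hψ
  refine ⟨hc.mul hc', C * C', by positivity, fun z hz => (norm_mul_le _ _).trans ?_⟩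
  exact mul_le_of_le_rpow_neg (by positivity) hC (norm_nonneg _) (hb z hz) (hb' z hz)

theorem hasDecay_of_isBigO (hK : IsClosed K) (hφ : ContinuousOn φ K)
    (h : φ =O[cocompact ℂ ⊓ 𝓟 K] fun z => (1 + ‖z‖) ^ (-k)) : HasDecay K k φ := by
  obtain ⟨C, hC, hbound⟩ := h.exists_pos
  obtain ⟨T, hT, hTC⟩ := mem_cocompact.1 (eventually_inf_principal.1 hbound.bound)
  have hc : ContinuousOn (fun z : ℂ => (1 + ‖z‖) ^ k * ‖φ z‖) (K ∩ T) :=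
    ContinuousOn.mul (Continuous.continuousOn <| (continuous_const.add continuous_norm).rpow_const
      fun z => Or.inl (show (1 : ℝ) + ‖z‖ ≠ 0 by positivity)) (hφ.mono inter_subset_left).norm
  obtain ⟨B, hB⟩ := (hT.inter_left hK).exists_bound_of_continuousOn hc
  refine ⟨hφ, max C B, hC.le.trans (le_max_left _ _), fun z hz => ?_⟩
  have hz1 : 0 < 1 + ‖z‖ := by positivity
  by_cases hzT : z ∈ T
  · have hzB := (Real.le_norm_self _).trans (hB z ⟨hz, hzT⟩)
    rw [Real.rpow_neg hz1.le, ← div_eq_mul_inv, le_div_iff₀ (by positivity), mul_comm]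
    exact hzB.trans (le_max_right _ _)
  · have hzC : ‖φ z‖ ≤ C * ‖(1 + ‖z‖) ^ (-k)‖ := hTC hzT hz
    rw [Real.norm_of_nonneg (by positivity)] at hzC
    exact hzC.trans (by gcongr; exact le_max_left _ _)

theorem isBigO_inv_one_add_norm :
    (fun z : ℂ => z⁻¹) =O[cocompact ℂ] fun z => (1 + ‖z‖) ^ (-1 : ℝ) := by
  refine Asymptotics.IsBigO.of_bound 2 ?_
  filter_upwards [tendsto_norm_cocompact_atTop.eventually_ge_atTop 1] with z hz
  rw [Real.rpow_neg_one, norm_inv, norm_inv, Real.norm_of_nonneg (by positivity),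
    ← div_eq_mul_inv, inv_eq_one_div, div_le_div_iff₀ (by positivity) (by positivity)]
  linarith

section Resolvent

variable {𝔅 : Type*} [NormedRing 𝔅] [NormedAlgebra ℂ 𝔅] [CompleteSpace 𝔅]

theorem isBigO_resolvent (m : 𝔅) :
    resolvent m =O[cocompact ℂ] fun z => (1 + ‖z‖) ^ (-1 : ℝ) :=
  Asymptotics.IsBigO.trans (Metric.cobounded_eq_cocompact (α := ℂ) ▸
    spectrum.resolvent_isBigO_inv m) isBigO_inv_one_add_norm

theorem hasDecay_resolvent (m : 𝔅) (hK : IsClosed K) (hKm : K ⊆ resolventSet ℂ m) :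
    HasDecay K 1 (resolvent m) :=
  hasDecay_of_isBigO hK (fun _ hz => (spectrum.hasDerivAt_resolvent_const_left
    (hKm hz)).continuousAt.continuousWithinAt) ((isBigO_resolvent m).mono inf_le_left)

end Resolvent

theorem hasDecay_inv_sub (hK : IsClosed K) {a : ℂ} (ha : a ∉ K) :
    HasDecay K 1 (fun z => (z - a)⁻¹) := by
  refine (hasDecay_resolvent a hK fun z hz => ?_).congr fun z _ => by simp [resolvent]
  exact (sub_ne_zero.2 (ne_of_mem_of_not_mem hz ha)).isUnit

theorem hasDecay_prod_inv (hK : IsClosed K) (S : Multiset ℂ) (hS : ∀ a ∈ S, a ∉ K) :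
    HasDecay K (Multiset.card S) (fun z => (S.map fun a => (z - a)⁻¹).prod) := by
  induction S using Multiset.induction_on with
  | empty => simpa using hasDecay_const K (1 : ℂ)
  | cons a S ih =>
    have := (hasDecay_inv_sub hK (hS a (by simp))).mul (ih fun b hb => hS b (by simp [hb]))
    simpa [add_comm] using this

end Decay

section UpwardContour

/-- A locally Lipschitz, piecewise differentiable curve which comes from infinity, goes to infinity
and, near both ends, runs upwards at an angle with the horizontal that is bounded away from `0`.
This is what convergence and contour deformation need from the contours of the theorem; vertical
lines are also of this type. -/
structure IsUpwardContour (γ : ℝ → ℂ) : Prop where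
  locallyLipschitz : LocallyLipschitz γ
  differentiableAt : ∃ F : Set ℝ, F.Finite ∧ ∀ x ∉ F, DifferentiableAt ℝ γ x
  tendsto_atTop : Tendsto γ atTop (cocompact ℂ)
  tendsto_atBot : Tendsto γ atBot (cocompact ℂ)
  deriv_bound : ∃ C : ℝ, 0 < C ∧ ∀ᶠ x in cocompact ℝ, ‖deriv γ x‖ ≤ C * (deriv γ x).im

theorem norm_sub_le_mul_im_sub {η : ℝ → ℂ} {C a x : ℝ} (hax : a ≤ x)
    (hd : ∀ y ≥ a, DifferentiableAt ℝ η y)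
    (hb : ∀ y ≥ a, ‖deriv η y‖ ≤ C * (deriv η y).im) :
    ‖η x - η a‖ ≤ C * ((η x).im - (η a).im) := by
  have him : ∀ y ≥ a, HasDerivAt (fun y => (η y).im) (deriv η y).im y := fun y hy =>
    Complex.imCLM.hasFDerivAt.comp_hasDerivAt y (hd y hy).hasDerivAt
  refine image_norm_le_of_norm_deriv_right_le_deriv_boundary' (f := fun y => η y - η a)
    (B := fun y => C * ((η y).im - (η a).im)) (fun y hy => ?_)
    (fun y hy => ((hd y hy.1).hasDerivAt.sub_const _).hasDerivWithinAt) (by simp) (fun y hy => ?_)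
    (fun y hy => (((him y hy.1).sub_const _).const_mul C).hasDerivWithinAt)
    (fun y hy => hb y hy.1) ⟨hax, le_rfl⟩
  · exact ((hd y hy.1).continuousAt.sub continuousAt_const).continuousWithinAt
  · exact (((him y hy.1).continuousAt.sub continuousAt_const).const_smul C).continuousWithinAt

theorem integrableOn_norm_deriv_mul_rpow {η : ℝ → ℂ} {C β b : ℝ} (hC : 0 < C) (hβ : 0 < β)
    (hd : ∀ y ≥ b, DifferentiableAt ℝ η y)
    (hb : ∀ y ≥ b, ‖deriv η y‖ ≤ C * (deriv η y).im) (hpos : ∀ y ≥ b, 0 < (η y).im)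
    (hlim : Tendsto (fun x => (η x).im) atTop atTop) :
    IntegrableOn (fun x => ‖deriv η x‖ * (1 + ‖η x‖) ^ (-(1 + β))) (Ioi b) := by
  have hderiv : ∀ x ∈ Ici b, HasDerivAt (fun x => -((η x).im ^ (-β) / β))
      ((deriv η x).im * (η x).im ^ (-(1 + β))) x := fun x hx => by
    have him : HasDerivAt (fun y => (η y).im) (deriv η x).im x :=
      Complex.imCLM.hasFDerivAt.comp_hasDerivAt x (hd x hx).hasDerivAt
    refine ((him.rpow_const (p := -β) (Or.inl (hpos x hx).ne')).div_const β).neg.congr_deriv ?_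
    rw [show -β - 1 = -(1 + β) by ring]
    field_simp
  have hnonneg : ∀ x ≥ b, 0 ≤ (deriv η x).im := fun x hx =>
    nonneg_of_mul_nonneg_right ((norm_nonneg _).trans (hb x hx)) hC
  have hmajorant := integrableOn_Ioi_deriv_of_nonneg' (l := 0) hderiv
    (fun x hx => mul_nonneg (hnonneg x hx.le) (Real.rpow_nonneg (hpos x hx.le).le _))
    (by simpa using (((tendsto_rpow_neg_atTop hβ).comp hlim).div_const β).neg)
  refine (hmajorant.const_mul C).mono' ?_ ?_
  · have hη : ContinuousOn η (Ioi b) := fun x hx =>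
      (hd x (le_of_lt hx)).continuousAt.continuousWithinAt
    refine (measurable_deriv η).norm.aestronglyMeasurable.mul
      (ContinuousOn.aestronglyMeasurable ?_ measurableSet_Ioi)
    exact (continuousOn_const.add hη.norm).rpow_const fun x _ =>
      Or.inl (show (1 : ℝ) + ‖η x‖ ≠ 0 by positivity)
  · refine (ae_restrict_iff' measurableSet_Ioi).2 (ae_of_all _ fun x hx => ?_)
    have hxb : b ≤ x := le_of_lt hx
    rw [Real.norm_of_nonneg (by positivity), ← mul_assoc]
    refine mul_le_mul (hb x hxb) ?_ (by positivity) (mul_nonneg hC.le (hnonneg x hxb))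
    refine Real.rpow_le_rpow_of_nonpos (hpos x hxb) ?_ (by linarith)
    linarith [Complex.im_le_norm (η x)]

theorem deriv_conj_comp_neg (γ : ℝ → ℂ) (x : ℝ) :
    deriv (fun x => (starRingEnd ℂ) (γ (-x))) x = -(starRingEnd ℂ) (deriv γ (-x)) := by
  rw [deriv_comp_neg (fun y => (starRingEnd ℂ) (γ y))]
  congr 1
  exact deriv.star (f := γ)

namespace IsUpwardContour

variable {γ : ℝ → ℂ}

theorem conj_neg (hγ : IsUpwardContour γ) :
    IsUpwardContour fun x => (starRingEnd ℂ) (γ (-x)) where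
  locallyLipschitz := Complex.conjLIE.lipschitz.locallyLipschitz.comp
    (hγ.locallyLipschitz.comp (LipschitzWith.id.neg).locallyLipschitz)
  differentiableAt := by
    obtain ⟨F, hF, hd⟩ := hγ.differentiableAt
    refine ⟨Neg.neg ⁻¹' F, hF.preimage neg_injective.injOn, fun x hx => ?_⟩
    exact Complex.conjCLE.differentiableAt.comp x ((hd (-x) hx).comp x differentiableAt_id.neg)
  tendsto_atTop := Complex.conjCLE.toHomeomorph.isClosedEmbedding.tendsto_cocompact.comp
    (hγ.tendsto_atBot.comp tendsto_neg_atTop_atBot)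
  tendsto_atBot := Complex.conjCLE.toHomeomorph.isClosedEmbedding.tendsto_cocompact.comp
    (hγ.tendsto_atTop.comp tendsto_neg_atBot_atTop)
  deriv_bound := by
    obtain ⟨C, hC, hb⟩ := hγ.deriv_bound
    refine ⟨C, hC, ?_⟩
    filter_upwards [(Homeomorph.neg ℝ).isClosedEmbedding.tendsto_cocompact.eventually hb] with x hx
    rw [deriv_conj_comp_neg]
    simpa using hx

theorem exists_deriv_bound_Ici (hγ : IsUpwardContour γ) : ∃ C a : ℝ, 0 < C ∧
    (∀ x ≥ a, DifferentiableAt ℝ γ x) ∧ ∀ x ≥ a, ‖deriv γ x‖ ≤ C * (deriv γ x).im := by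
  obtain ⟨F, hF, hd⟩ := hγ.differentiableAt
  obtain ⟨C, hC, hb⟩ := hγ.deriv_bound
  obtain ⟨B, hB⟩ := hF.bddAbove
  obtain ⟨a, ha⟩ := eventually_atTop.1 (hb.filter_mono atTop_le_cocompact)
  refine ⟨C, max a (B + 1), hC, fun x hx => hd x fun hxF => ?_,
    fun x hx => ha x ((le_max_left _ _).trans hx)⟩
  linarith [hB hxF, (le_max_right a (B + 1)).trans hx]

theorem tendsto_im_atTop (hγ : IsUpwardContour γ) : Tendsto (fun x => (γ x).im) atTop atTop := by
  obtain ⟨C, a, hC, hd, hb⟩ := hγ.exists_deriv_bound_Ici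
  have hnorm : Tendsto (fun x => ‖γ x‖) atTop atTop :=
    (tendsto_norm_cocompact_atTop (E := ℂ)).comp hγ.tendsto_atTop
  have hlower : Tendsto (fun x => C⁻¹ * (‖γ x‖ - ‖γ a‖) + (γ a).im) atTop atTop :=
    tendsto_atTop_add_const_right _ _
      ((tendsto_atTop_add_const_right _ _ hnorm).const_mul_atTop (inv_pos.2 hC))
  refine tendsto_atTop_mono' _ ?_ hlower
  filter_upwards [eventually_ge_atTop a] with x hx
  rw [← le_sub_iff_add_le, inv_mul_le_iff₀ hC]
  exact (norm_sub_norm_le (γ x) (γ a)).trans (norm_sub_le_mul_im_sub hx hd hb)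

theorem tendsto_im_atBot (hγ : IsUpwardContour γ) : Tendsto (fun x => (γ x).im) atBot atBot := by
  have h := tendsto_neg_atTop_atBot.comp (hγ.conj_neg.tendsto_im_atTop.comp tendsto_neg_atBot_atTop)
  simpa [Function.comp_def] using h

theorem integrableAtFilter_atTop (hγ : IsUpwardContour γ) {β : ℝ} (hβ : 0 < β) :
    IntegrableAtFilter (fun x => ‖deriv γ x‖ * (1 + ‖γ x‖) ^ (-(1 + β))) atTop := by
  obtain ⟨C, a, hC, hd, hb⟩ := hγ.exists_deriv_bound_Ici
  obtain ⟨b, hpos⟩ := eventually_atTop.1 (hγ.tendsto_im_atTop.eventually_gt_atTop 0)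
  refine ⟨Ioi (max a b), Ioi_mem_atTop _, integrableOn_norm_deriv_mul_rpow hC hβ
    (fun x hx => hd x ((le_max_left _ _).trans hx)) (fun x hx => hb x ((le_max_left _ _).trans hx))
    (fun x hx => hpos x ((le_max_right _ _).trans hx)) hγ.tendsto_im_atTop⟩

theorem integrableAtFilter_atBot (hγ : IsUpwardContour γ) {β : ℝ} (hβ : 0 < β) :
    IntegrableAtFilter (fun x => ‖deriv γ x‖ * (1 + ‖γ x‖) ^ (-(1 + β))) atBot := by
  obtain ⟨s, hs, hi⟩ := hγ.conj_neg.integrableAtFilter_atTop hβ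
  refine ⟨Neg.neg ⁻¹' s, tendsto_neg_atBot_atTop hs, ?_⟩
  have h := ((Measure.measurePreserving_neg (volume : Measure ℝ)).integrableOn_comp_preimage
    (Homeomorph.neg ℝ).measurableEmbedding (s := s)).2 hi
  simpa [Function.comp_def, deriv_conj_comp_neg] using h

theorem locallyIntegrable (hγ : IsUpwardContour γ) {β : ℝ} (hβ : 0 < β) :
    LocallyIntegrable fun x => ‖deriv γ x‖ * (1 + ‖γ x‖) ^ (-(1 + β)) := by
  intro x
  obtain ⟨K, t, ht, hK⟩ := hγ.locallyLipschitz x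
  obtain ⟨u, hut, hu, hxu⟩ := mem_nhds_iff.1 ht
  obtain ⟨ε, hε, hεu⟩ := Metric.isOpen_iff.1 hu x hxu
  refine ⟨Metric.ball x ε, Metric.ball_mem_nhds x hε, ?_⟩
  refine Measure.integrableOn_of_bounded (M := K)
    (by simp [Real.volume_ball, ENNReal.mul_eq_top]) ?_ ?_
  · refine (measurable_deriv γ).norm.aestronglyMeasurable.mul (Continuous.aestronglyMeasurable ?_)
    exact (continuous_const.add hγ.locallyLipschitz.continuous.norm).rpow_const
      fun x => Or.inl (show (1 : ℝ) + ‖γ x‖ ≠ 0 by positivity)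
  · refine (ae_restrict_iff' measurableSet_ball).2 (ae_of_all _ fun y hy => ?_)
    have hderiv := norm_deriv_le_of_lipschitzOn (hu.mem_nhds (hεu hy)) (hK.mono hut)
    rw [Real.norm_of_nonneg (by positivity)]
    refine (mul_le_of_le_one_right (norm_nonneg _) ?_).trans hderiv
    exact Real.rpow_le_one_of_one_le_of_nonpos (by linarith [norm_nonneg (γ y)]) (by linarith)

theorem integrable_norm_deriv_mul_rpow (hγ : IsUpwardContour γ) {β : ℝ} (hβ : 0 < β) :
    Integrable fun x => ‖deriv γ x‖ * (1 + ‖γ x‖) ^ (-(1 + β)) :=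
  integrable_iff_integrableAtFilter_atBot_atTop.2
    ⟨⟨hγ.integrableAtFilter_atBot hβ, hγ.integrableAtFilter_atTop hβ⟩, hγ.locallyIntegrable hβ⟩

theorem isClosed_range (hγ : IsUpwardContour γ) : IsClosed (range γ) := by
  have : IsProperMap γ := isProperMap_iff_tendsto_cocompact.2 ⟨hγ.locallyLipschitz.continuous, by
    rw [cocompact_eq_atBot_atTop]
    exact hγ.tendsto_atBot.sup hγ.tendsto_atTop⟩
  exact this.isClosedMap.isClosed_range

variable {E : Type*} [NormedAddCommGroup E] [NormedSpace ℂ E]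

theorem integrable_smul (hγ : IsUpwardContour γ) {φ : ℂ → E} {k : ℝ}
    (hφ : HasDecay (range γ) k φ) (hk : 1 < k) : Integrable fun x => deriv γ x • φ (γ x) := by
  obtain ⟨hc, C, _, hb⟩ := hφ
  have hmajorant := (hγ.integrable_norm_deriv_mul_rpow (sub_pos.2 hk)).const_mul C
  simp only [add_sub_cancel] at hmajorant
  refine hmajorant.mono' ?_ (ae_of_all _ fun x => ?_)
  · exact (measurable_deriv γ).aestronglyMeasurable.smul
      (hc.comp_continuous hγ.locallyLipschitz.continuous mem_range_self).aestronglyMeasurable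
  · rw [norm_smul, mul_left_comm]
    gcongr
    exact hb _ (mem_range_self x)

theorem integral_eq_sub [CompleteSpace E] (hγ : IsUpwardContour γ) {H G : ℂ → E}
    (hH : ∀ x, HasDerivAt H (G (γ x)) (γ x))
    (hi : Integrable fun x => deriv γ x • G (γ x)) {lt lb : E}
    (ht : Tendsto (fun x => H (γ x)) atTop (𝓝 lt)) (hb : Tendsto (fun x => H (γ x)) atBot (𝓝 lb)) :
    ∫ x, deriv γ x • G (γ x) = lt - lb := by
  obtain ⟨F, hF, hd⟩ := hγ.differentiableAt
  have hsymm : ∀ n : ℝ, ∫ x in (-n)..n, deriv γ x • G (γ x) = H (γ n) - H (γ (-n)) := fun n =>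
    integral_eq_of_hasDerivAt_off_countable (fun x => H (γ x)) _ hF.countable
      (fun x _ => ((hH x).continuousAt.comp
        hγ.locallyLipschitz.continuous.continuousAt).continuousWithinAt)
      (fun x hx => (hH x).scomp x (hd x hx.2).hasDerivAt) hi.intervalIntegrable
  refine tendsto_nhds_unique (intervalIntegral_tendsto_integral hi tendsto_neg_atTop_atBot
    tendsto_id) ((ht.sub (hb.comp tendsto_neg_atTop_atBot)).congr fun n => ?_)
  exact (hsymm n).symm

end IsUpwardContour

end UpwardContour

section Winding

variable {γ : ℝ → ℂ} {p q : ℂ}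

theorem tendsto_inv_sub_of_tendsto_cocompact {l : Filter ℝ} (h : Tendsto γ l (cocompact ℂ))
    (a : ℂ) : Tendsto (fun x => (γ x - a)⁻¹) l (𝓝 0) := by
  refine tendsto_inv₀_cobounded.comp ?_
  rw [← tendsto_norm_atTop_iff_cobounded]
  have hnorm : Tendsto (fun x => ‖γ x‖ - ‖a‖) l atTop :=
    tendsto_atTop_add_const_right _ _ ((tendsto_norm_cocompact_atTop (E := ℂ)).comp h)
  exact tendsto_atTop_mono (fun x => norm_sub_norm_le _ _) hnorm

theorem tendsto_log_div_of_tendsto_cocompact {l : Filter ℝ} (h : Tendsto γ l (cocompact ℂ))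
    (p q : ℂ) : Tendsto (fun x => Complex.log ((γ x - p) / (γ x - q))) l (𝓝 0) := by
  have hquot : Tendsto (fun x => (γ x - p) / (γ x - q)) l (𝓝 1) := by
    have hlim := ((tendsto_inv_sub_of_tendsto_cocompact h q).const_mul (q - p)).const_add 1
    rw [mul_zero, add_zero] at hlim
    refine hlim.congr' ?_
    filter_upwards [h (isCompact_singleton (x := q)).compl_mem_cocompact] with x hx
    have : γ x - q ≠ 0 := sub_ne_zero.2 hx
    field_simp
    ring
  simpa using hquot.clog (by simp)

theorem hasDecay_inv_sub_inv {K : Set ℂ} (hK : IsClosed K) (hp : p ∉ K) (hq : q ∉ K) :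
    HasDecay K 2 (fun z => (z - p)⁻¹ - (z - q)⁻¹) := by
  have := (hasDecay_const K (p - q)).mul ((hasDecay_inv_sub hK hp).mul (hasDecay_inv_sub hK hq))
  norm_num at this
  refine this.congr fun z hz => ?_
  have hzp : z - p ≠ 0 := sub_ne_zero.2 (ne_of_mem_of_not_mem hz hp)
  have hzq : z - q ≠ 0 := sub_ne_zero.2 (ne_of_mem_of_not_mem hz hq)
  field_simp
  ring

theorem div_mem_slitPlane_of_notMem_segment {z : ℂ} (hz : z ∉ segment ℝ p q) :
    (z - p) / (z - q) ∈ Complex.slitPlane := by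
  have hzq : z - q ≠ 0 := sub_ne_zero.2 fun h => hz (h ▸ right_mem_segment ℝ p q)
  by_contra hw
  rw [Complex.mem_slitPlane_iff_not_le_zero, not_not, Complex.le_def] at hw
  obtain ⟨t, ht⟩ : ∃ t : ℝ, (z - p) / (z - q) = -t :=
    ⟨-((z - p) / (z - q)).re, Complex.ext (by simp) (by simpa using hw.2)⟩
  have ht0 : 0 ≤ t := by simpa [ht] using hw.1
  have hne : (1 : ℂ) + t ≠ 0 := by exact_mod_cast (by positivity : 1 + t ≠ 0)
  rw [div_eq_iff hzq] at ht
  refine hz ⟨1 / (1 + t), t / (1 + t), by positivity, by positivity, by field_simp, ?_⟩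
  simp only [Complex.real_smul]
  push_cast
  field_simp
  linear_combination -ht

theorem log_real_sub_sub_log_of_im_pos {z : ℂ} {R : ℝ} (hz : 0 < z.im) :
    Complex.log (R - z) - Complex.log z = Complex.log ((z - R) / z) - Real.pi * Complex.I := by
  have hz0 : z ≠ 0 := fun h => by simp [h] at hz
  have hzR : 0 < (z - R).im := by simpa using hz
  have hzR0 : z - R ≠ 0 := fun h => by simp [h] at hzR
  have hneg : Complex.log (R - z) = Complex.log (z - R) - Real.pi * Complex.I := by
    rw [← neg_sub z (R : ℂ), Complex.log, Complex.log, norm_neg,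
      Complex.arg_neg_eq_arg_sub_pi_of_im_pos hzR]
    push_cast
    ring
  have hdiv : Complex.log ((z - R) / z) = Complex.log (z - R) - Complex.log z := by
    have hlt : z.arg < Real.pi := Complex.arg_lt_pi_iff.2 (Or.inr hz.ne')
    rw [← Complex.log_exp (x := Complex.log (z - R) - Complex.log z), Complex.exp_sub,
      Complex.exp_log hzR0, Complex.exp_log hz0]
    · simp only [Complex.sub_im, Complex.log_im]
      linarith [Complex.arg_nonneg_iff.2 hzR.le]
    · simp only [Complex.sub_im, Complex.log_im]
      linarith [Complex.arg_le_pi (z - R), Complex.arg_nonneg_iff.2 hz.le]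
  rw [hneg, hdiv]
  ring

theorem log_real_sub_sub_log_of_im_neg {z : ℂ} {R : ℝ} (hz : z.im < 0) :
    Complex.log (R - z) - Complex.log z = Complex.log ((z - R) / z) + Real.pi * Complex.I := by
  have hz0 : z ≠ 0 := fun h => by simp [h] at hz
  have hsub : (R - z).arg ≠ Real.pi := fun h =>
    hz.ne (by simpa using (Complex.arg_eq_pi_iff.1 h).2)
  have hdiv : ((z - R) / z).arg ≠ Real.pi := fun h => by
    obtain ⟨hre, him⟩ := Complex.arg_eq_pi_iff.1 h
    have heq := congr_arg Complex.im (div_mul_cancel₀ (z - R) hz0)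
    simp only [Complex.mul_im, him, zero_mul, add_zero, Complex.sub_im, Complex.ofReal_im,
      sub_zero] at heq
    nlinarith
  have h := congr_arg (starRingEnd ℂ) (log_real_sub_sub_log_of_im_pos (z := (starRingEnd ℂ) z)
    (R := R) (by simpa using hz))
  rw [← Complex.conj_ofReal R, ← map_sub, ← map_sub, ← map_div₀, Complex.log_conj _ hsub,
    Complex.log_conj _ hdiv, Complex.log_conj _ fun h => hz.ne (Complex.arg_eq_pi_iff.1 h).2] at h
  simpa using h

namespace IsUpwardContour

theorem integrable_inv_sub_inv (hγ : IsUpwardContour γ) (hp : p ∉ range γ) (hq : q ∉ range γ) :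
    Integrable (fun x => deriv γ x • ((γ x - p)⁻¹ - (γ x - q)⁻¹)) :=
  hγ.integrable_smul (hasDecay_inv_sub_inv hγ.isClosed_range hp hq) (by norm_num)

theorem integral_inv_pow (hγ : IsUpwardContour γ) (hp : p ∉ range γ) (n : ℕ) :
    ∫ x, deriv γ x • ((γ x - p)⁻¹) ^ (n + 2) = 0 := by
  have hi : Integrable (fun x => deriv γ x • ((γ x - p)⁻¹) ^ (n + 2)) := by
    have hdecay := hasDecay_prod_inv hγ.isClosed_range (Multiset.replicate (n + 2) p) fun b hb => by
      rwa [Multiset.eq_of_mem_replicate hb]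
    have := hγ.integrable_smul hdecay (by simp; linarith [(n.cast_nonneg : (0 : ℝ) ≤ n)])
    simpa only [Multiset.map_replicate, Multiset.prod_replicate] using this
  have hlim : ∀ l : Filter ℝ, Tendsto γ l (cocompact ℂ) →
      Tendsto (fun x => -(((γ x - p)⁻¹) ^ (n + 1) / (n + 1))) l (𝓝 0) := fun l hl => by
    simpa using
      (((tendsto_inv_sub_of_tendsto_cocompact hl p).pow (n + 1)).div_const ((n : ℂ) + 1)).neg
  have hderiv : ∀ x, HasDerivAt (fun z => -(((z - p)⁻¹) ^ (n + 1) / ((n : ℂ) + 1)))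
      (((γ x - p)⁻¹) ^ (n + 2)) (γ x) := fun x => by
    have hxp : γ x - p ≠ 0 := sub_ne_zero.2 fun h => hp ⟨x, h⟩
    have hn : (n : ℂ) + 1 ≠ 0 := Nat.cast_add_one_ne_zero n
    have := ((((hasDerivAt_id (γ x)).sub_const p).inv hxp).pow (n + 1)).div_const ((n : ℂ) + 1)
    refine this.neg.congr_deriv ?_
    simp only [Pi.inv_apply, id_eq, Nat.cast_add, Nat.cast_one, add_tsub_cancel_right]
    rw [pow_add _ n 2, inv_pow _ 2]
    field_simp
  simpa using hγ.integral_eq_sub (G := fun z => ((z - p)⁻¹) ^ (n + 2)) hderiv hi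
    (hlim _ hγ.tendsto_atTop) (hlim _ hγ.tendsto_atBot)

theorem integral_inv_sub_inv_of_segment (hγ : IsUpwardContour γ)
    (hpq : segment ℝ p q ⊆ (range γ)ᶜ) :
    ∫ x, deriv γ x • ((γ x - p)⁻¹ - (γ x - q)⁻¹) = 0 := by
  have hp : p ∉ range γ := hpq (left_mem_segment ℝ p q)
  have hq : q ∉ range γ := hpq (right_mem_segment ℝ p q)
  have hderiv : ∀ x, HasDerivAt (fun z => Complex.log ((z - p) / (z - q)))
      ((γ x - p)⁻¹ - (γ x - q)⁻¹) (γ x) := fun x => by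
    have hxp : γ x - p ≠ 0 := sub_ne_zero.2 fun h => hp ⟨x, h⟩
    have hxq : γ x - q ≠ 0 := sub_ne_zero.2 fun h => hq ⟨x, h⟩
    have hslit := div_mem_slitPlane_of_notMem_segment fun h => hpq h (mem_range_self x)
    refine ((((hasDerivAt_id (γ x)).sub_const p).div ((hasDerivAt_id (γ x)).sub_const q)
      hxq).clog hslit).congr_deriv ?_
    simp only [id_eq, Pi.div_apply]
    field_simp
  simpa using hγ.integral_eq_sub (G := fun z => (z - p)⁻¹ - (z - q)⁻¹) hderiv
    (hγ.integrable_inv_sub_inv hp hq) (tendsto_log_div_of_tendsto_cocompact hγ.tendsto_atTop p q)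
    (tendsto_log_div_of_tendsto_cocompact hγ.tendsto_atBot p q)

theorem exists_forall_sub_mem_slitPlane (hγ : IsUpwardContour γ) :
    ∃ R₀ : ℝ, ∀ R : ℝ, R₀ ≤ R → ∀ x, (R : ℂ) - γ x ∈ Complex.slitPlane := by
  obtain ⟨a, ha⟩ := eventually_atTop.1 (hγ.tendsto_im_atTop.eventually_gt_atTop 0)
  obtain ⟨b, hb⟩ := eventually_atBot.1 (hγ.tendsto_im_atBot.eventually_lt_atBot 0)
  obtain ⟨B, hB⟩ := (isCompact_Icc (a := b) (b := a)).exists_bound_of_continuousOn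
    hγ.locallyLipschitz.continuous.continuousOn
  refine ⟨B + 1, fun R hR x => ?_⟩
  rw [Complex.mem_slitPlane_iff]
  rcases le_total a x with hx | hx
  · exact Or.inr (by simpa using (ha x hx).ne')
  rcases le_total x b with hx' | hx'
  · exact Or.inr (by simpa using (hb x hx').ne)
  · refine Or.inl ?_
    have := (Complex.re_le_norm (γ x)).trans (hB x ⟨hx', hx⟩)
    rw [Complex.sub_re, Complex.ofReal_re]
    linarith

theorem integral_inv_sub_inv_of_sub_mem_slitPlane (hγ : IsUpwardContour γ)
    (h0 : ∀ x, γ x ∈ Complex.slitPlane) {R : ℝ} (hR : ∀ x, (R : ℂ) - γ x ∈ Complex.slitPlane) :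
    ∫ x, deriv γ x • ((γ x - R)⁻¹ - (γ x - 0)⁻¹) = -(2 * Real.pi * Complex.I) := by
  have hne : ∀ x, γ x ≠ 0 := fun x => Complex.slitPlane_ne_zero (h0 x)
  have hneR : ∀ x, (R : ℂ) - γ x ≠ 0 := fun x => Complex.slitPlane_ne_zero (hR x)
  have hlim : ∀ l : Filter ℝ, Tendsto γ l (cocompact ℂ) →
      Tendsto (fun x => Complex.log ((γ x - R) / γ x)) l (𝓝 0) := fun l hl => by
    simpa using tendsto_log_div_of_tendsto_cocompact hl R 0
  have ht : Tendsto (fun x => Complex.log (R - γ x) - Complex.log (γ x)) atTop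
      (𝓝 (0 - Real.pi * Complex.I)) := by
    refine ((hlim _ hγ.tendsto_atTop).sub_const _).congr' ?_
    filter_upwards [hγ.tendsto_im_atTop.eventually_gt_atTop 0] with x hx
    exact (log_real_sub_sub_log_of_im_pos hx).symm
  have hb : Tendsto (fun x => Complex.log (R - γ x) - Complex.log (γ x)) atBot
      (𝓝 (0 + Real.pi * Complex.I)) := by
    refine ((hlim _ hγ.tendsto_atBot).add_const _).congr' ?_
    filter_upwards [hγ.tendsto_im_atBot.eventually_lt_atBot 0] with x hx
    exact (log_real_sub_sub_log_of_im_neg hx).symm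
  have hderiv : ∀ x, HasDerivAt (fun z => Complex.log (R - z) - Complex.log z)
      ((γ x - R)⁻¹ - (γ x - 0)⁻¹) (γ x) := fun x => by
    refine ((((hasDerivAt_id (γ x)).const_sub (R : ℂ)).clog (hR x)).sub
      ((hasDerivAt_id (γ x)).clog (h0 x))).congr_deriv ?_
    simp only [id_eq, sub_zero]
    rw [← neg_sub (γ x) (R : ℂ), neg_div_neg_eq, one_div, one_div]
  rw [hγ.integral_eq_sub (G := fun z => (z - R)⁻¹ - (z - 0)⁻¹) hderiv
    (hγ.integrable_inv_sub_inv (fun ⟨x, hx⟩ => hneR x (by rw [hx, sub_self]))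
      fun ⟨x, hx⟩ => hne x hx) ht hb]
  ring

theorem integral_inv_sub_inv_of_joinedIn (hγ : IsUpwardContour γ)
    (hpq : JoinedIn (range γ)ᶜ p q) :
    ∫ x, deriv γ x • ((γ x - p)⁻¹ - (γ x - q)⁻¹) = 0 := by
  obtain ⟨c, hc⟩ := hpq
  have hp : p ∉ range γ := by simpa using hc 0
  have hloc : IsLocallyConstant fun t => ∫ x, deriv γ x • ((γ x - p)⁻¹ - (γ x - c t)⁻¹) := by
    rw [IsLocallyConstant.iff_eventually_eq]
    intro t
    obtain ⟨ε, hε, h⟩ := Metric.isOpen_iff.1 hγ.isClosed_range.isOpen_compl _ (hc t)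
    filter_upwards [c.continuous.continuousAt.eventually (Metric.ball_mem_nhds _ hε)] with u hu
    rw [← sub_eq_zero, ← integral_sub (hγ.integrable_inv_sub_inv hp (hc u))
      (hγ.integrable_inv_sub_inv hp (hc t)), ← hγ.integral_inv_sub_inv_of_segment
      (((convex_ball (c t) ε).segment_subset (Metric.mem_ball_self hε) hu).trans h)]
    congr 1
    ext x
    rw [← smul_sub, sub_sub_sub_cancel_left]
  simpa using hloc.apply_eq_of_preconnectedSpace 1 0

theorem integral_inv_sub_inv_of_rightOf (hγ : IsUpwardContour γ) (hp : RightOf γ p)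
    (hq : RightOf γ q) : ∫ x, deriv γ x • ((γ x - p)⁻¹ - (γ x - q)⁻¹) = 0 := by
  obtain ⟨R, hR⟩ := hp
  obtain ⟨R', hR'⟩ := hq
  exact hγ.integral_inv_sub_inv_of_joinedIn
    ((hR _ (le_max_left R R')).trans (hR' _ (le_max_right R R')).symm)

theorem integral_inv_sub_inv_zero (hγ : IsUpwardContour γ) (h0 : ∀ x, γ x ∈ Complex.slitPlane)
    (hp : RightOf γ p) :
    ∫ x, deriv γ x • ((γ x - p)⁻¹ - (γ x)⁻¹) = -(2 * Real.pi * Complex.I) := by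
  obtain ⟨R, hR⟩ := hp
  obtain ⟨R', hR'⟩ := hγ.exists_forall_sub_mem_slitPlane
  have hjoined := hR _ (le_max_left R R')
  have hzero : (0 : ℂ) ∉ range γ := fun ⟨x, hx⟩ => Complex.slitPlane_ne_zero (h0 x) hx
  have hsum := integral_add (hγ.integrable_inv_sub_inv hjoined.mem.1 hjoined.mem.2)
    (hγ.integrable_inv_sub_inv hjoined.mem.2 hzero)
  rw [hγ.integral_inv_sub_inv_of_joinedIn hjoined, zero_add,
    hγ.integral_inv_sub_inv_of_sub_mem_slitPlane h0 (hR' _ (le_max_right R R'))] at hsum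
  rw [← hsum]
  congr 1
  ext x
  rw [← smul_add, sub_add_sub_cancel, sub_zero]

end IsUpwardContour

theorem RightOf.notMem_range (hp : RightOf γ p) : p ∉ range γ := by
  obtain ⟨R, hR⟩ := hp
  exact (hR R le_rfl).mem.1

theorem isOpen_setOf_rightOf (hγ : IsClosed (range γ)) : IsOpen {p | RightOf γ p} := by
  rw [Metric.isOpen_iff]
  intro p hp
  obtain ⟨ε, hε, hball⟩ := Metric.isOpen_iff.1 hγ.isOpen_compl p (RightOf.notMem_range hp)
  refine ⟨ε, hε, fun q hq => ?_⟩
  obtain ⟨R, hR⟩ := hp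
  exact ⟨R, fun x hx => (JoinedIn.of_segment_subset
    (((convex_ball p ε).segment_subset hq (Metric.mem_ball_self hε)).trans hball)).trans (hR x hx)⟩

end Winding

section Rays

/-- An open set which avoids `0` and with every point contains the ray from that point to infinity
pointing away from `0`. On such a domain a decaying holomorphic function has a primitive that
vanishes at infinity, so that Cauchy's theorem holds for contours through infinity. -/
structure IsRayDomain (S : Set ℂ) : Prop where
  isOpen : IsOpen S
  zero_notMem : (0 : ℂ) ∉ S
  mul_mem : ∀ z ∈ S, ∀ t : ℝ, 1 ≤ t → (t : ℂ) * z ∈ S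

variable {E : Type*} [NormedAddCommGroup E] [NormedSpace ℂ E] {S : Set ℂ} {G : ℂ → E} {β : ℝ}

/-- The primitive of `G` obtained by integration along the rays that come from infinity; the point
at parameter `t` of the ray ending in `z` is `t * z`. -/
noncomputable def rayPrimitive (G : ℂ → E) (z : ℂ) : E := -∫ t : ℝ in Ioi 1, z • G (t * z)

theorem integrableOn_Ioi_one_rpow (hβ : 0 < β) :
    IntegrableOn (fun t : ℝ => t ^ (-(1 + β))) (Ioi 1) :=
  integrableOn_Ioi_rpow_of_lt (by linarith) one_pos

theorem norm_smul_comp_mul_le {C t : ℝ} {z : ℂ} (hC : 0 ≤ C) (hβ : 0 < β) (ht : 0 < t) (hz : z ≠ 0)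
    (h : ‖G (t * z)‖ ≤ C * (1 + ‖t * z‖) ^ (-(1 + β))) :
    ‖z • G (t * z)‖ ≤ C * ‖z‖ ^ (-β) * t ^ (-(1 + β)) := by
  have hz0 : 0 < ‖z‖ := norm_pos_iff.2 hz
  calc ‖z • G (t * z)‖ ≤ ‖z‖ * (C * (t * ‖z‖) ^ (-(1 + β))) := by
        rw [norm_smul]
        refine mul_le_mul_of_nonneg_left (h.trans (mul_le_mul_of_nonneg_left ?_ hC)) hz0.le
        refine Real.rpow_le_rpow_of_nonpos (by positivity) ?_ (by linarith)
        rw [norm_mul, Complex.norm_of_nonneg ht.le]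
        linarith
    _ = C * (‖z‖ ^ (1 : ℝ) * ‖z‖ ^ (-(1 + β))) * t ^ (-(1 + β)) := by
        rw [Real.mul_rpow ht.le hz0.le, Real.rpow_one]
        ring
    _ = _ := by
        rw [← Real.rpow_add hz0]
        congr 3
        ring

namespace IsRayDomain

theorem exists_isClosed_forall_mul_mem (hS : IsRayDomain S) {K : Set ℂ} (hK : IsCompact K)
    (hKS : K ⊆ S) : ∃ L ⊆ S, IsClosed L ∧ ∀ z ∈ K, ∀ t : ℝ, 1 ≤ t → (t : ℂ) * z ∈ L := by
  have hclosed : IsClosed {p : unitInterval × ℂ | ((p.1 : ℝ) : ℂ) * p.2 ∈ K} :=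
    hK.isClosed.preimage (by fun_prop)
  refine ⟨_, ?_, isClosedMap_snd_of_compactSpace _ hclosed, fun z hz t ht => ?_⟩
  · rintro _ ⟨⟨⟨s, hs0, hs1⟩, w⟩, hw, rfl⟩
    have hs : s ≠ 0 := fun h => hS.zero_notMem (by simpa [h] using hKS hw)
    have hmem := hS.mul_mem _ (hKS hw) s⁻¹ ((one_le_inv₀ (hs0.lt_of_ne' hs)).2 hs1)
    simpa [hs] using hmem
  · have ht0 : 0 < t := by linarith
    have ht' : (t : ℂ) ≠ 0 := by exact_mod_cast ht0.ne'
    exact ⟨(⟨t⁻¹, by positivity, inv_le_one_of_one_le₀ ht⟩, t * z), by simpa [ht'] using hz, rfl⟩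

theorem exists_norm_smul_comp_mul_le (hS : IsRayDomain S) (hG : ContinuousOn G S) (hβ : 0 < β)
    (hb : G =O[cocompact ℂ ⊓ 𝓟 S] fun z => (1 + ‖z‖) ^ (-(1 + β))) {K : Set ℂ} (hK : IsCompact K)
    (hKS : K ⊆ S) :
    ∃ M : ℝ, ∀ z ∈ K, ∀ t : ℝ, 1 ≤ t → ‖z • G (t * z)‖ ≤ M * t ^ (-(1 + β)) := by
  obtain ⟨L, hLS, hL, hKL⟩ := hS.exists_isClosed_forall_mul_mem hK hKS
  obtain ⟨-, C, hC, hCG⟩ := hasDecay_of_isBigO hL (hG.mono hLS)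
    (hb.mono (inf_le_inf_left _ (principal_mono.2 hLS)))
  have hne : ∀ z ∈ K, z ≠ 0 := fun z hz h => hS.zero_notMem (h ▸ hKS hz)
  obtain ⟨B, hB⟩ := hK.exists_bound_of_continuousOn (f := fun z => ‖z‖ ^ (-β))
    (continuous_norm.continuousOn.rpow_const fun z hz => Or.inl (norm_ne_zero_iff.2 (hne z hz)))
  refine ⟨C * B, fun z hz t ht => ?_⟩
  refine (norm_smul_comp_mul_le hC hβ (by linarith) (hne z hz) (hCG _ (hKL z hz t ht))).trans ?_
  gcongr
  exact (Real.le_norm_self _).trans (hB z hz)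

theorem tendsto_rayPrimitive (hS : IsRayDomain S) (hβ : 0 < β)
    (hb : G =O[cocompact ℂ ⊓ 𝓟 S] fun z => (1 + ‖z‖) ^ (-(1 + β))) :
    Tendsto (rayPrimitive G) (cocompact ℂ ⊓ 𝓟 S) (𝓝 0) := by
  obtain ⟨C, hC, hbound⟩ := hb.exists_pos
  obtain ⟨T, hT, hTC⟩ := mem_cocompact.1 (eventually_inf_principal.1 hbound.bound)
  obtain ⟨R, hR⟩ := hT.isBounded.exists_norm_le
  have hnorm : Tendsto (fun z : ℂ => ‖z‖) (cocompact ℂ ⊓ 𝓟 S) atTop :=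
    (tendsto_norm_cocompact_atTop (E := ℂ)).mono_left inf_le_left
  have hlim := ((tendsto_rpow_neg_atTop hβ).comp hnorm).const_mul (C * ∫ t in Ioi 1, t ^ (-(1 + β)))
  rw [mul_zero] at hlim
  refine squeeze_zero_norm' ?_ hlim
  filter_upwards [hnorm.eventually_gt_atTop R, mem_inf_of_right (mem_principal_self S)]
    with z hzR hz
  have hz0 : z ≠ 0 := fun h => hS.zero_notMem (h ▸ hz)
  rw [rayPrimitive, norm_neg]
  refine (norm_integral_le_of_norm_le ((integrableOn_Ioi_one_rpow hβ).const_mul (C * ‖z‖ ^ (-β)))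
    ((ae_restrict_iff' measurableSet_Ioi).2 (ae_of_all _ fun t ht => ?_))).trans_eq ?_
  · have ht1 : 1 ≤ t := le_of_lt ht
    refine norm_smul_comp_mul_le hC.le hβ (by linarith) hz0 ?_
    have hfar : (t : ℂ) * z ∉ T := fun h => by
      have := hR _ h
      rw [norm_mul, Complex.norm_of_nonneg (by linarith)] at this
      nlinarith [norm_nonneg z]
    have : ‖G (t * z)‖ ≤ C * ‖(1 + ‖(t : ℂ) * z‖) ^ (-(1 + β))‖ :=
      hTC hfar (hS.mul_mem z hz t ht1)
    rwa [Real.norm_of_nonneg (by positivity)] at this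
  · rw [integral_const_mul]
    simp only [Function.comp_apply]
    ring

theorem hasDerivAt_smul_comp_mul (hS : IsRayDomain S) (hG : DifferentiableOn ℂ G S) {t : ℝ}
    (ht : 1 ≤ t) {z : ℂ} (hz : z ∈ S) :
    HasDerivAt (fun z : ℂ => z • G (t * z)) (G (t * z) + (t * z) • deriv G (t * z)) z := by
  have hd : HasDerivAt G (deriv G (t * z)) (t * z) :=
    (hG.differentiableAt (hS.isOpen.mem_nhds (hS.mul_mem z hz t ht))).hasDerivAt
  refine ((hasDerivAt_id z).smul (hd.scomp z ((hasDerivAt_id z).const_mul (t : ℂ)))).congr_deriv ?_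
  simp only [id_eq, mul_one, Function.comp_apply, one_smul, smul_smul]
  rw [add_comm, mul_comm z]

theorem hasDerivAt_ofReal_smul_comp_mul (hS : IsRayDomain S) (hG : DifferentiableOn ℂ G S) {t : ℝ}
    (ht : 1 ≤ t) {z : ℂ} (hz : z ∈ S) :
    HasDerivAt (fun t : ℝ => (t : ℂ) • G (t * z)) (G (t * z) + (t * z) • deriv G (t * z)) t := by
  have hd : HasDerivAt G (deriv G (t * z)) (t * z) :=
    (hG.differentiableAt (hS.isOpen.mem_nhds (hS.mul_mem z hz t ht))).hasDerivAt
  have hcoe : HasDerivAt (fun t : ℝ => (t : ℂ)) 1 t := Complex.ofRealCLM.hasDerivAt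
  refine (hcoe.smul (hd.scomp t (hcoe.mul_const z))).congr_deriv ?_
  simp only [one_mul, one_smul, Function.comp_apply, smul_smul]
  rw [add_comm]

theorem tendsto_ofReal_smul_comp_mul (hS : IsRayDomain S) (hG : ContinuousOn G S) (hβ : 0 < β)
    (hb : G =O[cocompact ℂ ⊓ 𝓟 S] fun z => (1 + ‖z‖) ^ (-(1 + β))) {z : ℂ} (hz : z ∈ S) :
    Tendsto (fun t : ℝ => (t : ℂ) • G (t * z)) atTop (𝓝 0) := by
  obtain ⟨M, hM⟩ := hS.exists_norm_smul_comp_mul_le hG hβ hb (isCompact_singleton (x := z))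
    (singleton_subset_iff.2 hz)
  have hz0 : 0 < ‖z‖ := norm_pos_iff.2 fun h => hS.zero_notMem (h ▸ hz)
  have hlim := (tendsto_rpow_neg_atTop hβ).const_mul (M / ‖z‖)
  rw [mul_zero] at hlim
  refine squeeze_zero_norm' ?_ hlim
  filter_upwards [eventually_ge_atTop 1] with t ht
  have ht0 : 0 < t := by linarith
  have hle := hM z rfl t ht
  rw [norm_smul, mul_comm, ← le_div_iff₀ hz0] at hle
  rw [norm_smul, Complex.norm_of_nonneg ht0.le]
  calc t * ‖G (t * z)‖ ≤ t * (M * t ^ (-(1 + β)) / ‖z‖) := by gcongr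
    _ = M / ‖z‖ * (t ^ (1 : ℝ) * t ^ (-(1 + β))) := by
        rw [Real.rpow_one]
        ring
    _ = _ := by
        rw [← Real.rpow_add ht0]
        congr 2
        ring

theorem exists_norm_deriv_smul_comp_mul_le (hS : IsRayDomain S) (hG : DifferentiableOn ℂ G S)
    (hβ : 0 < β) (hb : G =O[cocompact ℂ ⊓ 𝓟 S] fun z => (1 + ‖z‖) ^ (-(1 + β))) {z₀ : ℂ}
    (hz₀ : z₀ ∈ S) : ∃ M ε : ℝ, 0 < ε ∧ Metric.ball z₀ ε ⊆ S ∧ ∀ z ∈ Metric.ball z₀ ε, ∀ t : ℝ,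
      1 ≤ t → ‖G (t * z) + (t * z) • deriv G (t * z)‖ ≤ M * t ^ (-(1 + β)) := by
  obtain ⟨r, hr, hball⟩ := Metric.isOpen_iff.1 hS.isOpen z₀ hz₀
  have hKS : Metric.closedBall z₀ (r / 2) ⊆ S :=
    (Metric.closedBall_subset_ball (by linarith)).trans hball
  obtain ⟨M, hM⟩ := hS.exists_norm_smul_comp_mul_le hG.continuousOn hβ hb
    (isCompact_closedBall z₀ (r / 2)) hKS
  have hε : 0 < r / 4 := by linarith
  refine ⟨M / (r / 4), r / 4, hε, (Metric.ball_subset_ball (by linarith)).trans hball,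
    fun z hz t ht => ?_⟩
  have hsub : Metric.closedBall z (r / 4) ⊆ Metric.closedBall z₀ (r / 2) :=
    Metric.closedBall_subset_closedBall' (by linarith [Metric.mem_ball.1 hz])
  have hd : ∀ w ∈ Metric.closedBall z (r / 4), DifferentiableAt ℂ (fun z => z • G (t * z)) w :=
    fun w hw => (hS.hasDerivAt_smul_comp_mul hG ht (hKS (hsub hw))).differentiableAt
  rw [← (hS.hasDerivAt_smul_comp_mul hG ht (hKS (hsub (Metric.mem_closedBall_self hε.le)))).deriv]
  refine (Complex.norm_deriv_le_of_forall_mem_sphere_norm_le hε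
    (DifferentiableOn.diffContOnCl fun w hw => ?_)
    fun w hw => hM w (hsub (Metric.sphere_subset_closedBall hw)) t ht).trans_eq (by ring)
  rw [closure_ball _ hε.ne'] at hw
  exact (hd w hw).differentiableWithinAt

variable [CompleteSpace E]

theorem hasDerivAt_rayPrimitive (hS : IsRayDomain S) (hG : DifferentiableOn ℂ G S) (hβ : 0 < β)
    (hb : G =O[cocompact ℂ ⊓ 𝓟 S] fun z => (1 + ‖z‖) ^ (-(1 + β))) {z₀ : ℂ} (hz₀ : z₀ ∈ S) :
    HasDerivAt (rayPrimitive G) (G z₀) z₀ := by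
  obtain ⟨M, ε, hε, hεS, hM⟩ := hS.exists_norm_deriv_smul_comp_mul_le hG hβ hb hz₀
  obtain ⟨M', hM'⟩ := hS.exists_norm_smul_comp_mul_le hG.continuousOn hβ hb
    (isCompact_singleton (x := z₀)) (singleton_subset_iff.2 hz₀)
  have hmaps : ∀ z ∈ S, MapsTo (fun t : ℝ => (t : ℂ) * z) (Ioi 1) S := fun z hz t ht =>
    hS.mul_mem z hz t (le_of_lt ht)
  have hcont : ∀ z ∈ S, ContinuousOn (fun t : ℝ => G (t * z)) (Ioi 1) := fun z hz =>
    hG.continuousOn.comp (by fun_prop) (hmaps z hz)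
  have hcont' : ContinuousOn (fun t : ℝ => G (t * z₀) + (t * z₀ : ℂ) • deriv G (t * z₀)) (Ioi 1) :=
    (hcont z₀ hz₀).add (ContinuousOn.smul (by fun_prop)
      ((hG.deriv hS.isOpen).continuousOn.comp (by fun_prop) (hmaps z₀ hz₀)))
  have hIoi : ∀ {P : ℝ → Prop}, (∀ t, 1 ≤ t → P t) → ∀ᵐ t ∂volume.restrict (Ioi (1 : ℝ)), P t :=
    fun h => (ae_restrict_iff' measurableSet_Ioi).2 (ae_of_all _ fun t ht => h t (le_of_lt ht))
  have hderiv := hasDerivAt_integral_of_dominated_loc_of_deriv_le (Metric.ball_mem_nhds z₀ hε)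
    (by filter_upwards [hS.isOpen.mem_nhds hz₀] with z hz using
      ((hcont z hz).const_smul z).aestronglyMeasurable measurableSet_Ioi)
    (((integrableOn_Ioi_one_rpow hβ).const_mul M').mono'
      (((hcont z₀ hz₀).const_smul z₀).aestronglyMeasurable measurableSet_Ioi) (hIoi (hM' z₀ rfl)))
    (hcont'.aestronglyMeasurable measurableSet_Ioi) (hIoi fun t ht z hz => hM z hz t ht)
    ((integrableOn_Ioi_one_rpow hβ).const_mul M)
    (hIoi fun t ht z hz => hS.hasDerivAt_smul_comp_mul hG ht (hεS hz))
  have hint := integral_Ioi_of_hasDerivAt_of_tendsto'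
    (fun t ht => hS.hasDerivAt_ofReal_smul_comp_mul hG ht hz₀) hderiv.1
    (hS.tendsto_ofReal_smul_comp_mul hG.continuousOn hβ hb hz₀)
  refine hderiv.2.neg.congr_deriv ?_
  rw [hint]
  simp

end IsRayDomain

theorem IsUpwardContour.integral_eq_zero [CompleteSpace E] {γ : ℝ → ℂ} (hγ : IsUpwardContour γ)
    (hS : IsRayDomain S) (hγS : ∀ x, γ x ∈ S) (hG : DifferentiableOn ℂ G S) (hβ : 0 < β)
    (hb : G =O[cocompact ℂ ⊓ 𝓟 S] fun z => (1 + ‖z‖) ^ (-(1 + β))) :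
    ∫ x, deriv γ x • G (γ x) = 0 := by
  have hsub : range γ ⊆ S := range_subset_iff.2 hγS
  have hdecay := hasDecay_of_isBigO hγ.isClosed_range (hG.continuousOn.mono hsub)
    (hb.mono (inf_le_inf_left _ (principal_mono.2 hsub)))
  have hlim : ∀ l : Filter ℝ, Tendsto γ l (cocompact ℂ) →
      Tendsto (fun x => rayPrimitive G (γ x)) l (𝓝 0) := fun l hl =>
    (hS.tendsto_rayPrimitive hβ hb).comp
      (tendsto_inf.2 ⟨hl, tendsto_principal.2 (Eventually.of_forall hγS)⟩)
  simpa using hγ.integral_eq_sub (fun x => hS.hasDerivAt_rayPrimitive hG hβ hb (hγS x))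
    (hγ.integrable_smul hdecay (by linarith)) (hlim _ hγ.tendsto_atTop) (hlim _ hγ.tendsto_atBot)

end Rays

section Sector

variable {α θ₀ θ : ℝ}

theorem sector_subset_slitPlane (hθ : θ ≤ Real.pi / 2) : sector θ ⊆ Complex.slitPlane := by
  intro z hz
  refine Complex.mem_slitPlane_iff_arg.2 ⟨fun h => ?_, hz.1⟩
  have hlt := hz.2
  rw [h, abs_of_pos Real.pi_pos] at hlt
  linarith

theorem isOpen_sector (hθ : θ ≤ Real.pi / 2) : IsOpen (sector θ) := by
  have harg : ContinuousOn (fun z : ℂ => |z.arg|) Complex.slitPlane := fun z hz =>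
    (Complex.continuousAt_arg hz).abs.continuousWithinAt
  convert harg.isOpen_inter_preimage Complex.isOpen_slitPlane
    (isOpen_Iio (a := Real.pi / 2 + θ)) using 1
  ext z
  exact ⟨fun h => ⟨sector_subset_slitPlane hθ h, h.2⟩, fun h =>
    ⟨Complex.slitPlane_ne_zero h.1, h.2⟩⟩

theorem isRayDomain_sector (hθ : θ ≤ Real.pi / 2) : IsRayDomain (sector θ) where
  isOpen := isOpen_sector hθ
  zero_notMem := fun h => h.1 rfl
  mul_mem := fun z hz t ht => by
    have ht0 : 0 < t := by linarith
    refine ⟨mul_ne_zero (by exact_mod_cast ht0.ne') hz.1, ?_⟩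
    rw [Complex.arg_real_mul _ ht0]
    exact hz.2

theorem mem_sector_of_re_pos (hθ : 0 ≤ θ) {z : ℂ} (hz : 0 < z.re) : z ∈ sector θ := by
  refine ⟨fun h => by simp [h] at hz, ?_⟩
  have := Complex.abs_arg_lt_pi_div_two_iff.2 (Or.inl hz)
  linarith

theorem theta1_le_pi_div_two : theta1 α θ₀ ≤ Real.pi / 2 := min_le_right _ _

theorem theta1_nonneg (hα₀ : 0 < α) (hα₁ : α ≤ 1) (hθ : 0 ≤ θ₀) : 0 ≤ theta1 α θ₀ := by
  have : 0 ≤ 1 - α := by linarith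
  exact le_min (by positivity) (by positivity)

theorem mul_pi_div_two_add_theta1_le (hα : 0 < α) :
    α * (Real.pi / 2 + theta1 α θ₀) ≤ Real.pi / 2 + θ₀ :=
  calc α * (Real.pi / 2 + theta1 α θ₀)
      ≤ α * (Real.pi / 2 + (Real.pi * (1 - α) + 2 * θ₀) / (2 * α)) := by
        gcongr; exact min_le_left _ _
    _ = Real.pi / 2 + θ₀ := by field_simp; ring

theorem cpow_mem_sector (hα : 0 < α) (hθ : θ₀ ≤ Real.pi / 2) {z : ℂ}
    (hz : z ∈ sector (theta1 α θ₀)) : z ^ (α : ℂ) ∈ sector θ₀ := by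
  have hlt : |α * z.arg| < Real.pi / 2 + θ₀ := by
    rw [abs_mul, abs_of_pos hα]
    exact (mul_lt_mul_of_pos_left hz.2 hα).trans_le (mul_pi_div_two_add_theta1_le hα)
  have harg : (z ^ (α : ℂ)).arg = α * z.arg := by
    rw [Complex.cpow_def_of_ne_zero hz.1, Complex.arg_exp, Complex.im_mul_ofReal, Complex.log_im,
      mul_comm z.arg, toIocMod_eq_self]
    have := abs_lt.1 hlt
    constructor <;> linarith
  exact ⟨by simp [Complex.cpow_eq_zero_iff, hz.1], harg ▸ hlt⟩

theorem one_mem_sector (hα : 0 < α) (hθ : 0 ≤ theta1 α θ₀) : 1 ∈ sector θ₀ := by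
  refine ⟨one_ne_zero, ?_⟩
  have hpos : 0 < α * (Real.pi / 2 + theta1 α θ₀) := by positivity
  simpa using hpos.trans_le (mul_pi_div_two_add_theta1_le hα)

end Sector

section Division

variable {𝔅 : Type*} [NormedRing 𝔅] [NormedAlgebra ℂ 𝔅]

open Polynomial in
theorem exists_aeval_quotient (m : 𝔅) (p : ℂ[X]) :
    ∃ K : ℂ → 𝔅, Differentiable ℂ K ∧
      ∀ z, algebraMap ℂ 𝔅 (p.eval z) = aeval m p + (algebraMap ℂ 𝔅 z - m) * K z := by
  induction p using Polynomial.induction_on with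
  | C a => exact ⟨0, differentiable_const 0, fun z => by simp⟩
  | add p q hp hq =>
    obtain ⟨K, hK, h⟩ := hp
    obtain ⟨K', hK', h'⟩ := hq
    refine ⟨fun z => K z + K' z, hK.add hK', fun z => ?_⟩
    rw [eval_add, map_add, map_add, h, h', mul_add]
    abel
  | monomial n a hn =>
    obtain ⟨K, hK, h⟩ := hn
    refine ⟨fun z => algebraMap ℂ 𝔅 ((C a * X ^ n).eval z) + K z * m, ?_, fun z => ?_⟩
    · simp_rw [Algebra.algebraMap_eq_smul_one]
      exact ((Polynomial.differentiable _).smul_const _).add (hK.mul_const m)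
    · have hK : (algebraMap ℂ 𝔅 z - m) * K z =
          algebraMap ℂ 𝔅 ((C a * X ^ n).eval z) - aeval m (C a * X ^ n) := by rw [h]; abel
      rw [mul_add, ← mul_assoc _ (K z), hK, pow_succ, ← mul_assoc, eval_mul_X, map_mul, map_mul,
        aeval_X, sub_mul, sub_mul, ← Algebra.commutes z, Algebra.commutes _ m]
      abel

theorem resolvent_mul_of_quotient {m Φ : 𝔅} {F Ψ : ℂ → 𝔅} {z : ℂ} (hz : z ∈ resolventSet ℂ m)
    (h : F z = Φ + (algebraMap ℂ 𝔅 z - m) * Ψ z) :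
    resolvent m z * F z = resolvent m z * Φ + Ψ z := by
  have hinv : resolvent m z * (algebraMap ℂ 𝔅 z - m) = 1 := Ring.inverse_mul_cancel _ hz
  rw [h, mul_add, ← mul_assoc, hinv, one_mul]

open Polynomial in
theorem aeval_multiset_prod_cons_mul (m : 𝔅) (a : ℂ) (T : Multiset ℂ) (N : 𝔅) :
    aeval m ((a ::ₘ T).map fun b => X - C b).prod * N =
      aeval m (T.map fun b => X - C b).prod * ((m - algebraMap ℂ 𝔅 a) * N) := by
  rw [Multiset.map_cons, Multiset.prod_cons, mul_comm, map_mul, mul_assoc]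
  simp

variable [CompleteSpace 𝔅]

open Polynomial in
theorem exists_resolvent_quotient (m : 𝔅) {U : Set ℂ} (hU : IsOpen U) {T : Multiset ℂ}
    (hT : ∀ a ∈ T, a ∈ U) {N : 𝔅} (hN : aeval m (T.map fun a => X - C a).prod * N = 0)
    {F : ℂ → 𝔅} (hF : DifferentiableOn ℂ F U) :
    ∃ (Φ : 𝔅) (Ψ : ℂ → 𝔅), DifferentiableOn ℂ Ψ U ∧
      ∀ z ∈ U, N * F z = Φ + (algebraMap ℂ 𝔅 z - m) * Ψ z := by
  induction T using Multiset.induction_on generalizing N F with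
  | empty =>
    simp only [Multiset.map_zero, Multiset.prod_zero, map_one, one_mul] at hN
    exact ⟨0, 0, differentiableOn_const 0, fun z _ => by simp [hN]⟩
  | cons a T ih =>
    rw [Multiset.forall_mem_cons] at hT
    rw [aeval_multiset_prod_cons_mul] at hN
    have hd : DifferentiableOn ℂ (dslope F a) U :=
      (Complex.differentiableOn_dslope (hU.mem_nhds hT.1)).2 hF
    obtain ⟨Φ, Ψ, hΨ, h⟩ := ih hT.2 hN hd
    refine ⟨N * F a + Φ, fun z => N * dslope F a z + Ψ z, (hd.const_mul N).add hΨ, fun z hz => ?_⟩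
    calc N * F z = N * F a + (z - a) • (N * dslope F a z) := by
          rw [← mul_smul_comm, sub_smul_dslope, mul_sub]; abel
      _ = N * F a + ((algebraMap ℂ 𝔅 z - m) * (N * dslope F a z) +
            (m - algebraMap ℂ 𝔅 a) * N * dslope F a z) := by
          rw [mul_assoc, ← add_mul, Algebra.smul_def, map_sub, sub_add_sub_cancel]
      _ = _ := by rw [h z hz, mul_add]; abel

/- By Liouville: `resolvent m z * c` extends to an entire function which vanishes at infinity. -/
theorem eq_zero_of_quotient {m c : 𝔅} {U : Set ℂ} (hU : IsOpen U) (hm : spectrum ℂ m ⊆ U)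
    {Ψ : ℂ → 𝔅} (hΨ : DifferentiableOn ℂ Ψ U)
    (h : ∀ z ∈ U, c = (algebraMap ℂ 𝔅 z - m) * Ψ z) : c = 0 := by
  classical
  set R : Set ℂ := resolventSet ℂ m
  have hR : IsOpen R := spectrum.isOpen_resolventSet m
  set f : ℂ → 𝔅 := R.piecewise (fun z => resolvent m z * c) Ψ
  have hfR : EqOn f (fun z => resolvent m z * c) R := piecewise_eqOn _ _ _
  have hfU : EqOn f Ψ U := fun z hz => by
    by_cases hzR : z ∈ R
    · have := resolvent_mul_of_quotient (F := fun _ => c) (Φ := 0) hzR (by rw [zero_add, ← h z hz])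
      simpa [hfR hzR] using this
    · exact piecewise_eq_of_notMem _ _ _ hzR
  have hdiff : Differentiable ℂ f := fun z => by
    by_cases hzR : z ∈ R
    · have hres := (spectrum.hasDerivAt_resolvent_const_left hzR).differentiableAt.mul_const c
      exact hres.congr_of_eventuallyEq (hfR.eventuallyEq_of_mem (hR.mem_nhds hzR))
    · have hzU : U ∈ 𝓝 z := hU.mem_nhds (hm hzR)
      exact (hΨ.differentiableAt hzU).congr_of_eventuallyEq (hfU.eventuallyEq_of_mem hzU)
  have hcobdd : R ∈ cocompact ℂ :=
    mem_of_superset (spectrum.isCompact m).compl_mem_cocompact fun z hz => not_not.1 hz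
  have hlim : Tendsto f (cocompact ℂ) (𝓝 0) := by
    have h0 := (spectrum.resolvent_tendsto_cobounded (𝕜 := ℂ) m).mul_const c
    rw [zero_mul, Metric.cobounded_eq_cocompact] at h0
    exact h0.congr' (hfR.symm.eventuallyEq_of_mem hcobdd)
  obtain ⟨z, hz⟩ := Filter.nonempty_of_mem hcobdd
  exact (spectrum.isUnit_resolvent.1 hz).mul_right_eq_zero.1
    ((hfR hz).symm.trans (hdiff.apply_eq_of_tendsto_cocompact z hlim))

open Polynomial in
theorem exists_hermite_interpolation {U : Set ℂ} (hU : IsOpen U) {T : Multiset ℂ}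
    (hT : ∀ a ∈ T, a ∈ U) {g : ℂ → ℂ} (hg : DifferentiableOn ℂ g U) :
    ∃ (p : ℂ[X]) (u : ℂ → ℂ), DifferentiableOn ℂ u U ∧
      ∀ z ∈ U, g z = p.eval z + (T.map fun a => X - C a).prod.eval z * u z := by
  induction T using Multiset.induction_on generalizing g with
  | empty => exact ⟨0, g, hg, by simp⟩
  | cons a T ih =>
    rw [Multiset.forall_mem_cons] at hT
    obtain ⟨p, u, hu, h⟩ := ih hT.2 ((Complex.differentiableOn_dslope (hU.mem_nhds hT.1)).2 hg)
    refine ⟨C (g a) + (X - C a) * p, u, hu, fun z hz => ?_⟩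
    calc g z = g a + (z - a) * dslope g a z := by
          rw [← smul_eq_mul, sub_smul_dslope]; abel
      _ = _ := by
          rw [h z hz, Multiset.map_cons, Multiset.prod_cons]
          simp only [eval_add, eval_mul, eval_sub, eval_X, eval_C]
          ring

end Division

section ResolventIntegral

variable {γ : ℝ → ℂ}

theorem prod_map_inv_sub_cons_cons {z a b : ℂ} (ha : z ≠ a) (hb : z ≠ b) (hab : a ≠ b)
    (T : Multiset ℂ) : ((a ::ₘ b ::ₘ T).map fun c => (z - c)⁻¹).prod =
      (a - b)⁻¹ * (((a ::ₘ T).map fun c => (z - c)⁻¹).prod -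
        ((b ::ₘ T).map fun c => (z - c)⁻¹).prod) := by
  have hza : z - a ≠ 0 := sub_ne_zero.2 ha
  have hzb : z - b ≠ 0 := sub_ne_zero.2 hb
  have hab' : a - b ≠ 0 := sub_ne_zero.2 hab
  simp only [Multiset.map_cons, Multiset.prod_cons]
  field_simp
  ring

theorem integral_prod_inv_cons_cons {a b : ℂ} (ha : a ∉ range γ) (hb : b ∉ range γ) (hab : a ≠ b)
    (T : Multiset ℂ) :
    ∫ x, deriv γ x • ((a ::ₘ b ::ₘ T).map fun c => (γ x - c)⁻¹).prod =
      (a - b)⁻¹ * ∫ x, (deriv γ x • ((a ::ₘ T).map fun c => (γ x - c)⁻¹).prod -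
        deriv γ x • ((b ::ₘ T).map fun c => (γ x - c)⁻¹).prod) := by
  rw [← integral_const_mul]
  congr 1 with x
  rw [prod_map_inv_sub_cons_cons (fun h => ha ⟨x, h⟩) (fun h => hb ⟨x, h⟩) hab, ← smul_sub,
    smul_eq_mul, smul_eq_mul, mul_left_comm]

namespace IsUpwardContour

theorem integrable_prod_inv (hγ : IsUpwardContour γ) {S : Multiset ℂ}
    (hS : ∀ a ∈ S, a ∉ range γ) (hcard : 2 ≤ Multiset.card S) :
    Integrable fun x => deriv γ x • (S.map fun a => (γ x - a)⁻¹).prod :=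
  hγ.integrable_smul (hasDecay_prod_inv hγ.isClosed_range S hS)
    (by exact_mod_cast (show 1 < Multiset.card S by omega))

theorem integral_prod_inv_eq_zero (hγ : IsUpwardContour γ) {S : Multiset ℂ}
    (hS : ∀ a ∈ S, RightOf γ a) (hcard : 2 ≤ Multiset.card S) :
    ∫ x, deriv γ x • (S.map fun a => (γ x - a)⁻¹).prod = 0 := by
  induction S using Multiset.strongInductionOn with
  | ih S ih =>
  obtain ⟨n, hn⟩ := Nat.exists_eq_add_of_le' hcard
  obtain ⟨a, S, rfl⟩ : ∃ a S', S = a ::ₘ S' := by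
    obtain ⟨a, ha⟩ := Multiset.card_pos_iff_exists_mem.1 (show 0 < Multiset.card S by omega)
    exact ⟨a, Multiset.exists_cons_of_mem ha⟩
  rw [Multiset.forall_mem_cons] at hS
  by_cases hall : ∀ b ∈ S, b = a
  · have hrep : a ::ₘ S = Multiset.replicate (n + 2) a :=
      Multiset.eq_replicate.2 ⟨hn, by simpa using hall⟩
    simpa only [hrep, Multiset.map_replicate, Multiset.prod_replicate] using
      hγ.integral_inv_pow hS.1.notMem_range n
  push Not at hall
  obtain ⟨b, hbS, hba⟩ := hall
  obtain ⟨T, rfl⟩ := Multiset.exists_cons_of_mem hbS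
  rw [Multiset.forall_mem_cons] at hS
  obtain ⟨ha, hb, hT⟩ := hS
  rw [integral_prod_inv_cons_cons ha.notMem_range hb.notMem_range hba.symm, mul_eq_zero]
  refine Or.inr ?_
  obtain rfl | ⟨c, hc⟩ := T.empty_or_exists_mem
  · simpa [mul_sub] using hγ.integral_inv_sub_inv_of_rightOf ha hb
  have hpos := Multiset.card_pos_iff_exists_mem.2 ⟨c, hc⟩
  have haT := Multiset.forall_mem_cons.2 ⟨ha, hT⟩
  have hbT := Multiset.forall_mem_cons.2 ⟨hb, hT⟩
  have hcard' : ∀ p, 2 ≤ Multiset.card (p ::ₘ T) := fun p => by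
    rw [Multiset.card_cons]
    omega
  rw [integral_sub (hγ.integrable_prod_inv (fun c hc => (haT c hc).notMem_range) (hcard' a))
    (hγ.integrable_prod_inv (fun c hc => (hbT c hc).notMem_range) (hcard' b)),
    ih _ (Multiset.cons_lt_cons_iff.2 (Multiset.lt_cons_self T b)) haT (hcard' a),
    ih _ (Multiset.lt_cons_self _ a) hbT (hcard' b), sub_zero]

end IsUpwardContour

variable {𝔅 : Type*} [NormedRing 𝔅] [NormedAlgebra ℂ 𝔅]

theorem resolvent_mul_eq {m N : 𝔅} {z a : ℂ} (hz : z ∈ resolventSet ℂ m) (hza : z ≠ a) :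
    resolvent m z * N = (z - a)⁻¹ • N +
      (z - a)⁻¹ • (resolvent m z * ((m - algebraMap ℂ 𝔅 a) * N)) := by
  have hinv : resolvent m z * (algebraMap ℂ 𝔅 z - m) = 1 := Ring.inverse_mul_cancel _ hz
  have hsub : m - algebraMap ℂ 𝔅 a = (z - a) • 1 - (algebraMap ℂ 𝔅 z - m) := by
    rw [sub_smul, Algebra.algebraMap_eq_smul_one, Algebra.algebraMap_eq_smul_one]
    abel
  rw [hsub, sub_mul, mul_sub, ← mul_assoc _ _ N, ← mul_assoc _ _ N, hinv, smul_sub]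
  simp [smul_smul, inv_mul_cancel₀ (sub_ne_zero.2 hza)]

theorem resolvent_sub_inv_smul {m : 𝔅} {z a : ℂ} (hz : z ∈ resolventSet ℂ m) (hza : z ≠ a) :
    resolvent m z - (z - a)⁻¹ • (1 : 𝔅) =
      (z - a)⁻¹ • (resolvent m z * (m - algebraMap ℂ 𝔅 a)) := by
  have := resolvent_mul_eq (N := 1) hz hza
  rw [mul_one, mul_one] at this
  rw [sub_eq_iff_eq_add', ← this]

variable [CompleteSpace 𝔅]

theorem hasDecay_resolvent_sub_inv (m : 𝔅) {K : Set ℂ} (hK : IsClosed K)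
    (hKm : K ⊆ resolventSet ℂ m) {a : ℂ} (ha : a ∉ K) :
    HasDecay K 2 (fun z => resolvent m z - (z - a)⁻¹ • (1 : 𝔅)) := by
  have := (hasDecay_inv_sub hK ha).smul
    ((hasDecay_resolvent m hK hKm).mul (hasDecay_const K (m - algebraMap ℂ 𝔅 a)))
  norm_num at this
  exact this.congr fun z hz => resolvent_sub_inv_smul (hKm hz) (ne_of_mem_of_not_mem hz ha)

namespace IsUpwardContour

open Polynomial in
theorem integral_prod_inv_resolvent_eq_zero (hγ : IsUpwardContour γ) (m : 𝔅)
    (hm : range γ ⊆ resolventSet ℂ m) {T S : Multiset ℂ} (hT : ∀ a ∈ T, RightOf γ a)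
    (hS : ∀ a ∈ S, RightOf γ a) (hcard : 1 ≤ Multiset.card S) {N : 𝔅}
    (hN : aeval m (T.map fun a => X - C a).prod * N = 0) :
    ∫ x, deriv γ x • (S.map fun a => (γ x - a)⁻¹).prod • (resolvent m (γ x) * N) = 0 := by
  induction T using Multiset.induction_on generalizing S N with
  | empty =>
    simp only [Multiset.map_zero, Multiset.prod_zero, map_one, one_mul] at hN
    simp [hN]
  | cons a T ih =>
    rw [Multiset.forall_mem_cons] at hT
    rw [aeval_multiset_prod_cons_mul] at hN
    have haS : ∀ b ∈ a ::ₘ S, RightOf γ b := Multiset.forall_mem_cons.2 ⟨hT.1, hS⟩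
    have haS' : ∀ b ∈ a ::ₘ S, b ∉ range γ := fun b hb => (haS b hb).notMem_range
    have hcard' : 2 ≤ Multiset.card (a ::ₘ S) := by simpa using hcard
    have hsplit : ∀ x, deriv γ x • (S.map fun b => (γ x - b)⁻¹).prod • (resolvent m (γ x) * N) =
        (deriv γ x • ((a ::ₘ S).map fun b => (γ x - b)⁻¹).prod) • N +
          deriv γ x • ((a ::ₘ S).map fun b => (γ x - b)⁻¹).prod •
            (resolvent m (γ x) * ((m - algebraMap ℂ 𝔅 a) * N)) := fun x => by
      rw [resolvent_mul_eq (hm (mem_range_self x))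
        (ne_of_mem_of_not_mem (mem_range_self x) hT.1.notMem_range), Multiset.map_cons,
        Multiset.prod_cons, smul_assoc, mul_comm, mul_smul, mul_smul, smul_add, smul_add]
    have hdecay := (hasDecay_prod_inv hγ.isClosed_range _ haS').smul
      ((hasDecay_resolvent m hγ.isClosed_range hm).mul
        (hasDecay_const (range γ) ((m - algebraMap ℂ 𝔅 a) * N)))
    have hint := hγ.integrable_smul hdecay
      (by have : (2 : ℝ) ≤ Multiset.card (a ::ₘ S) := by exact_mod_cast hcard'
          linarith)
    simp_rw [hsplit]
    rw [integral_add ((hγ.integrable_prod_inv haS' hcard').smul_const N) hint,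
      integral_smul_const, hγ.integral_prod_inv_eq_zero haS hcard', zero_smul, zero_add,
      ih hT.2 haS (by simp) hN]

open Polynomial in
theorem integral_resolvent_sub_inv_eq_zero (hγ : IsUpwardContour γ) (m : 𝔅)
    (hm : range γ ⊆ resolventSet ℂ m) {T : Multiset ℂ} (hT : ∀ a ∈ T, RightOf γ a)
    (hmT : aeval m (T.map fun a => X - C a).prod = 0) {a : ℂ} (ha : RightOf γ a) :
    ∫ x, deriv γ x • (resolvent m (γ x) - (γ x - a)⁻¹ • (1 : 𝔅)) = 0 := by
  rw [← hγ.integral_prod_inv_resolvent_eq_zero m hm hT (S := {a}) (by simpa using ha) (by simp)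
    (N := m - algebraMap ℂ 𝔅 a) (by rw [hmT, zero_mul])]
  congr 1 with x
  rw [resolvent_sub_inv_smul (hm (mem_range_self x))
    (ne_of_mem_of_not_mem (mem_range_self x) ha.notMem_range), Multiset.map_singleton,
    Multiset.prod_singleton]

open Polynomial in
theorem integral_resolvent_sub_inv_zero (hγ : IsUpwardContour γ)
    (h0 : ∀ x, γ x ∈ Complex.slitPlane) (m : 𝔅) (hm : range γ ⊆ resolventSet ℂ m)
    {T : Multiset ℂ} (hT : ∀ a ∈ T, RightOf γ a)
    (hmT : aeval m (T.map fun a => X - C a).prod = 0) :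
    ∫ x, deriv γ x • (resolvent m (γ x) - (γ x)⁻¹ • (1 : 𝔅)) =
      -((2 * Real.pi * Complex.I : ℂ) • (1 : 𝔅)) := by
  obtain rfl | ⟨a, ha⟩ := T.empty_or_exists_mem
  · have : Subsingleton 𝔅 := subsingleton_of_zero_eq_one (by simpa using hmT.symm)
    exact Subsingleton.elim _ _
  have ha := hT a ha
  have hzero : (0 : ℂ) ∉ range γ := fun ⟨x, hx⟩ => Complex.slitPlane_ne_zero (h0 x) hx
  have hsplit : ∀ x, deriv γ x • (resolvent m (γ x) - (γ x)⁻¹ • (1 : 𝔅)) =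
      deriv γ x • (resolvent m (γ x) - (γ x - a)⁻¹ • (1 : 𝔅)) +
        (deriv γ x • ((γ x - a)⁻¹ - (γ x - 0)⁻¹)) • (1 : 𝔅) := fun x => by
    rw [smul_assoc, ← smul_add, sub_smul, sub_zero, sub_add_sub_cancel]
  simp_rw [hsplit]
  rw [integral_add (hγ.integrable_smul (hasDecay_resolvent_sub_inv m hγ.isClosed_range hm
      ha.notMem_range) one_lt_two)
    ((hγ.integrable_inv_sub_inv ha.notMem_range hzero).smul_const 1),
    hγ.integral_resolvent_sub_inv_eq_zero m hm hT hmT ha, integral_smul_const, zero_add]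
  simp_rw [sub_zero]
  rw [hγ.integral_inv_sub_inv_zero h0 ha, neg_smul]

end IsUpwardContour

end ResolventIntegral

section ContourResolvent

variable {𝔅 : Type*} [NormedRing 𝔅] [NormedAlgebra ℂ 𝔅]

theorem quotient_add_inv_smul {m Φ : 𝔅} {F Ψ : ℂ → 𝔅} {z : ℂ} (hz : z ∈ resolventSet ℂ m)
    (h : F z = Φ + (algebraMap ℂ 𝔅 z - m) * Ψ z) :
    Ψ z + z⁻¹ • Φ = resolvent m z * F z - (resolvent m z - z⁻¹ • (1 : 𝔅)) * Φ := by
  rw [resolvent_mul_of_quotient hz h, sub_mul, smul_mul_assoc, one_mul]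
  abel

variable [CompleteSpace 𝔅]

theorem isBigO_resolvent_sub_inv (m : 𝔅) :
    (fun z => resolvent m z - z⁻¹ • (1 : 𝔅)) =O[cocompact ℂ] fun z => (1 + ‖z‖) ^ (-2 : ℝ) := by
  have hmul : (fun z => z⁻¹ • (resolvent m z * m)) =O[cocompact ℂ]
      fun z => (1 + ‖z‖) ^ (-1 : ℝ) • ((1 + ‖z‖) ^ (-1 : ℝ) * (1 : ℝ)) :=
    isBigO_inv_one_add_norm.smul ((isBigO_resolvent m).mul (Asymptotics.isBigO_const_one ℝ m _))
  refine hmul.congr' ?_ (.of_forall fun z => ?_)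
  · filter_upwards [(spectrum.isCompact (𝕜 := ℂ) m).compl_mem_cocompact,
      (isCompact_singleton (x := (0 : ℂ))).compl_mem_cocompact] with z hz hz0
    have := resolvent_sub_inv_smul (not_not.1 hz) hz0
    rwa [map_zero, sub_zero, sub_zero, eq_comm] at this
  · beta_reduce
    rw [mul_one, smul_eq_mul, ← Real.rpow_add (by positivity)]
    norm_num

theorem isBigO_quotient_add_inv_smul {S : Set ℂ} {m Φ : 𝔅} {F Ψ : ℂ → 𝔅} {β : ℝ} (hβ : β ≤ 1)
    (hF : F =O[cocompact ℂ ⊓ 𝓟 S] fun z => (1 + ‖z‖) ^ (-β))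
    (h : ∀ z ∈ S, F z = Φ + (algebraMap ℂ 𝔅 z - m) * Ψ z) :
    (fun z => Ψ z + z⁻¹ • Φ) =O[cocompact ℂ ⊓ 𝓟 S] fun z => (1 + ‖z‖) ^ (-(1 + β)) := by
  have hRF := (((isBigO_resolvent m).mono inf_le_left).mul hF).congr_right
    (g₂ := fun z => (1 + ‖z‖) ^ (-(1 + β))) fun z => by
      rw [← Real.rpow_add (by positivity), neg_add]
  have hRΦ := ((isBigO_resolvent_sub_inv m).mono inf_le_left).mul
    (Asymptotics.isBigO_const_one ℝ Φ (cocompact ℂ ⊓ 𝓟 S))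
  refine (hRF.sub (hRΦ.trans ?_)).congr' ?_ .rfl
  · refine Asymptotics.IsBigO.of_bound 1 (.of_forall fun z => ?_)
    rw [mul_one, one_mul, Real.norm_of_nonneg (by positivity), Real.norm_of_nonneg (by positivity)]
    gcongr
    · linarith [norm_nonneg z]
    · linarith
  · rw [EventuallyEq, eventually_inf_principal]
    filter_upwards [(spectrum.isCompact (𝕜 := ℂ) m).compl_mem_cocompact] with z hz hzS
    exact (quotient_add_inv_smul (not_not.1 hz) (h z hzS)).symm

open Polynomial in
theorem IsUpwardContour.integral_resolvent_mul {γ : ℝ → ℂ} (hγ : IsUpwardContour γ) {S : Set ℂ}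
    (hS : IsRayDomain S) (hSslit : S ⊆ Complex.slitPlane) (hγS : ∀ x, γ x ∈ S) {m : 𝔅}
    (hm : range γ ⊆ resolventSet ℂ m) {T : Multiset ℂ} (hT : ∀ a ∈ T, RightOf γ a)
    (hmT : aeval m (T.map fun a => X - C a).prod = 0) {F Ψ : ℂ → 𝔅} {Φ : 𝔅}
    (hF : DifferentiableOn ℂ F S) {β : ℝ} (hβ : 0 < β) (hβ₁ : β ≤ 1)
    (hFO : F =O[cocompact ℂ ⊓ 𝓟 S] fun z => (1 + ‖z‖) ^ (-β))
    (hΨ : DifferentiableOn ℂ Ψ S) (h : ∀ z ∈ S, F z = Φ + (algebraMap ℂ 𝔅 z - m) * Ψ z) :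
    ∫ x, deriv γ x • (resolvent m (γ x) * F (γ x)) = -((2 * Real.pi * Complex.I : ℂ) • Φ) := by
  have hsub : range γ ⊆ S := range_subset_iff.2 hγS
  have hRF := (hasDecay_resolvent m hγ.isClosed_range hm).mul
    (hasDecay_of_isBigO hγ.isClosed_range (hF.continuousOn.mono hsub)
      (hFO.mono (inf_le_inf_left _ (principal_mono.2 hsub))))
  have hR := hasDecay_resolvent_sub_inv m hγ.isClosed_range hm fun h0 => hS.zero_notMem (hsub h0)
  simp only [sub_zero] at hR
  have hRi := hγ.integrable_smul hR one_lt_two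
  have hG0 := hγ.integral_eq_zero hS hγS (hΨ.add ((differentiableOn_inv.mono fun z hz =>
    ne_of_mem_of_not_mem hz hS.zero_notMem).smul_const Φ)) hβ
    (isBigO_quotient_add_inv_smul hβ₁ hFO h)
  have hsplit : ∀ x, deriv γ x • (Ψ (γ x) + (γ x)⁻¹ • Φ) =
      deriv γ x • (resolvent m (γ x) * F (γ x)) -
        (deriv γ x • (resolvent m (γ x) - (γ x)⁻¹ • (1 : 𝔅))) * Φ := fun x => by
    rw [quotient_add_inv_smul (hm (mem_range_self x)) (h _ (hγS x)), smul_sub, smul_mul_assoc]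
  simp only [Pi.add_apply, hsplit] at hG0
  rw [integral_sub (hγ.integrable_smul hRF (by linarith)) (hRi.mul_const Φ), sub_eq_zero,
    integral_mul_const_of_integrable hRi,
    hγ.integral_resolvent_sub_inv_zero (fun x => hSslit (hγS x)) m hm hT hmT] at hG0
  rw [hG0, neg_mul, smul_mul_assoc, one_mul]

end ContourResolvent

section Neumann

theorem norm_mul_pow_mul_le {𝔅 : Type*} [NormedRing 𝔅] (a b c : 𝔅) (n : ℕ) :
    ‖a * b ^ n * c‖ ≤ ‖a‖ * ‖b‖ ^ n * ‖c‖ := by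
  have h : ‖b ^ n * c‖ ≤ ‖b‖ ^ n * ‖c‖ := by
    induction n with
    | zero => simp
    | succ n ih =>
      rw [pow_succ', pow_succ', mul_assoc, mul_assoc]
      exact (norm_mul_le _ _).trans (by gcongr)
  rw [mul_assoc, mul_assoc]
  exact (norm_mul_le _ _).trans (by gcongr)

variable {𝔅 : Type*} [NormedRing 𝔅] [NormedAlgebra ℂ 𝔅]

/-- The coefficient of `ζⁿ` in the Neumann expansion of `(z - (m - ζ e))⁻¹`. -/
noncomputable def neumannTerm (m e : 𝔅) (n : ℕ) (z : ℂ) : 𝔅 :=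
  resolvent m z * (-(e * resolvent m z)) ^ n

theorem algebraMap_sub_sub_smul {m e : 𝔅} {z : ℂ} (ζ : ℂ) (hz : z ∈ resolventSet ℂ m) :
    algebraMap ℂ 𝔅 z - (m - ζ • e) =
      (1 - ζ • -(e * resolvent m z)) * (algebraMap ℂ 𝔅 z - m) := by
  have hinv : resolvent m z * (algebraMap ℂ 𝔅 z - m) = 1 := Ring.inverse_mul_cancel _ hz
  rw [sub_mul, one_mul, smul_mul_assoc, neg_mul, mul_assoc, hinv, mul_one, smul_neg]
  abel

theorem norm_smul_neg_mul_le (e b : 𝔅) (ζ : ℂ) : ‖ζ • -(e * b)‖ ≤ ‖ζ‖ * (‖e‖ * ‖b‖) := by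
  rw [norm_smul, norm_neg]
  gcongr
  exact norm_mul_le _ _

theorem norm_smul_neumannTerm_mul_le (m e : 𝔅) (n : ℕ) (z ζ : ℂ) (f : 𝔅) :
    ‖ζ ^ n • (neumannTerm m e n z * f)‖ ≤
      (‖ζ‖ * (‖e‖ * ‖resolvent m z‖)) ^ n * (‖resolvent m z‖ * ‖f‖) := by
  rw [neumannTerm, ← smul_mul_assoc, ← mul_smul_comm, ← smul_pow]
  calc ‖resolvent m z * (ζ • -(e * resolvent m z)) ^ n * f‖
      ≤ ‖resolvent m z‖ * ‖ζ • -(e * resolvent m z)‖ ^ n * ‖f‖ := norm_mul_pow_mul_le _ _ _ n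
    _ ≤ ‖resolvent m z‖ * (‖ζ‖ * (‖e‖ * ‖resolvent m z‖)) ^ n * ‖f‖ := by
        gcongr
        exact norm_smul_neg_mul_le _ _ _
    _ = _ := by ring

variable [CompleteSpace 𝔅]

theorem mem_resolventSet_sub_smul {m e : 𝔅} {z ζ : ℂ} (hz : z ∈ resolventSet ℂ m)
    (hζ : ‖ζ‖ * (‖e‖ * ‖resolvent m z‖) < 1) : z ∈ resolventSet ℂ (m - ζ • e) := by
  rw [spectrum.mem_resolventSet_iff, algebraMap_sub_sub_smul ζ hz]
  exact (isUnit_one_sub_of_norm_lt_one ((norm_smul_neg_mul_le _ _ _).trans_lt hζ)).mul hz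

theorem hasSum_neumannTerm {m e : 𝔅} {z ζ : ℂ} (hz : z ∈ resolventSet ℂ m)
    (hζ : ‖ζ‖ * (‖e‖ * ‖resolvent m z‖) < 1) :
    HasSum (fun n => ζ ^ n • neumannTerm m e n z) (resolvent (m - ζ • e) z) := by
  set x : 𝔅 := ζ • -(e * resolvent m z) with hx
  have hx1 : ‖x‖ < 1 := (norm_smul_neg_mul_le _ _ _).trans_lt hζ
  have hsum : resolvent m z * ∑' n : ℕ, x ^ n = resolvent (m - ζ • e) z := by
    have hu := mem_resolventSet_sub_smul hz hζ
    have hinv : (algebraMap ℂ 𝔅 z - m) * resolvent m z = 1 := Ring.mul_inverse_cancel _ hz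
    have hinv' : (algebraMap ℂ 𝔅 z - (m - ζ • e)) * resolvent (m - ζ • e) z = 1 :=
      Ring.mul_inverse_cancel _ hu
    refine hu.mul_left_cancel ?_
    rw [hinv', algebraMap_sub_sub_smul ζ hz, mul_assoc, ← mul_assoc _ (resolvent m z), hinv,
      one_mul, mul_neg_geom_series x hx1]
  rw [← hsum]
  refine ((summable_geometric_of_norm_lt_one hx1).hasSum.mul_left _).congr_fun fun n => ?_
  rw [neumannTerm, hx, smul_pow, mul_smul_comm]

theorem hasDecay_neumannTerm (m e : 𝔅) {K : Set ℂ} (hK : IsClosed K)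
    (hm : K ⊆ resolventSet ℂ m) (n : ℕ) : HasDecay K 1 (neumannTerm m e n) := by
  have hdecay := hasDecay_resolvent m hK hm
  induction n with
  | zero => exact hdecay.congr fun z _ => by simp [neumannTerm]
  | succ n ih =>
    have hmul := ih.mul (((hasDecay_const K e).mul hdecay).neg)
    refine (hmul.of_le (show (1 : ℝ) ≤ 1 + (0 + 1) by norm_num)).congr fun z _ => ?_
    simp only [neumannTerm, pow_succ, mul_assoc]

namespace IsUpwardContour

variable {γ : ℝ → ℂ}

theorem exists_forall_norm_mul_resolvent_le (hγ : IsUpwardContour γ) {m : 𝔅}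
    (hm : range γ ⊆ resolventSet ℂ m) (e : 𝔅) : ∃ ρ : ℝ, 0 < ρ ∧ ∀ ζ : ℂ, ‖ζ‖ < ρ → ∀ x,
      ‖ζ‖ * (‖e‖ * ‖resolvent m (γ x)‖) ≤ 1 / 2 := by
  obtain ⟨-, B, hB, hb⟩ := hasDecay_resolvent m hγ.isClosed_range hm
  refine ⟨(2 * (‖e‖ * B + 1))⁻¹, by positivity, fun ζ hζ x => ?_⟩
  have hbB : ‖resolvent m (γ x)‖ ≤ B := (hb _ (mem_range_self x)).trans
    (mul_le_of_le_one_right hB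
      (Real.rpow_le_one_of_one_le_of_nonpos (by linarith [norm_nonneg (γ x)]) (by norm_num)))
  calc ‖ζ‖ * (‖e‖ * ‖resolvent m (γ x)‖) ≤ (2 * (‖e‖ * B + 1))⁻¹ * (‖e‖ * B + 1) := by
        gcongr
        exact (mul_le_mul_of_nonneg_left hbB (norm_nonneg e)).trans (by linarith)
    _ = 1 / 2 := by field_simp

theorem integrable_neumannTerm_mul (hγ : IsUpwardContour γ) (m e : 𝔅)
    (hm : range γ ⊆ resolventSet ℂ m) {F : ℂ → 𝔅} {β : ℝ} (hβ : 0 < β)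
    (hF : HasDecay (range γ) β F) (n : ℕ) :
    Integrable fun x => deriv γ x • (neumannTerm m e n (γ x) * F (γ x)) :=
  hγ.integrable_smul ((hasDecay_neumannTerm m e hγ.isClosed_range hm n).mul hF) (by linarith)

theorem hasSum_integral_neumannTerm_mul (hγ : IsUpwardContour γ) {m e : 𝔅}
    (hm : range γ ⊆ resolventSet ℂ m) {F : ℂ → 𝔅} {β : ℝ} (hβ : 0 < β)
    (hF : HasDecay (range γ) β F) {ζ : ℂ}
    (hζ : ∀ x, ‖ζ‖ * (‖e‖ * ‖resolvent m (γ x)‖) ≤ 1 / 2) :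
    HasSum (fun n : ℕ => ζ ^ n • ∫ x, deriv γ x • (neumannTerm m e n (γ x) * F (γ x)))
      (∫ x, deriv γ x • (resolvent (m - ζ • e) (γ x) * F (γ x))) := by
  set f : ℕ → ℝ → 𝔅 := fun n x => ζ ^ n • (deriv γ x • (neumannTerm m e n (γ x) * F (γ x)))
    with hf
  have hfi : ∀ n, Integrable (f n) := fun n =>
    (hγ.integrable_neumannTerm_mul m e hm hβ hF n).smul (ζ ^ n)
  obtain ⟨-, B, hB, hRb⟩ := hasDecay_resolvent m hγ.isClosed_range hm
  obtain ⟨-, B', _, hFb⟩ := hF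
  set g : ℝ → ℝ := fun x => ‖deriv γ x‖ * (1 + ‖γ x‖) ^ (-(1 + β)) with hg
  have hgi : Integrable g := hγ.integrable_norm_deriv_mul_rpow hβ
  have hfg : ∀ n x, ‖f n x‖ ≤ (1 / 2) ^ n * (B * B' * g x) := fun n x => by
    have hx := mem_range_self (f := γ) x
    calc ‖f n x‖ = ‖deriv γ x‖ * ‖ζ ^ n • (neumannTerm m e n (γ x) * F (γ x))‖ := by
          simp only [hf, smul_comm (ζ ^ n), norm_smul (deriv γ x)]
      _ ≤ ‖deriv γ x‖ * ((1 / 2) ^ n * (B * B' * (1 + ‖γ x‖) ^ (-(1 + β)))) := by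
          gcongr
          refine (norm_smul_neumannTerm_mul_le _ _ _ _ _ _).trans ?_
          gcongr ?_ ^ n * ?_
          · exact hζ x
          · exact mul_le_of_le_rpow_neg (by positivity) hB (norm_nonneg _) (hRb _ hx) (hFb _ hx)
      _ = (1 / 2) ^ n * (B * B' * g x) := by rw [hg]; ring
  have hsummable : Summable fun n => ∫ x, ‖f n x‖ := by
    refine Summable.of_nonneg_of_le (fun n => integral_nonneg fun x => norm_nonneg _)
      (fun n => integral_mono (hfi n).norm ((hgi.const_mul (B * B')).const_mul _) (hfg n)) ?_
    simp_rw [integral_const_mul]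
    exact (summable_geometric_of_lt_one (by norm_num) (by norm_num)).mul_right _
  have hsum : ∀ x, ∑' n, f n x = deriv γ x • (resolvent (m - ζ • e) (γ x) * F (γ x)) := fun x => by
    rw [← (((hasSum_neumannTerm (hm (mem_range_self x)) ((hζ x).trans_lt (by norm_num))).mul_right
      (F (γ x))).const_smul (deriv γ x)).tsum_eq]
    exact tsum_congr fun n => by rw [hf, smul_mul_assoc, smul_comm]
  have hasSum := hasSum_integral_of_summable_integral_norm hfi hsummable
  simp only [hsum] at hasSum
  simpa only [hf, integral_smul] using hasSum

end IsUpwardContour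

end Neumann

section Resolvents

variable {X : Type*} [NormedAddCommGroup X] [NormedSpace ℂ X]

section BoundedInverse

variable {T : X →ₗ.[ℂ] X} {R R' : X →L[ℂ] X}

theorem isBoundedInverse_iff_mem_graph :
    IsBoundedInverse T R ↔ ∀ x y, (x, y) ∈ T.graph ↔ R y = x := by
  simp only [IsBoundedInverse, LinearPMap.mem_graph_iff]
  refine ⟨fun h x y => ⟨?_, ?_⟩,
    fun h => ⟨fun y => (h _ y).2 rfl, fun x => (h _ _).1 ⟨x, rfl, rfl⟩⟩⟩
  · rintro ⟨x, rfl, rfl⟩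
    exact h.2 x
  · rintro rfl
    exact h.1 y

theorem IsBoundedInverse.mem_graph_iff (h : IsBoundedInverse T R) {x y : X} :
    (x, y) ∈ T.graph ↔ R y = x :=
  isBoundedInverse_iff_mem_graph.1 h x y

theorem IsBoundedInverse.unique (h : IsBoundedInverse T R) (h' : IsBoundedInverse T R') :
    R = R' := by
  ext y
  exact h.mem_graph_iff.1 (h'.mem_graph_iff.2 rfl)

theorem IsBoundedInverse.injective (h : IsBoundedInverse T R) : Function.Injective R :=
  (injective_iff_map_eq_zero R).2 fun _ hy =>
    T.graph_fst_eq_zero_snd (h.mem_graph_iff.2 hy) rfl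

end BoundedInverse

variable {A : X →ₗ.[ℂ] X}

theorem mem_graph_shiftOp {z : ℂ} {x y : X} :
    (x, y) ∈ (shiftOp z A).graph ↔ (x, z • x - y) ∈ A.graph := by
  simp only [LinearPMap.mem_graph_iff]
  have happly (x : A.domain) : shiftOp z A x = z • (x : X) - A x := rfl
  constructor
  · rintro ⟨x, rfl, rfl⟩
    exact ⟨x, rfl, (sub_sub_cancel (z • (x : X)) (A x)).symm⟩
  · rintro ⟨x, rfl, hx⟩
    exact ⟨x, rfl, by rw [happly, hx, sub_sub_cancel]⟩

theorem IsBoundedInverse.resolvent_identity {z w : ℂ} {R R' : X →L[ℂ] X}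
    (h : IsBoundedInverse (shiftOp z A) R) (h' : IsBoundedInverse (shiftOp w A) R') :
    R - R' = (w - z) • (R * R') := by
  ext y
  have hA : (R' y, w • R' y - y) ∈ A.graph := mem_graph_shiftOp.1 (h'.mem_graph_iff.2 rfl)
  have hR : R (y - (w - z) • R' y) = R' y := by
    refine h.mem_graph_iff.1 (mem_graph_shiftOp.2 ?_)
    convert hA using 2
    rw [sub_smul]
    abel
  rw [map_sub, map_smul, sub_eq_iff_eq_add] at hR
  rw [sub_apply, hR, add_sub_cancel_left]
  rfl

theorem IsBoundedInverse.commute {z w : ℂ} {R R' : X →L[ℂ] X}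
    (h : IsBoundedInverse (shiftOp z A) R) (h' : IsBoundedInverse (shiftOp w A) R') :
    Commute R R' := by
  rcases eq_or_ne w z with rfl | hne
  · rw [h.unique h']
  · refine smul_right_injective _ (sub_ne_zero.2 hne) ?_
    change (w - z) • (R * R') = (w - z) • (R' * R)
    rw [← h.resolvent_identity h', ← neg_sub z w, neg_smul, ← h'.resolvent_identity h, neg_sub]

theorem isBoundedInverse_resolventOp {z : ℂ} (h : ∃ R, IsBoundedInverse (shiftOp z A) R) :
    IsBoundedInverse (shiftOp z A) (resolventOp A z) := by
  rw [resolventOp, dif_pos h]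
  exact h.choose_spec

/-- The resolvent bound `‖(z - A)⁻¹‖ ≤ C / |z|` on the sector of angle `θ₀`. -/
structure HasSectorialResolvent (A : X →ₗ.[ℂ] X) (θ₀ : ℝ) : Prop where
  angle_le : θ₀ ≤ Real.pi / 2
  resolvent_exists : ∀ z ∈ sector θ₀, ∃ R, IsBoundedInverse (shiftOp z A) R
  resolvent_bound : ∃ C : ℝ, 0 ≤ C ∧ ∀ z ∈ sector θ₀, ‖resolventOp A z‖ ≤ C / ‖z‖

theorem IsSectorialOp.hasSectorialResolvent {θ₀ : ℝ} (hA : IsSectorialOp A θ₀) :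
    HasSectorialResolvent A θ₀ where
  angle_le := hA.angle_le
  resolvent_exists := hA.resolvent_exists
  resolvent_bound := let ⟨C, hC, hb⟩ := hA.resolvent_bound; ⟨C, hC.le, hb⟩

namespace HasSectorialResolvent

variable {θ₀ α : ℝ} (hA : HasSectorialResolvent A θ₀)

include hA

theorem isBoundedInverse {z : ℂ} (hz : z ∈ sector θ₀) :
    IsBoundedInverse (shiftOp z A) (resolventOp A z) :=
  isBoundedInverse_resolventOp (hA.resolvent_exists z hz)

theorem resolventOp_sub {z w : ℂ} (hz : z ∈ sector θ₀) (hw : w ∈ sector θ₀) :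
    resolventOp A z - resolventOp A w = (w - z) • (resolventOp A z * resolventOp A w) :=
  (hA.isBoundedInverse hz).resolvent_identity (hA.isBoundedInverse hw)

theorem continuousAt_resolventOp {w : ℂ} (hw : w ∈ sector θ₀) :
    ContinuousAt (resolventOp A) w := by
  obtain ⟨C, _, hb⟩ := hA.resolvent_bound
  have hbound : Tendsto (fun z : ℂ => ‖w - z‖ * (C / ‖z‖ * ‖resolventOp A w‖)) (𝓝 w) (𝓝 0) := by
    have hcont : ContinuousAt (fun z : ℂ => ‖w - z‖ * (C / ‖z‖ * ‖resolventOp A w‖)) w :=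
      ContinuousAt.mul (by fun_prop) (ContinuousAt.mul
        (continuousAt_const.div (by fun_prop) (norm_ne_zero_iff.2 hw.1)) continuousAt_const)
    simpa only [sub_self, norm_zero, zero_mul] using hcont.tendsto
  rw [ContinuousAt, tendsto_iff_norm_sub_tendsto_zero]
  refine squeeze_zero' (Eventually.of_forall fun _ => norm_nonneg _) ?_ hbound
  filter_upwards [(isOpen_sector hA.angle_le).mem_nhds hw] with z hz
  rw [hA.resolventOp_sub hz hw, norm_smul]
  gcongr
  exact (norm_mul_le _ _).trans (by gcongr; exact hb z hz)

theorem differentiableOn_resolventOp : DifferentiableOn ℂ (resolventOp A) (sector θ₀) := by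
  intro w hw
  refine (HasDerivAt.differentiableAt (f' := -(resolventOp A w * resolventOp A w))
    ?_).differentiableWithinAt
  rw [hasDerivAt_iff_tendsto_slope]
  have hlim : Tendsto (fun z => -(resolventOp A z * resolventOp A w)) (𝓝[≠] w)
      (𝓝 (-(resolventOp A w * resolventOp A w))) :=
    ((hA.continuousAt_resolventOp hw).mul continuousAt_const).neg.tendsto.mono_left
      nhdsWithin_le_nhds
  refine hlim.congr' ?_
  filter_upwards [self_mem_nhdsWithin,
    nhdsWithin_le_nhds ((isOpen_sector hA.angle_le).mem_nhds hw)] with z hz hzS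
  rw [slope_def_module, hA.resolventOp_sub hzS hw, smul_smul, ← neg_sub z w, mul_neg,
    inv_mul_cancel₀ (sub_ne_zero.2 hz), neg_smul, one_smul]

theorem differentiableOn_resolventOp_cpow (hα : 0 < α) :
    DifferentiableOn ℂ (fun z => resolventOp A (z ^ (α : ℂ))) (sector (theta1 α θ₀)) := by
  refine hA.differentiableOn_resolventOp.comp (fun z hz => ?_)
    fun z hz => cpow_mem_sector hα hA.angle_le hz
  exact (differentiableAt_id.cpow_const
    (sector_subset_slitPlane theta1_le_pi_div_two hz)).differentiableWithinAt

theorem isBigO_resolventOp_cpow {β : ℝ} (hβ : 0 < β) (hβα : β ≤ α) :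
    (fun z => resolventOp A (z ^ (α : ℂ))) =O[cocompact ℂ ⊓ 𝓟 (sector (theta1 α θ₀))]
      fun z => (1 + ‖z‖) ^ (-β) := by
  obtain ⟨C, hC, hb⟩ := hA.resolvent_bound
  refine Asymptotics.IsBigO.of_bound (C * 2 ^ β) ?_
  rw [Filter.eventually_inf_principal]
  filter_upwards [tendsto_norm_cocompact_atTop.eventually_ge_atTop (1 : ℝ)] with z hz hzS
  have hz0 : 0 < ‖z‖ := by linarith
  calc ‖resolventOp A (z ^ (α : ℂ))‖ ≤ C / ‖z ^ (α : ℂ)‖ :=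
        hb _ (cpow_mem_sector (hβ.trans_le hβα) hA.angle_le hzS)
    _ = C * ‖z‖ ^ (-α) := by
        rw [Complex.norm_cpow_of_ne_zero hzS.1, Real.rpow_neg hz0.le]
        simp [div_eq_mul_inv]
    _ ≤ C * ‖z‖ ^ (-β) := by gcongr
    _ = C * (2 ^ β * (2 * ‖z‖) ^ (-β)) := by
        rw [Real.mul_rpow zero_le_two hz0.le, ← mul_assoc (2 ^ β : ℝ), ← Real.rpow_add two_pos,
          add_neg_cancel, Real.rpow_zero, one_mul]
    _ ≤ C * (2 ^ β * (1 + ‖z‖) ^ (-β)) := by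
        gcongr C * (2 ^ β * ?_)
        exact Real.rpow_le_rpow_of_nonpos (by positivity) (by linarith) (neg_nonpos.2 hβ.le)
    _ = C * 2 ^ β * ‖(1 + ‖z‖) ^ (-β)‖ := by
        rw [Real.norm_of_nonneg (by positivity), mul_assoc]

end HasSectorialResolvent

end Resolvents

section BlockOperators

variable {X : Type*} [NormedAddCommGroup X] [NormedSpace ℂ X] {s : ℕ}

/-- The operator `M ⊗ Id` on `X^s`. -/
noncomputable def matOp (X : Type*) [NormedAddCommGroup X] [NormedSpace ℂ X] {s : ℕ} :
    Matrix (Fin s) (Fin s) ℂ →ₐ[ℂ] ((Fin s → X) →L[ℂ] (Fin s → X)) :=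
  AlgHom.ofLinearMap
    { toFun := fun M => ContinuousLinearMap.pi fun i =>
        ∑ j, M i j • (ContinuousLinearMap.proj j : (Fin s → X) →L[ℂ] X)
      map_add' := fun M N => by
        ext x i
        simp [add_smul, Finset.sum_add_distrib]
      map_smul' := fun c M => by
        ext x i
        simp [Finset.smul_sum, mul_smul] }
    (by
      ext x i
      simp [Matrix.one_apply])
    (fun M N => by
      ext x i
      simp only [LinearMap.coe_mk, AddHom.coe_mk, Matrix.mul_apply, ContinuousLinearMap.coe_pi',
        mul_apply_eq_comp, sum_apply, smul_apply, ContinuousLinearMap.proj_apply, Finset.sum_smul,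
        Finset.smul_sum, smul_smul]
      exact Finset.sum_comm)

theorem matOp_apply (M : Matrix (Fin s) (Fin s) ℂ) (x : Fin s → X) (i : Fin s) :
    matOp X M x i = ∑ j, M i j • x j := by
  simp [matOp]

/-- The operator `Id_s ⊗ T` on `X^s`. -/
noncomputable def diagOp (X : Type*) [NormedAddCommGroup X] [NormedSpace ℂ X] (s : ℕ) :
    (X →L[ℂ] X) →L[ℂ] ((Fin s → X) →L[ℂ] (Fin s → X)) :=
  LinearMap.mkContinuous
    { toFun := fun T => ContinuousLinearMap.pi fun i => T.comp (ContinuousLinearMap.proj i)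
      map_add' := fun _ _ => rfl
      map_smul' := fun _ _ => rfl } 1 fun T => by
    rw [one_mul]
    refine ContinuousLinearMap.opNorm_le_bound _ (norm_nonneg _) fun x => ?_
    refine (pi_norm_le_iff_of_nonneg (by positivity)).2 fun i => ?_
    exact (T.le_opNorm _).trans (by gcongr; exact norm_le_pi_norm x i)

theorem diagOp_apply (T : X →L[ℂ] X) (x : Fin s → X) (i : Fin s) : diagOp X s T x i = T (x i) := rfl

theorem diagOp_mul (T T' : X →L[ℂ] X) : diagOp X s (T * T') = diagOp X s T * diagOp X s T' := rfl

theorem commute_matOp_diagOp (M : Matrix (Fin s) (Fin s) ℂ) (T : X →L[ℂ] X) :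
    Commute (matOp X M) (diagOp X s T) := by
  ext x i
  simp [mul_apply_eq_comp, matOp_apply, diagOp_apply]

theorem mem_graph_blockShift {P : Matrix (Fin s) (Fin s) ℂ} {A : X →ₗ.[ℂ] X} {x y : Fin s → X} :
    (x, y) ∈ (blockShift P A).graph ↔ ∀ i, (x i, matOp X P x i - y i) ∈ A.graph := by
  have hdom : x ∈ (blockShift P A).domain ↔ ∀ i, x i ∈ A.domain :=
    ⟨fun h i => h i (mem_univ i), fun h i _ => h i⟩
  have happly (hx : x ∈ (blockShift P A).domain) (i : Fin s) :
      blockShift P A ⟨x, hx⟩ i = matOp X P x i - A ⟨x i, hdom.1 hx i⟩ := by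
    rw [matOp_apply]
    change (∑ j, P i j • LinearMap.proj j : (Fin s → X) →ₗ[ℂ] X) x - _ = _
    rw [LinearMap.sum_apply]
    rfl
  simp only [LinearPMap.mem_graph_iff]
  constructor
  · rintro ⟨⟨x, hx⟩, rfl, rfl⟩ i
    exact ⟨⟨x i, hdom.1 hx i⟩, rfl, by rw [happly, sub_sub_cancel]⟩
  · intro h
    have hx : x ∈ (blockShift P A).domain := hdom.2 fun i => by
      obtain ⟨v, hv, -⟩ := h i
      exact hv ▸ v.2
    refine ⟨⟨x, hx⟩, rfl, funext fun i => ?_⟩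
    obtain ⟨v, hv, hAv⟩ := h i
    rw [happly, show (⟨x i, hdom.1 hx i⟩ : A.domain) = v from Subtype.ext hv.symm, hAv,
      sub_sub_cancel]

theorem isBoundedInverse_blockShift {A : X →ₗ.[ℂ] X} {R : X →L[ℂ] X}
    (hR : IsBoundedInverse (shiftOp 1 A) R) {P : Matrix (Fin s) (Fin s) ℂ}
    {Φ : (Fin s → X) →L[ℂ] (Fin s → X)}
    (hleft : (1 + (matOp X P - 1) * diagOp X s R) * Φ = diagOp X s R)
    (hright : Φ * (1 + (matOp X P - 1) * diagOp X s R) = diagOp X s R) :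
    IsBoundedInverse (blockShift P A) Φ := by
  set D := diagOp X s R
  set Q := 1 + (matOp X P - 1) * D with hQ
  have hD : Function.Injective D := hR.injective.comp_left
  have hgraph (x y : Fin s → X) : (x, y) ∈ (blockShift P A).graph ↔ D y = Q x := by
    have hcomm : (matOp X P - 1) * D = D * (matOp X P - 1) :=
      ((commute_matOp_diagOp P R).sub_left (Commute.one_left D)).eq
    have hDQ : D y = Q x ↔ D (y - (matOp X P x - x)) = x := by
      rw [hQ, hcomm, map_sub, sub_eq_iff_eq_add]
      rfl
    rw [mem_graph_blockShift, hDQ, funext_iff]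
    refine forall_congr' fun i => ?_
    have hi := hR.mem_graph_iff (x := x i) (y := (y - (matOp X P x - x)) i)
    rw [mem_graph_shiftOp] at hi
    rw [diagOp_apply, ← hi]
    simp only [one_smul, Pi.sub_apply]
    abel_nf
  refine isBoundedInverse_iff_mem_graph.2 fun x y => ?_
  rw [hgraph]
  constructor
  · intro h
    refine hD ?_
    rw [← hright, mul_apply_eq_comp, mul_apply_eq_comp, ← h, ← mul_apply_eq_comp Q, hleft]
  · rintro rfl
    rw [← mul_apply_eq_comp, hleft]

end BlockOperators

section PrincipalPower

open Polynomial

variable {s : ℕ}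

theorem iteratedDeriv_polynomial_eval (p : ℂ[X]) (k : ℕ) (z : ℂ) :
    iteratedDeriv k (fun z => p.eval z) z = (derivative^[k] p).eval z := by
  induction k generalizing p z with
  | zero => simp
  | succ k ih =>
    rw [iteratedDeriv_succ', Function.iterate_succ_apply, ← ih]
    congr 1
    ext w
    exact p.deriv

theorem iteratedDeriv_eq_zero_of_eventually_eq {f v : ℂ → ℂ} {μ : ℂ} (hv : AnalyticAt ℂ v μ)
    (hf : ∀ᶠ z in 𝓝 μ, f z = (z - μ) ^ s * v z) {k : ℕ} (hk : k < s) :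
    iteratedDeriv k f μ = 0 := by
  have hfa : AnalyticAt ℂ f μ :=
    AnalyticAt.congr (by fun_prop : AnalyticAt ℂ (fun z => (z - μ) ^ s * v z) μ)
      (hf.mono fun z hz => hz.symm)
  have horder : (s : ℕ∞) ≤ analyticOrderAt f μ := by
    rw [natCast_le_analyticOrderAt hfa]
    exact ⟨v, hv, by simpa only [smul_eq_mul] using hf⟩
  exact (natCast_le_analyticOrderAt_iff_iteratedDeriv_eq_zero hfa).1 horder k hk

theorem iterate_derivative_eval_eq_iteratedDeriv {U : Set ℂ} (hU : IsOpen U) {g u : ℂ → ℂ}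
    (hg : DifferentiableOn ℂ g U) (hu : DifferentiableOn ℂ u U) {p q : ℂ[X]}
    (h : ∀ z ∈ U, g z = p.eval z + (q ^ s).eval z * u z) {μ : ℂ} (hμ : μ ∈ U) (hq : q.IsRoot μ)
    {k : ℕ} (hk : k < s) : (derivative^[k] p).eval μ = iteratedDeriv k g μ := by
  obtain ⟨w, rfl⟩ := dvd_iff_isRoot.2 hq
  have hnhds : U ∈ 𝓝 μ := hU.mem_nhds hμ
  have hua : AnalyticAt ℂ u μ := hu.analyticAt hnhds
  have hpa (p : ℂ[X]) : AnalyticAt ℂ (fun z => p.eval z) μ := p.differentiable.analyticAt μ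
  have hzero : iteratedDeriv k (fun z => g z - p.eval z) μ = 0 := by
    refine iteratedDeriv_eq_zero_of_eventually_eq (((hpa w).pow s).mul hua) ?_ hk
    filter_upwards [hnhds] with z hz
    rw [h z hz, add_sub_cancel_left, eval_pow, eval_mul, mul_pow, eval_sub, eval_X, eval_C,
      mul_assoc]
    rfl
  rw [iteratedDeriv_fun_sub (hg.analyticAt hnhds).contDiffAt (hpa p).contDiffAt, sub_eq_zero,
    iteratedDeriv_polynomial_eval] at hzero
  exact hzero.symm

theorem mem_roots_charpoly_iff {M : Matrix (Fin s) (Fin s) ℂ} {μ : ℂ} :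
    μ ∈ M.charpoly.roots ↔ μ ∈ spectrum ℂ M := by
  rw [mem_roots M.charpoly_monic.ne_zero, Matrix.mem_spectrum_iff_isRoot_charpoly]

theorem charpoly_dvd_of_derivative_eval_eq_zero {M : Matrix (Fin s) (Fin s) ℂ} {p : ℂ[X]}
    (h : ∀ μ ∈ spectrum ℂ M, ∀ k < s, (derivative^[k] p).eval μ = 0) : M.charpoly ∣ p := by
  rcases eq_or_ne p 0 with rfl | hp
  · exact dvd_zero _
  refine (IsAlgClosed.splits M.charpoly).dvd_of_roots_le_roots M.charpoly_monic.ne_zero ?_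
  rw [Multiset.le_iff_count]
  intro μ
  by_cases hμ : μ ∈ M.charpoly.roots
  · have hcount : M.charpoly.roots.count μ ≤ s := by
      refine (Multiset.count_le_card _ _).trans ((card_roots' _).trans ?_)
      rw [Matrix.charpoly_natDegree_eq_dim, Fintype.card_fin]
    refine hcount.trans ?_
    rw [count_roots]
    rcases s with _ | s
    · exact Nat.zero_le _
    · exact (lt_rootMultiplicity_iff_isRoot_iterate_derivative hp).2 fun k hk =>
        h μ (mem_roots_charpoly_iff.1 hμ) k (by omega)
  · rw [Multiset.count_eq_zero_of_notMem hμ]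
    exact Nat.zero_le _

theorem IsPrincipalPower.unique {M P P' : Matrix (Fin s) (Fin s) ℂ} {α : ℝ}
    (h : IsPrincipalPower M α P) (h' : IsPrincipalPower M α P') : P = P' := by
  obtain ⟨-, p, rfl, hp⟩ := h
  obtain ⟨-, p', rfl, hp'⟩ := h'
  obtain ⟨w, hw⟩ : M.charpoly ∣ p - p' := by
    refine charpoly_dvd_of_derivative_eval_eq_zero fun μ hμ k hk => ?_
    rw [iterate_derivative_sub, eval_sub, hp μ hμ k hk, hp' μ hμ k hk, sub_self]
  rw [← sub_eq_zero, ← map_sub, hw, map_mul, Matrix.aeval_self_charpoly, zero_mul]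

theorem prod_roots_charpoly (M : Matrix (Fin s) (Fin s) ℂ) :
    (M.charpoly.roots.map fun a => X - C a).prod = M.charpoly :=
  ((IsAlgClosed.splits M.charpoly).eq_prod_roots_of_monic M.charpoly_monic).symm

variable {X : Type*} [NormedAddCommGroup X] [NormedSpace ℂ X]

theorem aeval_matOp (M : Matrix (Fin s) (Fin s) ℂ) (p : ℂ[X]) :
    aeval (matOp X M) p = matOp X (aeval M p) :=
  aeval_algHom_apply _ _ _

theorem aeval_matOp_charpoly (M : Matrix (Fin s) (Fin s) ℂ) :
    aeval (matOp X M) M.charpoly = 0 := by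
  rw [aeval_matOp, Matrix.aeval_self_charpoly, map_zero]

/-- The quotient `ψ` is `(z^α - M^α)/(z - M)`. -/
theorem exists_isPrincipalPower_quotient [NeZero s] {M : Matrix (Fin s) (Fin s) ℂ} (α : ℝ)
    (hM : spectrum ℂ M ⊆ Complex.slitPlane) :
    ∃ P, IsPrincipalPower M α P ∧ ∃ ψ : ℂ → ((Fin s → X) →L[ℂ] (Fin s → X)),
      DifferentiableOn ℂ ψ Complex.slitPlane ∧ ∀ z ∈ Complex.slitPlane,
        algebraMap ℂ _ (z ^ (α : ℂ)) = matOp X P + (algebraMap ℂ _ z - matOp X M) * ψ z := by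
  have hcpow : DifferentiableOn ℂ (fun z : ℂ => z ^ (α : ℂ)) Complex.slitPlane := fun z hz =>
    (differentiableAt_id.cpow_const hz).differentiableWithinAt
  obtain ⟨p, u, hu, hpu⟩ := exists_hermite_interpolation Complex.isOpen_slitPlane
    (T := s • M.charpoly.roots)
    (fun a ha => hM (mem_roots_charpoly_iff.1 (Multiset.mem_of_mem_nsmul ha))) hcpow
  simp only [Multiset.map_nsmul, Multiset.prod_nsmul, prod_roots_charpoly] at hpu
  refine ⟨aeval M p, ⟨hM, p, rfl, fun μ hμ k hk =>
    iterate_derivative_eval_eq_iteratedDeriv Complex.isOpen_slitPlane hcpow hu hpu (hM hμ)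
      (Matrix.mem_spectrum_iff_isRoot_charpoly.1 hμ) hk⟩, ?_⟩
  obtain ⟨K, hK, hKp⟩ := exists_aeval_quotient (matOp X M) p
  obtain ⟨K', hK', hKp'⟩ := exists_aeval_quotient (matOp X M) (M.charpoly ^ s)
  refine ⟨fun z => K z + u z • K' z, hK.differentiableOn.add (hu.smul hK'.differentiableOn),
    fun z hz => ?_⟩
  rw [map_pow, aeval_matOp_charpoly, zero_pow (NeZero.ne s)] at hKp'
  simp only [zero_add] at hKp'
  rw [hpu z hz, map_add, hKp, map_mul, hKp', aeval_matOp, mul_add, mul_smul_comm, add_assoc,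
    ← Algebra.commutes, Algebra.smul_def]

end PrincipalPower

section BlockInverse

/-- The identity `(1 + (g(z) - 1) D) F(z) = D` is inherited by the values `Φ` of `F` and `p` of `g`
at `m`. -/
theorem mul_eq_and_mul_eq_of_quotients {𝔅 : Type*} [NormedRing 𝔅] [NormedAlgebra ℂ 𝔅]
    [CompleteSpace 𝔅] {m p D Φ : 𝔅} {F Ψ ψ : ℂ → 𝔅} {g : ℂ → ℂ} {S : Set ℂ} (hS : IsOpen S)
    (hm : spectrum ℂ m ⊆ S) (hF : DifferentiableOn ℂ F S) (hΨ : DifferentiableOn ℂ Ψ S)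
    (hψ : DifferentiableOn ℂ ψ S) (hFΨ : ∀ z ∈ S, F z = Φ + (algebraMap ℂ 𝔅 z - m) * Ψ z)
    (hgψ : ∀ z ∈ S, algebraMap ℂ 𝔅 (g z) = p + (algebraMap ℂ 𝔅 z - m) * ψ z)
    (hFD : ∀ z ∈ S, (1 + (algebraMap ℂ 𝔅 (g z) - 1) * D) * F z = D)
    (hmp : Commute m p) (hmD : Commute m D) (hcomm : ∀ z ∈ S, Commute (F z) (1 + (p - 1) * D)) :
    (1 + (p - 1) * D) * Φ = D ∧ Φ * (1 + (p - 1) * D) = D := by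
  generalize hQ : 1 + (p - 1) * D = Q at hcomm ⊢
  have hmQ (z : ℂ) : Commute (algebraMap ℂ 𝔅 z - m) Q :=
    (Algebra.commute_algebraMap_left z Q).sub_left (hQ ▸
      (Commute.one_right m).add_right ((hmp.sub_right (Commute.one_right m)).mul_right hmD))
  have hQF : ∀ z ∈ S, Q * F z = D - (algebraMap ℂ 𝔅 z - m) * (ψ z * (D * F z)) := fun z hz => by
    have hg := hFD z hz
    rw [hgψ z hz] at hg
    rw [← hQ, eq_sub_iff_add_eq]
    exact Eq.trans (by noncomm_ring) hg
  constructor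
  · refine sub_eq_zero.1 (eq_zero_of_quotient hS hm (Ψ := fun z => -(ψ z * (D * F z) + Q * Ψ z))
      (((hψ.mul (hF.const_mul D)).add (hΨ.const_mul Q)).neg) fun z hz => ?_)
    have hQΦ : Q * F z = Q * Φ + (algebraMap ℂ 𝔅 z - m) * (Q * Ψ z) := by
      rw [← mul_assoc (algebraMap ℂ 𝔅 z - m), (hmQ z).eq, mul_assoc, ← mul_add, ← hFΨ z hz]
    rw [eq_sub_of_add_eq (hQΦ.symm.trans (hQF z hz)), mul_neg, mul_add]
    abel
  · refine sub_eq_zero.1 (eq_zero_of_quotient hS hm (Ψ := fun z => -(ψ z * (D * F z) + Ψ z * Q))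
      (((hψ.mul (hF.const_mul D)).add (hΨ.mul_const Q)).neg) fun z hz => ?_)
    have hΦQ : Q * F z = Φ * Q + (algebraMap ℂ 𝔅 z - m) * (Ψ z * Q) := by
      rw [← (hcomm z hz).eq, ← mul_assoc, ← add_mul, ← hFΨ z hz]
    rw [eq_sub_of_add_eq (hΦQ.symm.trans (hQF z hz)), mul_neg, mul_add]
    abel

variable {X : Type*} [NormedAddCommGroup X] [NormedSpace ℂ X] {A : X →ₗ.[ℂ] X} {θ₀ α : ℝ}

theorem HasSectorialResolvent.differentiableOn_diagOp_resolventOp_cpow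
    (hA : HasSectorialResolvent A θ₀) (hα : 0 < α) (s : ℕ) :
    DifferentiableOn ℂ (fun z => diagOp X s (resolventOp A (z ^ (α : ℂ))))
      (sector (theta1 α θ₀)) :=
  (diagOp X s).differentiable.comp_differentiableOn (hA.differentiableOn_resolventOp_cpow hα)

theorem HasSectorialResolvent.one_add_sub_one_mul_diagOp_resolventOp
    (hA : HasSectorialResolvent A θ₀) (h1 : (1 : ℂ) ∈ sector θ₀) {z : ℂ} (hz : z ∈ sector θ₀)
    (s : ℕ) :
    (1 + (algebraMap ℂ _ z - 1) * diagOp X s (resolventOp A 1)) * diagOp X s (resolventOp A z) =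
      diagOp X s (resolventOp A 1) := by
  have hsub : diagOp X s (resolventOp A 1) - diagOp X s (resolventOp A z) =
      (z - 1) • (diagOp X s (resolventOp A 1) * diagOp X s (resolventOp A z)) := by
    rw [← map_sub, hA.resolventOp_sub h1 hz, map_smul, diagOp_mul]
  rw [add_mul, one_mul, ← map_one (algebraMap ℂ ((Fin s → X) →L[ℂ] (Fin s → X))), ← map_sub,
    mul_assoc, ← Algebra.smul_def, ← hsub, add_sub_cancel]

variable [CompleteSpace X] {s : ℕ} [NeZero s]

theorem HasSectorialResolvent.exists_blockInverse (hA : HasSectorialResolvent A θ₀) (hα : 0 < α)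
    (hθ : 0 ≤ theta1 α θ₀) {M : Matrix (Fin s) (Fin s) ℂ}
    (hM : spectrum ℂ M ⊆ sector (theta1 α θ₀)) :
    ∃ (P : Matrix (Fin s) (Fin s) ℂ) (Φ : (Fin s → X) →L[ℂ] (Fin s → X))
      (Ψ : ℂ → ((Fin s → X) →L[ℂ] (Fin s → X))),
      IsPrincipalPower M α P ∧ IsBoundedInverse (blockShift P A) Φ ∧
      DifferentiableOn ℂ Ψ (sector (theta1 α θ₀)) ∧
      ∀ z ∈ sector (theta1 α θ₀), diagOp X s (resolventOp A (z ^ (α : ℂ))) =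
        Φ + (algebraMap ℂ _ z - matOp X M) * Ψ z := by
  set S := sector (theta1 α θ₀)
  set m := matOp X M
  have hS : IsOpen S := isOpen_sector theta1_le_pi_div_two
  have hslit : S ⊆ Complex.slitPlane := sector_subset_slitPlane theta1_le_pi_div_two
  have hF := hA.differentiableOn_diagOp_resolventOp_cpow hα s
  obtain ⟨Φ, Ψ, hΨ, hΦΨ⟩ := exists_resolvent_quotient m hS (T := M.charpoly.roots) (N := 1)
    (fun a ha => hM (mem_roots_charpoly_iff.1 ha))
    (by rw [prod_roots_charpoly, aeval_matOp_charpoly, zero_mul]) hF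
  simp only [one_mul] at hΦΨ
  obtain ⟨P, hP, ψ, hψ, hPψ⟩ := exists_isPrincipalPower_quotient (X := X) α (hM.trans hslit)
  have hone : (1 : ℂ) ∈ sector θ₀ := one_mem_sector hα hθ
  set D := diagOp X s (resolventOp A 1)
  have hcomm : ∀ z ∈ S, Commute (diagOp X s (resolventOp A (z ^ (α : ℂ))))
      (1 + (matOp X P - 1) * D) := fun z hz =>
    (Commute.one_right _).add_right
      (((commute_matOp_diagOp P _).symm.sub_right (Commute.one_right _)).mul_right
        (congrArg (diagOp X s) ((hA.isBoundedInverse (cpow_mem_sector hα hA.angle_le hz)).commute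
          (hA.isBoundedInverse hone)).eq))
  have hmP : Commute m (matOp X P) := by
    obtain ⟨-, p, rfl, -⟩ := hP
    rw [← aeval_matOp]
    simpa only [Polynomial.aeval_X] using
      (Commute.all (Polynomial.X : Polynomial ℂ) p).map (Polynomial.aeval m)
  obtain ⟨hleft, hright⟩ := mul_eq_and_mul_eq_of_quotients hS
    ((AlgHom.spectrum_apply_subset (matOp X) M).trans hM) hF hΨ (hψ.mono hslit) hΦΨ
    (fun z hz => hPψ z (hslit hz))
    (fun z hz => hA.one_add_sub_one_mul_diagOp_resolventOp hone
      (cpow_mem_sector hα hA.angle_le hz) s) hmP (commute_matOp_diagOp M _) hcomm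
  exact ⟨P, Φ, Ψ, hP, isBoundedInverse_blockShift (hA.isBoundedInverse hone) hleft hright, hΨ, hΦΨ⟩

end BlockInverse

section RowTensor

variable {X : Type*} [NormedAddCommGroup X] [NormedSpace ℂ X] {s : ℕ}

theorem rowTensor_apply (v : Fin s → ℂ) (T : X →L[ℂ] X) (x : Fin s → X) :
    rowTensor v T x = ∑ j, v j • T (x j) := by
  simp [rowTensor]

theorem rowTensor_vecMul (v : Fin s → ℂ) (M : Matrix (Fin s) (Fin s) ℂ) (T : X →L[ℂ] X) :
    rowTensor (Matrix.vecMul v M) T = (rowTensor v T).comp (matOp X M) := by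
  ext x
  simp only [rowTensor_apply, ContinuousLinearMap.comp_apply, matOp_apply, map_sum, map_smul,
    Finset.smul_sum, smul_smul, Matrix.vecMul, dotProduct, Finset.sum_smul]
  exact Finset.sum_comm

theorem rowTensor_smul (c : ℂ) (v : Fin s → ℂ) (T : X →L[ℂ] X) :
    rowTensor (c • v) T = c • rowTensor v T := by
  ext x
  simp [rowTensor_apply, Finset.smul_sum, smul_smul]

theorem rowTensor_one_comp_diagOp (v : Fin s → ℂ) (T : X →L[ℂ] X) :
    (rowTensor v 1).comp (diagOp X s T) = rowTensor v T := by
  ext x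
  simp [rowTensor_apply, diagOp_apply]

theorem rowTensor_eq_apply (v : Fin s → ℂ) (T : X →L[ℂ] X) (x : Fin s → X) :
    rowTensor v T x = T (rowTensor v 1 x) := by
  simp [rowTensor_apply]

theorem rowTensor_one_const (v : Fin s → ℂ) (y : X) :
    rowTensor v 1 (fun _ => y) = (∑ j, v j) • y := by
  simp [rowTensor_apply, Finset.sum_smul]

theorem rowTensor_single (i : Fin s) :
    rowTensor (X := X) (Pi.single i 1) 1 = ContinuousLinearMap.proj i := by
  ext x
  simp [rowTensor_apply, Pi.single_apply]

end RowTensor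

namespace RungeKutta

variable {s : ℕ} {rk : RungeKutta s}

section StifflyAccurate

variable [NeZero s]

/-- Stiff accuracy of the method: `bᵀ` is the last row of `𝒜`. -/
def IsStifflyAccurate (rk : RungeKutta s) : Prop := ∀ j, rk.b j = rk.a (lastStage s) j

/-- The rank one matrix `𝒜⁻¹ 𝟙 e_sᵀ`, the coefficient of `-ζ` in `Δ(ζ)`. -/
noncomputable def perturb (rk : RungeKutta s) : Matrix (Fin s) (Fin s) ℂ :=
  rk.mat⁻¹ * Matrix.vecMulVec (fun _ => 1) (Pi.single (lastStage s) 1)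

theorem IsStifflyAccurate.single_vecMul (hacc : rk.IsStifflyAccurate) :
    Matrix.vecMul (Pi.single (lastStage s) 1) rk.mat = rk.wt := by
  ext j
  simp [mat, wt, hacc j]

theorem IsStifflyAccurate.wt_vecMul_inv (hacc : rk.IsStifflyAccurate)
    (hdet : IsUnit rk.mat.det) :
    Matrix.vecMul rk.wt rk.mat⁻¹ = Pi.single (lastStage s) 1 := by
  rw [← hacc.single_vecMul, Matrix.vecMul_vecMul, Matrix.mul_nonsing_inv _ hdet,
    Matrix.vecMul_one]

theorem IsStifflyAccurate.delta_eq (hacc : rk.IsStifflyAccurate) (hdet : IsUnit rk.mat.det)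
    {ζ : ℂ} (hζ : ζ ≠ 1) : rk.delta ζ = rk.mat⁻¹ - ζ • rk.perturb := by
  have hζ' : 1 - ζ ≠ 0 := sub_ne_zero.2 hζ.symm
  refine Matrix.inv_eq_right_inv ?_
  rw [perturb, ← hacc.single_vecMul, ← Matrix.vecMulVec_mul]
  have hVV : Matrix.vecMulVec (fun _ : Fin s => (1 : ℂ)) (Pi.single (lastStage s) 1) *
      Matrix.vecMulVec (fun _ => 1) (Pi.single (lastStage s) 1) =
        Matrix.vecMulVec (fun _ => 1) (Pi.single (lastStage s) 1) := by
    rw [Matrix.vecMulVec_mul_vecMulVec, single_one_dotProduct, one_smul]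
  generalize Matrix.vecMulVec (fun _ : Fin s => (1 : ℂ)) (Pi.single (lastStage s) 1) = V at *
  calc (rk.mat + (ζ / (1 - ζ)) • (V * rk.mat)) * (rk.mat⁻¹ - ζ • (rk.mat⁻¹ * V))
      = (1 + (ζ / (1 - ζ)) • V) * (rk.mat * rk.mat⁻¹) * (1 - ζ • V) := by noncomm_ring
    _ = 1 + (ζ / (1 - ζ) - ζ - ζ / (1 - ζ) * ζ) • V := by
        rw [Matrix.mul_nonsing_inv _ hdet, mul_one, mul_sub, mul_one, add_mul, one_mul,
          smul_mul_smul_comm, hVV, sub_smul, sub_smul]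
        abel
    _ = 1 := by
        rw [show ζ / (1 - ζ) - ζ - ζ / (1 - ζ) * ζ = 0 by field_simp; ring, zero_smul, add_zero]

end StifflyAccurate

theorem isUnit_one_sub (hdet : IsUnit rk.mat.det) {w : ℂ} (hw : w ∉ spectrum ℂ rk.mat⁻¹) :
    IsUnit (1 - w • rk.mat).det := by
  have hunit : IsUnit (algebraMap ℂ (Matrix (Fin s) (Fin s) ℂ) w - rk.mat⁻¹) := by
    simpa [spectrum.mem_iff] using hw
  have hfactor : 1 - w • rk.mat =
      -((algebraMap ℂ (Matrix (Fin s) (Fin s) ℂ) w - rk.mat⁻¹) * rk.mat) := by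
    rw [sub_mul, Matrix.nonsing_inv_mul _ hdet, Algebra.algebraMap_eq_smul_one,
      smul_mul_assoc, one_mul, neg_sub]
  rw [← Matrix.isUnit_iff_isUnit_det, hfactor]
  exact (hunit.mul ((Matrix.isUnit_iff_isUnit_det _).2 hdet)).neg

theorem q_vecMul (hdet : IsUnit rk.mat.det) {w : ℂ} (hw : w ∉ spectrum ℂ rk.mat⁻¹) :
    Matrix.vecMul (rk.q w) (1 - w • rk.mat) = rk.wt := by
  rw [q, Matrix.vecMul_vecMul, Matrix.nonsing_inv_mul _ (isUnit_one_sub hdet hw),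
    Matrix.vecMul_one]

namespace IsStifflyAccurate

variable [NeZero s] (hacc : rk.IsStifflyAccurate) (hdet : IsUnit rk.mat.det)

include hacc hdet

theorem q_vecMul_inv {w : ℂ} (hw : w ∉ spectrum ℂ rk.mat⁻¹) :
    Matrix.vecMul (rk.q w) rk.mat⁻¹ = Pi.single (lastStage s) 1 + w • rk.q w := by
  have h : Matrix.vecMul (Matrix.vecMul (rk.q w) (1 - w • rk.mat)) rk.mat⁻¹ =
      Pi.single (lastStage s) 1 := by
    rw [q_vecMul hdet hw, hacc.wt_vecMul_inv hdet]
  rw [Matrix.vecMul_vecMul, sub_mul, one_mul, smul_mul_assoc, Matrix.mul_nonsing_inv _ hdet,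
    Matrix.vecMul_sub, Matrix.vecMul_smul, Matrix.vecMul_one] at h
  rw [← h, sub_add_cancel]

theorem q_vecMul_perturb {w : ℂ} (hw : w ∉ spectrum ℂ rk.mat⁻¹) :
    Matrix.vecMul (rk.q w) rk.perturb = rk.r w • Pi.single (lastStage s) 1 := by
  rw [perturb, ← Matrix.vecMul_vecMul, hacc.q_vecMul_inv hdet hw, Matrix.vecMul_vecMulVec]
  congr 1
  simp [r, dotProduct, Finset.sum_add_distrib, Finset.mul_sum, Pi.single_apply]

variable {X : Type*} [NormedAddCommGroup X] [NormedSpace ℂ X] {h : ℝ} (hh : h ≠ 0) {z : ℂ}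
  (hz : (h : ℂ) * z ∉ spectrum ℂ rk.mat⁻¹)
  (hzm : z ∈ resolventSet ℂ (matOp X ((h : ℂ)⁻¹ • rk.mat⁻¹)))

include hh hz hzm

theorem proj_comp_resolvent :
    (ContinuousLinearMap.proj (lastStage s) : (Fin s → X) →L[ℂ] X).comp
      (resolvent (matOp X ((h : ℂ)⁻¹ • rk.mat⁻¹)) z) = -(h : ℂ) • rowTensor (rk.q (h * z)) 1 := by
  have hh' : (h : ℂ) ≠ 0 := by exact_mod_cast hh
  have hshift : algebraMap ℂ _ z - matOp X ((h : ℂ)⁻¹ • rk.mat⁻¹) =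
      matOp X (z • (1 : Matrix (Fin s) (Fin s) ℂ) - (h : ℂ)⁻¹ • rk.mat⁻¹) := by
    rw [map_sub, ← Algebra.algebraMap_eq_smul_one, AlgHom.commutes]
  have hinv : (algebraMap ℂ _ z - matOp X ((h : ℂ)⁻¹ • rk.mat⁻¹)) *
      resolvent (matOp X ((h : ℂ)⁻¹ • rk.mat⁻¹)) z = 1 := Ring.mul_inverse_cancel _ hzm
  have hproj : (ContinuousLinearMap.proj (lastStage s) : (Fin s → X) →L[ℂ] X) =
      -(h : ℂ) • (rowTensor (rk.q (h * z)) 1).comp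
        (algebraMap ℂ _ z - matOp X ((h : ℂ)⁻¹ • rk.mat⁻¹)) := by
    rw [hshift, ← rowTensor_vecMul, ← rowTensor_smul, ← rowTensor_single]
    congr 1
    rw [Matrix.vecMul_sub, Matrix.vecMul_smul, Matrix.vecMul_smul, Matrix.vecMul_one,
      hacc.q_vecMul_inv hdet hz, smul_add, smul_smul, smul_sub, smul_add, smul_smul, smul_smul,
      smul_smul, neg_mul, neg_mul, neg_mul, mul_inv_cancel₀ hh', mul_inv_cancel_left₀ hh']
    module
  rw [hproj, ContinuousLinearMap.smul_comp, ContinuousLinearMap.comp_assoc]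
  congr 1
  exact (congrArg (rowTensor (rk.q (h * z)) 1).comp hinv).trans (ContinuousLinearMap.comp_id _)

theorem rowTensor_q_comp_pow (n : ℕ) :
    (rowTensor (rk.q (h * z)) 1).comp ((-(matOp X ((h : ℂ)⁻¹ • rk.perturb) *
      resolvent (matOp X ((h : ℂ)⁻¹ • rk.mat⁻¹)) z)) ^ n) =
        rk.r (h * z) ^ n • rowTensor (X := X) (rk.q (h * z)) 1 := by
  have hh' : (h : ℂ) ≠ 0 := by exact_mod_cast hh
  have hstep : (rowTensor (rk.q (h * z)) 1).comp (-(matOp X ((h : ℂ)⁻¹ • rk.perturb) *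
      resolvent (matOp X ((h : ℂ)⁻¹ • rk.mat⁻¹)) z)) =
        rk.r (h * z) • rowTensor (X := X) (rk.q (h * z)) 1 := by
    rw [ContinuousLinearMap.comp_neg, ContinuousLinearMap.mul_def,
      ← ContinuousLinearMap.comp_assoc, ← rowTensor_vecMul, Matrix.vecMul_smul,
      hacc.q_vecMul_perturb hdet hz, rowTensor_smul, rowTensor_smul, rowTensor_single,
      ContinuousLinearMap.smul_comp, ContinuousLinearMap.smul_comp,
      hacc.proj_comp_resolvent hdet hh hz hzm, smul_smul, smul_smul,
      show (h : ℂ)⁻¹ * rk.r (h * z) * -(h : ℂ) = -rk.r (h * z) by field_simp]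
    ext x
    simp
  induction n with
  | zero =>
    rw [pow_zero, pow_zero, one_smul]
    exact ContinuousLinearMap.comp_id _
  | succ n ih =>
    rw [pow_succ, ContinuousLinearMap.mul_def, ← ContinuousLinearMap.comp_assoc, ih,
      ContinuousLinearMap.smul_comp, hstep, smul_smul, pow_succ]

theorem lastRow_neumannTerm_mul (A : X →ₗ.[ℂ] X) (α : ℝ) (n : ℕ) :
    lastRow (neumannTerm (matOp X ((h : ℂ)⁻¹ • rk.mat⁻¹)) (matOp X ((h : ℂ)⁻¹ • rk.perturb)) n z *
      diagOp X s (resolventOp A (z ^ (α : ℂ)))) = -(h : ℂ) • weightKernel rk A α h n z := by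
  rw [lastRow, neumannTerm, weightKernel, ContinuousLinearMap.mul_def, ContinuousLinearMap.mul_def,
    ← ContinuousLinearMap.comp_assoc, ← ContinuousLinearMap.comp_assoc,
    hacc.proj_comp_resolvent hdet hh hz hzm, ContinuousLinearMap.smul_comp,
    ContinuousLinearMap.smul_comp, hacc.rowTensor_q_comp_pow hdet hh hz hzm,
    ContinuousLinearMap.smul_comp, rowTensor_one_comp_diagOp]

end IsStifflyAccurate

section Trajectories

variable {X : Type*} [NormedAddCommGroup X] [NormedSpace ℂ X] (hdet : IsUnit rk.mat.det) {h : ℝ}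
  {z : ℂ} (hz : (h : ℂ) * z ∉ spectrum ℂ rk.mat⁻¹)

theorem stages_iff {y : X} {Y G : Fin s → X} :
    (∀ i, Y i = y + (h : ℂ) • ∑ j, (rk.a i j : ℂ) • (z • Y j + G j)) ↔
      Y = (fun _ => y) + (h : ℂ) • matOp X rk.mat (z • Y + G) := by
  simp only [funext_iff, Pi.add_apply, Pi.smul_apply, matOp_apply]
  rfl

theorem matOp_one_sub_smul_apply (w : ℂ) (K : Fin s → X) :
    matOp X (1 - w • rk.mat) K = K - w • matOp X rk.mat K := by
  rw [map_sub, map_one, map_smul]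
  rfl

include hdet hz

theorem step_eq {y : X} {Y G : Fin s → X}
    (hY : ∀ i, Y i = y + (h : ℂ) • ∑ j, (rk.a i j : ℂ) • (z • Y j + G j)) :
    y + (h : ℂ) • ∑ j, (rk.b j : ℂ) • (z • Y j + G j) =
      rk.r (h * z) • y + (h : ℂ) • rowTensor (rk.q (h * z)) 1 G := by
  have hsum : ∑ j, (rk.b j : ℂ) • (z • Y j + G j) = rowTensor rk.wt 1 (z • Y + G) := by
    rw [rowTensor_apply]
    rfl
  have hslopes : matOp X (1 - ((h : ℂ) * z) • rk.mat) (z • Y + G) = z • (fun _ => y) + G := by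
    rw [matOp_one_sub_smul_apply, sub_eq_iff_eq_add]
    nth_rewrite 1 [stages_iff.1 hY]
    module
  rw [hsum, ← q_vecMul hdet hz, rowTensor_vecMul, ContinuousLinearMap.comp_apply, hslopes, map_add,
    map_smul, rowTensor_one_const, r]
  module

theorem exists_stages (y : X) (G : Fin s → X) :
    ∃ Y : Fin s → X, ∀ i, Y i = y + (h : ℂ) • ∑ j, (rk.a i j : ℂ) • (z • Y j + G j) := by
  obtain ⟨K, hK⟩ : ∃ K, matOp X (1 - ((h : ℂ) * z) • rk.mat) K = z • (fun _ => y) + G := by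
    refine ⟨matOp X (1 - ((h : ℂ) * z) • rk.mat)⁻¹ (z • (fun _ => y) + G), ?_⟩
    rw [← mul_apply_eq_comp, ← map_mul, Matrix.mul_nonsing_inv _ (isUnit_one_sub hdet hz), map_one,
      one_apply_eq_self]
  rw [matOp_one_sub_smul_apply, sub_eq_iff_eq_add] at hK
  refine ⟨(fun _ => y) + (h : ℂ) • matOp X rk.mat K, stages_iff.2 ?_⟩
  have hslopes : z • ((fun _ => y) + (h : ℂ) • matOp X rk.mat K) + G = K := by
    conv_rhs => rw [hK]
    module
  rw [hslopes]

theorem isTrajectory_iff (g : ℝ → X) (y₀ : X) (y : ℕ → X) :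
    rk.IsTrajectory (linearField g z) y₀ h y ↔
      y 0 = y₀ ∧ ∀ n, y (n + 1) =
        rk.r (h * z) • y n + (h : ℂ) • rowTensor (rk.q (h * z)) 1 (rk.G g h n) := by
  refine and_congr_right fun _ => forall_congr' fun n => ⟨?_, fun hn => ?_⟩
  · rintro ⟨Y, hY, hn⟩
    exact hn.trans (step_eq hdet hz (G := rk.G g h n) hY)
  · obtain ⟨Y, hY⟩ := exists_stages hdet hz (y n) (rk.G g h n)
    exact ⟨Y, hY, hn.trans (step_eq hdet hz hY).symm⟩

theorem existsUnique_trajectory (g : ℝ → X) :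
    ∃! y : ℕ → X, rk.IsTrajectory (linearField g z) 0 h y := by
  simp_rw [isTrajectory_iff hdet hz]
  refine ⟨fun n => Nat.rec 0 (fun n y =>
    rk.r (h * z) • y + (h : ℂ) • rowTensor (rk.q (h * z)) 1 (rk.G g h n)) n,
    ⟨rfl, fun n => rfl⟩, fun y hy => ?_⟩
  ext n
  induction n with
  | zero => exact hy.1
  | succ n ih => rw [hy.2, ih]

theorem approx_eq (g : ℝ → X) (N : ℕ) :
    rk.approx g h z N = (h : ℂ) • ∑ n ∈ Finset.range N,
      rk.r (h * z) ^ n • rowTensor (rk.q (h * z)) 1 (rk.G g h (N - 1 - n)) := by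
  have hex := (existsUnique_trajectory hdet hz g).exists
  have htraj : rk.IsTrajectory (linearField g z) 0 h (rk.approx g h z) := by
    rw [approx, dif_pos hex]
    exact hex.choose_spec
  rw [isTrajectory_iff hdet hz] at htraj
  induction N with
  | zero => simpa using htraj.1
  | succ N ih =>
    rw [htraj.2, ih, Finset.sum_range_succ', smul_comm, ← smul_add, Finset.smul_sum]
    congr 2
    · refine Finset.sum_congr rfl fun n _ => ?_
      rw [smul_smul, ← pow_succ', show N + 1 - 1 - (n + 1) = N - 1 - n by omega]
    · simp

theorem cqKernel_eq (A : X →ₗ.[ℂ] X) (α : ℝ) (g : ℝ → X) (N : ℕ) :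
    cqKernel rk A α h g N z = (h : ℂ) • ∑ n ∈ Finset.range N,
      weightKernel rk A α h n z (rk.G g h (N - 1 - n)) := by
  rw [cqKernel, approx_eq hdet hz, map_smul, map_sum]
  congr 1
  refine Finset.sum_congr rfl fun n _ => ?_
  rw [map_smul, ← rowTensor_eq_apply, weightKernel]
  rfl

end Trajectories

end RungeKutta

section PowerSeries

theorem eq_of_hasSum_pow_smul {𝕜 E : Type*} [NontriviallyNormedField 𝕜] [NormedAddCommGroup E]
    [NormedSpace 𝕜 E] {a b : ℕ → E} {f : 𝕜 → E}
    (ha : ∀ᶠ z in 𝓝 (0 : 𝕜), HasSum (fun n => z ^ n • a n) (f z))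
    (hb : ∀ᶠ z in 𝓝 (0 : 𝕜), HasSum (fun n => z ^ n • b n) (f z)) : a = b := by
  let p : (ℕ → E) → FormalMultilinearSeries 𝕜 𝕜 E := fun c n =>
    ContinuousMultilinearMap.mkPiRing 𝕜 (Fin n) (c n)
  have hasFPowerSeriesAt : ∀ c : ℕ → E,
      (∀ᶠ z in 𝓝 (0 : 𝕜), HasSum (fun n => z ^ n • c n) (f z)) → HasFPowerSeriesAt f (p c) 0 := by
    intro c hc
    refine hasFPowerSeriesAt_iff.2 ?_
    filter_upwards [hc] with z hz
    simpa [FormalMultilinearSeries.coeff, p] using hz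
  have h := (hasFPowerSeriesAt a ha).eq_formalMultilinearSeries (hasFPowerSeriesAt b hb)
  ext n
  simpa [p] using congrArg (fun p => p fun _ => (1 : 𝕜)) (congrFun h n)

end PowerSeries

section SpectrumPerturbation

theorem eventually_spectrum_sub_smul_subset {𝔅 : Type*} [NormedRing 𝔅] [NormedAlgebra ℂ 𝔅]
    [CompleteSpace 𝔅] (m e : 𝔅) {V : Set ℂ} (hV : IsOpen V) (hm : spectrum ℂ m ⊆ V) :
    ∀ᶠ ζ in 𝓝 (0 : ℂ), spectrum ℂ (m - ζ • e) ⊆ V := by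
  have hlim : Tendsto (fun ζ : ℂ => m - ζ • e) (𝓝 0) (𝓝 m) := by
    have : ContinuousAt (fun ζ : ℂ => m - ζ • e) 0 := by fun_prop
    simpa [ContinuousAt] using this
  exact hlim.eventually ((upperHemicontinuous_iff.1 (upperHemicontinuous_spectrum ℂ 𝔅)
    m).forall_isOpen V hV hm)

attribute [local instance] Matrix.linftyOpNormedRing Matrix.linftyOpNormedAlgebra

theorem eventually_matrix_spectrum_subset {s : ℕ} (M E : Matrix (Fin s) (Fin s) ℂ) {V : Set ℂ}
    (hV : IsOpen V) (hM : spectrum ℂ M ⊆ V) : ∀ᶠ ζ in 𝓝 (0 : ℂ), spectrum ℂ (M - ζ • E) ⊆ V :=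
  eventually_spectrum_sub_smul_subset M E hV hM

end SpectrumPerturbation

section GeneratingFunction

variable {X : Type*} [NormedAddCommGroup X] [NormedSpace ℂ X] {A : X →ₗ.[ℂ] X} {θ₀ α : ℝ} {s : ℕ}

theorem range_subset_resolventSet_matOp {γ : ℝ → ℂ} {M : Matrix (Fin s) (Fin s) ℂ}
    (hM : ∀ x, γ x ∉ spectrum ℂ M) : range γ ⊆ resolventSet ℂ (matOp X M) := by
  rintro _ ⟨x, rfl⟩
  by_contra hx
  exact hM x (AlgHom.spectrum_apply_subset (matOp X) M hx)

namespace HasSectorialResolvent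

variable (hA : HasSectorialResolvent A θ₀)

include hA

theorem isBigO_diagOp_resolventOp_cpow {β : ℝ} (hβ : 0 < β) (hβα : β ≤ α) :
    (fun z => diagOp X s (resolventOp A (z ^ (α : ℂ))))
      =O[cocompact ℂ ⊓ 𝓟 (sector (theta1 α θ₀))] fun z => (1 + ‖z‖) ^ (-β) :=
  ((diagOp X s).isBigO_comp _ _).trans (hA.isBigO_resolventOp_cpow hβ hβα)

theorem hasDecay_diagOp_resolventOp_cpow (hα : 0 < α) {K : Set ℂ} (hK : IsClosed K)
    (hKS : K ⊆ sector (theta1 α θ₀)) :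
    HasDecay K α (fun z => diagOp X s (resolventOp A (z ^ (α : ℂ)))) :=
  hasDecay_of_isBigO hK ((hA.differentiableOn_diagOp_resolventOp_cpow hα s).continuousOn.mono hKS)
    ((hA.isBigO_diagOp_resolventOp_cpow hα le_rfl).mono
      (inf_le_inf_left _ (principal_mono.2 hKS)))

variable [CompleteSpace X]

theorem integrable_neumannTerm (hα : 0 < α) {γ : ℝ → ℂ} (hγ : IsUpwardContour γ)
    (hγS : ∀ x, γ x ∈ sector (theta1 α θ₀)) {M : Matrix (Fin s) (Fin s) ℂ}
    (hM : ∀ x, γ x ∉ spectrum ℂ M) (E : Matrix (Fin s) (Fin s) ℂ) (n : ℕ) :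
    Integrable fun x => deriv γ x • (neumannTerm (matOp X M) (matOp X E) n (γ x) *
      diagOp X s (resolventOp A ((γ x) ^ (α : ℂ)))) :=
  hγ.integrable_neumannTerm_mul (matOp X M) (matOp X E) (range_subset_resolventSet_matOp hM) hα
    (hA.hasDecay_diagOp_resolventOp_cpow (s := s) hα hγ.isClosed_range (range_subset_iff.2 hγS)) n

variable [NeZero s]

theorem exists_blockInverse_eq_integral (hα : 0 < α) (hθ : 0 ≤ theta1 α θ₀) {γ : ℝ → ℂ}
    (hγ : IsUpwardContour γ) (hγS : ∀ x, γ x ∈ sector (theta1 α θ₀))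
    {M : Matrix (Fin s) (Fin s) ℂ} (hMS : spectrum ℂ M ⊆ sector (theta1 α θ₀))
    (hMγ : spectrum ℂ M ⊆ {μ | RightOf γ μ}) :
    ∃ (P : Matrix (Fin s) (Fin s) ℂ) (Φ : (Fin s → X) →L[ℂ] (Fin s → X)),
      IsPrincipalPower M α P ∧ IsBoundedInverse (blockShift P A) Φ ∧
      Φ = -(2 * Real.pi * Complex.I : ℂ)⁻¹ • ∫ x, deriv γ x •
        (resolvent (matOp X M) (γ x) * diagOp X s (resolventOp A ((γ x) ^ (α : ℂ)))) := by
  obtain ⟨P, Φ, Ψ, hP, hΦ, hΨ, hΦΨ⟩ := hA.exists_blockInverse hα hθ hMS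
  have hm : range γ ⊆ resolventSet ℂ (matOp X M) :=
    range_subset_resolventSet_matOp fun x hx => (hMγ hx).notMem_range (mem_range_self x)
  have hint := hγ.integral_resolvent_mul (isRayDomain_sector theta1_le_pi_div_two)
    (sector_subset_slitPlane theta1_le_pi_div_two) hγS hm
    (T := M.charpoly.roots) (fun a ha => hMγ (mem_roots_charpoly_iff.1 ha))
    (by rw [prod_roots_charpoly, aeval_matOp_charpoly])
    (hA.differentiableOn_diagOp_resolventOp_cpow hα s) (lt_min hα one_pos) (min_le_right α 1)
    (hA.isBigO_diagOp_resolventOp_cpow (s := s) (lt_min hα one_pos) (min_le_left α 1)) hΨ hΦΨ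
  refine ⟨P, Φ, hP, hΦ, ?_⟩
  rw [hint, smul_neg, neg_smul, neg_neg, inv_smul_smul₀ Complex.two_pi_I_ne_zero]

theorem eventually_hasSum_blockInverse (hα : 0 < α) (hθ : 0 ≤ theta1 α θ₀) {γ : ℝ → ℂ}
    (hγ : IsUpwardContour γ) (hγS : ∀ x, γ x ∈ sector (theta1 α θ₀))
    {M : Matrix (Fin s) (Fin s) ℂ} (hMS : spectrum ℂ M ⊆ sector (theta1 α θ₀))
    (hMγ : spectrum ℂ M ⊆ {μ | RightOf γ μ}) (E : Matrix (Fin s) (Fin s) ℂ) :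
    ∀ᶠ ζ in 𝓝 (0 : ℂ), ∃ (P : Matrix (Fin s) (Fin s) ℂ) (Φ : (Fin s → X) →L[ℂ] (Fin s → X)),
      IsPrincipalPower (M - ζ • E) α P ∧ IsBoundedInverse (blockShift P A) Φ ∧
      HasSum (fun n : ℕ => ζ ^ n • -(2 * Real.pi * Complex.I : ℂ)⁻¹ •
        ∫ x, deriv γ x • (neumannTerm (matOp X M) (matOp X E) n (γ x) *
          diagOp X s (resolventOp A ((γ x) ^ (α : ℂ))))) Φ := by
  have hm : range γ ⊆ resolventSet ℂ (matOp X M) :=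
    range_subset_resolventSet_matOp fun x hx => (hMγ hx).notMem_range (mem_range_self x)
  obtain ⟨ρ, hρ, hsmall⟩ := hγ.exists_forall_norm_mul_resolvent_le hm (matOp X E)
  filter_upwards [
    eventually_matrix_spectrum_subset M E (isOpen_sector theta1_le_pi_div_two) hMS,
    eventually_matrix_spectrum_subset M E (isOpen_setOf_rightOf hγ.isClosed_range) hMγ,
    Metric.ball_mem_nhds (0 : ℂ) hρ] with ζ hζS hζγ hζρ
  obtain ⟨P, Φ, hP, hΦ, hΦint⟩ := hA.exists_blockInverse_eq_integral hα hθ hγ hγS hζS hζγ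
  refine ⟨P, Φ, hP, hΦ, ?_⟩
  have hsum := hγ.hasSum_integral_neumannTerm_mul hm hα
    (hA.hasDecay_diagOp_resolventOp_cpow (s := s) hα hγ.isClosed_range (range_subset_iff.2 hγS))
    (hsmall ζ (mem_ball_zero_iff.1 hζρ))
  rw [hΦint, map_sub, map_smul]
  refine (hsum.const_smul (-(2 * Real.pi * Complex.I : ℂ)⁻¹)).congr_fun fun n => ?_
  rw [smul_comm]

end HasSectorialResolvent

end GeneratingFunction

section VerticalLine

/-- The vertical line `Re z = ε`, run upwards. It serves as a contour to the left of any given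
finite subset of the right half-plane. -/
noncomputable def verticalLine (ε : ℝ) : ℝ → ℂ := fun x => ε + x * Complex.I

theorem hasDerivAt_verticalLine (ε x : ℝ) : HasDerivAt (verticalLine ε) Complex.I x :=
  ((((hasDerivAt_id x).ofReal_comp).mul_const Complex.I).const_add (ε : ℂ)).congr_deriv (by simp)

theorem isometry_verticalLine (ε : ℝ) : Isometry (verticalLine ε) :=
  Isometry.of_dist_eq fun x y => by
    rw [verticalLine, verticalLine, dist_add_left, dist_eq_norm, ← sub_mul, norm_mul,
      Complex.norm_I, mul_one, ← Complex.ofReal_sub, Complex.norm_real, Real.dist_eq,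
      Real.norm_eq_abs]

theorem isUpwardContour_verticalLine (ε : ℝ) : IsUpwardContour (verticalLine ε) where
  locallyLipschitz := (isometry_verticalLine ε).lipschitz.locallyLipschitz
  differentiableAt := ⟨∅, finite_empty, fun x _ => (hasDerivAt_verticalLine ε x).differentiableAt⟩
  tendsto_atTop :=
    (isometry_verticalLine ε).isClosedEmbedding.tendsto_cocompact.mono_left atTop_le_cocompact
  tendsto_atBot :=
    (isometry_verticalLine ε).isClosedEmbedding.tendsto_cocompact.mono_left atBot_le_cocompact
  deriv_bound := ⟨1, one_pos, Eventually.of_forall fun x => by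
    rw [(hasDerivAt_verticalLine ε x).deriv, Complex.norm_I, Complex.I_im, mul_one]⟩

theorem rightOf_verticalLine {ε : ℝ} {p : ℂ} (hp : ε < p.re) : RightOf (verticalLine ε) p := by
  refine ⟨ε + 1, fun x hx => JoinedIn.of_segment_subset
    (((convex_halfSpace_re_gt ε).segment_subset hp (?_ : ε < (x : ℂ).re)).trans ?_)⟩
  · rw [Complex.ofReal_re]
    linarith
  · rintro z hz ⟨y, rfl⟩
    simp [verticalLine] at hz

theorem exists_pos_forall_lt_re {K : Set ℂ} (hK : K.Finite) (hre : ∀ z ∈ K, 0 < z.re) :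
    ∃ ε : ℝ, 0 < ε ∧ ∀ z ∈ K, ε < z.re := by
  have hlt : ∀ᶠ ε : ℝ in 𝓝[>] 0, ∀ z ∈ K, ε < z.re :=
    hK.eventually_all.2 fun z hz => mem_nhdsWithin_of_mem_nhds (Iio_mem_nhds (hre z hz))
  have hpos : ∀ᶠ ε : ℝ in 𝓝[>] 0, 0 < ε := self_mem_nhdsWithin
  exact (hpos.and hlt).exists

end VerticalLine

section MatrixSpectrum

variable {s : ℕ} {M : Matrix (Fin s) (Fin s) ℂ}

theorem mem_spectrum_inv_smul {c : ℂ} (hc : c ≠ 0) {z : ℂ} :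
    z ∈ spectrum ℂ (c⁻¹ • M) ↔ c * z ∈ spectrum ℂ M := by
  rw [← spectrum.smul_mem_smul_iff (a := M) (s := c * z) (r := (Units.mk0 c hc)⁻¹),
    Units.smul_def, Units.smul_def]
  simp [hc]

theorem isUnit_det_of_forall_re_pos (hM : ∀ μ ∈ spectrum ℂ M, 0 < μ.re) : IsUnit M.det := by
  rw [← Matrix.isUnit_iff_isUnit_det, ← spectrum.zero_notMem_iff ℂ]
  exact fun h => (hM 0 h).false

theorem re_pos_of_mem_spectrum_inv (hM : ∀ μ ∈ spectrum ℂ M, 0 < μ.re) {μ : ℂ}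
    (hμ : μ ∈ spectrum ℂ M⁻¹) : 0 < μ.re := by
  obtain ⟨u, rfl⟩ := (Matrix.isUnit_iff_isUnit_det _).2 (isUnit_det_of_forall_re_pos hM)
  rw [← Matrix.coe_units_inv] at hμ
  have hμ₀ : μ ≠ 0 := spectrum.ne_zero_of_mem_of_unit hμ
  have hre := hM _ (spectrum.inv₀_mem_iff.2 hμ)
  rw [Complex.inv_re] at hre
  exact (div_pos_iff_of_pos_right (Complex.normSq_pos.2 hμ₀)).1 hre

theorem re_pos_of_mem_spectrum_inv_smul_inv (hM : ∀ μ ∈ spectrum ℂ M, 0 < μ.re) {h : ℝ}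
    (hh : 0 < h) {μ : ℂ} (hμ : μ ∈ spectrum ℂ ((h : ℂ)⁻¹ • M⁻¹)) : 0 < μ.re := by
  have hre := re_pos_of_mem_spectrum_inv hM
    ((mem_spectrum_inv_smul (by exact_mod_cast hh.ne')).1 hμ)
  rw [Complex.re_ofReal_mul] at hre
  exact (pos_iff_pos_of_mul_pos hre).1 hh

end MatrixSpectrum

section Weights

variable {X : Type*} [NormedAddCommGroup X] [NormedSpace ℂ X] {A : X →ₗ.[ℂ] X} {θ₀ α h : ℝ}
  {s : ℕ} {rk : RungeKutta s} {γ : ℝ → ℂ}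

theorem IsCQWeights.unique (hh : h ≠ 0) {W W' : ℕ → (Fin s → X) →L[ℂ] (Fin s → X)}
    (hW : IsCQWeights rk A α h W) (hW' : IsCQWeights rk A α h W') : W = W' := by
  obtain ⟨ρ, hρ, H⟩ := hW
  obtain ⟨ρ', hρ', H'⟩ := hW'
  have hcoeff : (fun n => (h : ℂ) • W n) = fun n => (h : ℂ) • W' n := by
    refine eq_of_hasSum_pow_smul (𝕜 := ℂ) (f := fun ζ => ∑' n, ζ ^ n • (h : ℂ) • W n) ?_ ?_
    · filter_upwards [Metric.ball_mem_nhds (0 : ℂ) hρ] with ζ hζ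
      obtain ⟨P, R, -, -, hs⟩ := H ζ (mem_ball_zero_iff.1 hζ)
      exact hs.summable.hasSum
    · filter_upwards [Metric.ball_mem_nhds (0 : ℂ) hρ, Metric.ball_mem_nhds (0 : ℂ) hρ']
        with ζ hζ hζ'
      obtain ⟨P, R, hP, hR, hs⟩ := H ζ (mem_ball_zero_iff.1 hζ)
      obtain ⟨P', R', hP', hR', hs'⟩ := H' ζ (mem_ball_zero_iff.1 hζ')
      obtain rfl := hP.unique hP'
      rw [hs.tsum_eq, hR.unique hR']
      exact hs'
  ext1 n
  exact smul_right_injective _ (by exact_mod_cast hh : (h : ℂ) ≠ 0) (congrFun hcoeff n)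

theorem pullback_cqKernel (hdet : IsUnit rk.mat.det)
    (hγσ : ∀ x : ℝ, (h : ℂ) * γ x ∉ spectrum ℂ rk.mat⁻¹) (g : ℝ → X) (N : ℕ) :
    pullback γ (cqKernel rk A α h g N) = fun x => (h : ℂ) • ∑ n ∈ Finset.range N,
      pullback γ (weightKernel rk A α h n) x (rk.G g h (N - 1 - n)) := by
  ext1 x
  simp only [pullback]
  rw [RungeKutta.cqKernel_eq hdet (hγσ x), smul_comm, Finset.smul_sum]
  rfl

theorem integrable_cqKernel (hdet : IsUnit rk.mat.det)
    (hγσ : ∀ x : ℝ, (h : ℂ) * γ x ∉ spectrum ℂ rk.mat⁻¹)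
    (hint : ∀ n, Integrable (pullback γ (weightKernel rk A α h n))) (g : ℝ → X) (N : ℕ) :
    Integrable (pullback γ (cqKernel rk A α h g N)) := by
  rw [pullback_cqKernel hdet hγσ]
  exact (integrable_finsetSum _ fun n _ => (hint n).apply_continuousLinearMap _).smul _

theorem cqApprox_eq (hdet : IsUnit rk.mat.det)
    (hγσ : ∀ x : ℝ, (h : ℂ) * γ x ∉ spectrum ℂ rk.mat⁻¹)
    (hint : ∀ n, Integrable (pullback γ (weightKernel rk A α h n))) (g : ℝ → X) (N : ℕ) :
    cqApprox rk A α h γ g N =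
      (h : ℂ) • ∑ n ∈ Finset.range N, weight rk A α h γ n (rk.G g h (N - 1 - n)) := by
  rw [cqApprox, contourInt, pullback_cqKernel hdet hγσ, integral_smul,
    integral_finsetSum _ fun n _ => (hint n).apply_continuousLinearMap _, smul_comm,
    Finset.smul_sum]
  congr 1
  refine Finset.sum_congr rfl fun n _ => ?_
  exact congrArg _ (ContinuousLinearMap.integral_apply (hint n) _).symm

variable [NeZero s]

theorem RungeKutta.IsStifflyAccurate.isCQWeights (hacc : rk.IsStifflyAccurate)
    (hdet : IsUnit rk.mat.det) (hh : h ≠ 0) {V : ℕ → (Fin s → X) →L[ℂ] (Fin s → X)}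
    (hV : ∀ᶠ ζ in 𝓝 (0 : ℂ), ∃ (P : Matrix (Fin s) (Fin s) ℂ)
      (Φ : (Fin s → X) →L[ℂ] (Fin s → X)),
      IsPrincipalPower ((h : ℂ)⁻¹ • rk.mat⁻¹ - ζ • ((h : ℂ)⁻¹ • rk.perturb)) α P ∧
      IsBoundedInverse (blockShift P A) Φ ∧ HasSum (fun n => ζ ^ n • V n) Φ) :
    IsCQWeights rk A α h (fun n => (h : ℂ)⁻¹ • V n) := by
  have hne : ∀ᶠ ζ in 𝓝 (0 : ℂ), ζ ≠ 1 := isOpen_ne.mem_nhds zero_ne_one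
  obtain ⟨ρ, hρ, H⟩ := Metric.eventually_nhds_iff.1 (hV.and hne)
  refine ⟨ρ, hρ, fun ζ hζ => ?_⟩
  obtain ⟨⟨P, Φ, hP, hΦ, hs⟩, hζ₁⟩ := H (mem_ball_zero_iff.2 hζ)
  refine ⟨P, Φ, ?_, hΦ, hs.congr_fun fun n => ?_⟩
  · rwa [hacc.delta_eq hdet hζ₁, smul_sub, smul_comm]
  · rw [smul_inv_smul₀ (by exact_mod_cast hh : (h : ℂ) ≠ 0)]

/-- `lastRow` as a bounded linear map, to interchange it with integrals. -/
noncomputable def lastRowCLM (X : Type*) [NormedAddCommGroup X] [NormedSpace ℂ X] (s : ℕ)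
    [NeZero s] : ((Fin s → X) →L[ℂ] (Fin s → X)) →L[ℂ] ((Fin s → X) →L[ℂ] X) :=
  ContinuousLinearMap.compL ℂ (Fin s → X) (Fin s → X) X (ContinuousLinearMap.proj (lastStage s))

theorem lastRowCLM_apply (W : (Fin s → X) →L[ℂ] (Fin s → X)) :
    lastRowCLM X s W = lastRow W := rfl

theorem lastRowCLM_neumannTerm (hacc : rk.IsStifflyAccurate) (hdet : IsUnit rk.mat.det)
    (hh : h ≠ 0) (hγσ : ∀ x : ℝ, (h : ℂ) * γ x ∉ spectrum ℂ rk.mat⁻¹) (n : ℕ) (x : ℝ) :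
    lastRowCLM X s (deriv γ x • (neumannTerm (matOp X ((h : ℂ)⁻¹ • rk.mat⁻¹))
      (matOp X ((h : ℂ)⁻¹ • rk.perturb)) n (γ x) *
        diagOp X s (resolventOp A ((γ x) ^ (α : ℂ))))) =
      -(h : ℂ) • pullback γ (weightKernel rk A α h n) x := by
  have hm : range γ ⊆ resolventSet ℂ (matOp X ((h : ℂ)⁻¹ • rk.mat⁻¹)) :=
    range_subset_resolventSet_matOp fun x hx =>
      hγσ x ((mem_spectrum_inv_smul (by exact_mod_cast hh)).1 hx)
  rw [map_smul, lastRowCLM_apply, hacc.lastRow_neumannTerm_mul hdet hh (hγσ x)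
    (hm (mem_range_self x)), smul_comm]
  rfl

namespace HasSectorialResolvent

variable [CompleteSpace X] (hA : HasSectorialResolvent A θ₀) (hα : 0 < α)
  (hacc : rk.IsStifflyAccurate)

include hA hα hacc

theorem integrable_weightKernel (hdet : IsUnit rk.mat.det) (hh : h ≠ 0) (hγ : IsUpwardContour γ)
    (hγS : ∀ x, γ x ∈ sector (theta1 α θ₀))
    (hγσ : ∀ x : ℝ, (h : ℂ) * γ x ∉ spectrum ℂ rk.mat⁻¹) (n : ℕ) :
    Integrable (pullback γ (weightKernel rk A α h n)) := by
  have hh' : (h : ℂ) ≠ 0 := by exact_mod_cast hh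
  have hint := (lastRowCLM X s).integrable_comp (hA.integrable_neumannTerm hα hγ hγS
    (M := (h : ℂ)⁻¹ • rk.mat⁻¹) (fun x hx => hγσ x ((mem_spectrum_inv_smul hh').1 hx))
    ((h : ℂ)⁻¹ • rk.perturb) n)
  simp_rw [lastRowCLM_neumannTerm hacc hdet hh hγσ] at hint
  exact (integrable_smul_iff (neg_ne_zero.2 hh') _).1 hint

variable (hθ : 0 ≤ theta1 α θ₀) (hre : ∀ μ ∈ spectrum ℂ rk.mat, 0 < μ.re) (hh : 0 < h)

include hθ hre hh

theorem isCQWeights_integral (hγ : IsUpwardContour γ) (hγS : ∀ x, γ x ∈ sector (theta1 α θ₀))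
    (hright : ∀ μ ∈ spectrum ℂ ((h : ℂ)⁻¹ • rk.mat⁻¹), RightOf γ μ) :
    IsCQWeights rk A α h fun n => (h : ℂ)⁻¹ • -(2 * Real.pi * Complex.I : ℂ)⁻¹ •
      ∫ x, deriv γ x • (neumannTerm (matOp X ((h : ℂ)⁻¹ • rk.mat⁻¹))
        (matOp X ((h : ℂ)⁻¹ • rk.perturb)) n (γ x) *
          diagOp X s (resolventOp A ((γ x) ^ (α : ℂ)))) :=
  hacc.isCQWeights (isUnit_det_of_forall_re_pos hre) hh.ne'
    (hA.eventually_hasSum_blockInverse hα hθ hγ hγS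
      (fun _ hμ => mem_sector_of_re_pos hθ (re_pos_of_mem_spectrum_inv_smul_inv hre hh hμ))
      hright _)

theorem exists_isCQWeights : ∃ W, IsCQWeights rk A α h W := by
  obtain ⟨ε, hε, hlt⟩ := exists_pos_forall_lt_re ((h : ℂ)⁻¹ • rk.mat⁻¹).finite_spectrum
    fun μ => re_pos_of_mem_spectrum_inv_smul_inv hre hh
  exact ⟨_, hA.isCQWeights_integral hα hacc hθ hre hh (isUpwardContour_verticalLine ε)
    (fun x => mem_sector_of_re_pos hθ (by simpa [verticalLine] using hε))
    fun μ hμ => rightOf_verticalLine (hlt μ hμ)⟩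

theorem lastRow_eq_weight {W : ℕ → (Fin s → X) →L[ℂ] (Fin s → X)}
    (hW : IsCQWeights rk A α h W) (hγ : IsUpwardContour γ)
    (hγS : ∀ x, γ x ∈ sector (theta1 α θ₀))
    (hγσ : ∀ x : ℝ, (h : ℂ) * γ x ∉ spectrum ℂ rk.mat⁻¹)
    (hright : ∀ μ ∈ spectrum ℂ rk.mat⁻¹, RightOf γ (μ / h)) (n : ℕ) :
    lastRow (W n) = weight rk A α h γ n := by
  have hh' : (h : ℂ) ≠ 0 := by exact_mod_cast hh.ne'
  have hW_eq := hW.unique hh.ne' (hA.isCQWeights_integral hα hacc hθ hre hh hγ hγS fun μ hμ => by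
    have := hright _ ((mem_spectrum_inv_smul hh').1 hμ)
    rwa [mul_div_cancel_left₀ _ hh'] at this)
  rw [hW_eq, ← lastRowCLM_apply, map_smul, map_smul, ← ContinuousLinearMap.integral_comp_comm _
    (hA.integrable_neumannTerm hα hγ hγS
      (fun x hx => hγσ x ((mem_spectrum_inv_smul hh').1 hx)) _ n)]
  simp_rw [lastRowCLM_neumannTerm hacc (isUnit_det_of_forall_re_pos hre) hh.ne' hγσ]
  rw [integral_smul, smul_smul, smul_smul, weight, contourInt]
  congr 1
  field_simp

end HasSectorialResolvent

end Weights

section Contour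

variable {γ : ℝ → ℂ}

theorem exists_deriv_bound_of_tendsto {l : Filter ℝ} {e : ℂ} (he : 0 < e.im)
    (h : Tendsto (fun x => deriv γ x / (‖deriv γ x‖ : ℂ)) l (𝓝 e)) :
    ∃ C : ℝ, 0 < C ∧ ∀ᶠ x in l, ‖deriv γ x‖ ≤ C * (deriv γ x).im := by
  refine ⟨2 / e.im, by positivity, ?_⟩
  have him := (Complex.continuous_im.tendsto e).comp h
  filter_upwards [him.eventually (lt_mem_nhds (half_lt_self he))] with x hx
  simp only [Function.comp_apply, Complex.div_ofReal_im] at hx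
  rcases eq_or_ne (deriv γ x) 0 with h0 | h0
  · simp [h0]
  · rw [lt_div_iff₀ (norm_pos_iff.2 h0)] at hx
    rw [div_mul_eq_mul_div, le_div_iff₀ he]
    linarith

theorem im_exp_pi_div_two_add_mul_I_pos {φ : ℝ} (hφ : |φ| < Real.pi / 2) :
    0 < (Complex.exp (((Real.pi / 2 + φ : ℝ) : ℂ) * Complex.I)).im := by
  rw [Complex.exp_ofReal_mul_I_im, add_comm, Real.sin_add_pi_div_two]
  exact Real.cos_pos_of_mem_Ioo (abs_lt.1 hφ)

theorem IsContour.exists_deriv_bound {S : Set ℂ} (hγ : IsContour S γ) :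
    ∃ C : ℝ, 0 < C ∧ ∀ᶠ x in cocompact ℝ, ‖deriv γ x‖ ≤ C * (deriv γ x).im := by
  obtain ⟨φ, hφ₀, hφ, htop⟩ := hγ.top_angle
  obtain ⟨φ', hφ₀', hφ', hbot⟩ := hγ.bot_angle
  obtain ⟨C, hC, hb⟩ := exists_deriv_bound_of_tendsto
    (im_exp_pi_div_two_add_mul_I_pos ((abs_of_pos hφ₀).trans_lt hφ)) htop
  obtain ⟨C', hC', hb'⟩ := exists_deriv_bound_of_tendsto (by
    have him := im_exp_pi_div_two_add_mul_I_pos ((abs_of_pos hφ₀').trans_lt hφ')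
    rw [Complex.exp_ofReal_mul_I_im] at him
    rwa [Complex.neg_im, ← Complex.ofReal_neg, Complex.exp_ofReal_mul_I_im, Real.sin_neg,
      neg_neg]) hbot
  have hmono {K L : ℝ} {w : ℂ} (hK : 0 < K) (hKL : K ≤ L) (hw : ‖w‖ ≤ K * w.im) :
      ‖w‖ ≤ L * w.im :=
    hw.trans (mul_le_mul_of_nonneg_right hKL
      (nonneg_of_mul_nonneg_right ((norm_nonneg w).trans hw) hK))
  refine ⟨max C C', lt_max_of_lt_left hC, ?_⟩
  rw [cocompact_eq_atBot_atTop, eventually_sup]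
  exact ⟨hb'.mono fun x => hmono hC' (le_max_right C C'),
    hb.mono fun x => hmono hC (le_max_left C C')⟩

theorem IsContour.isUpwardContour {S : Set ℂ} (hγ : IsContour S γ) : IsUpwardContour γ where
  locallyLipschitz := hγ.lipschitz
  differentiableAt := by
    obtain ⟨F, hF, hd⟩ := hγ.piecewise
    exact ⟨F, hF, fun x hx => (hd.differentiableOn one_ne_zero).differentiableAt
      (hF.isClosed.isOpen_compl.mem_nhds hx)⟩
  tendsto_atTop := hγ.top_infinity
  tendsto_atBot := hγ.bot_infinity
  deriv_bound := hγ.exists_deriv_bound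

end Contour

end FracCQ

theorem proposition3p3_general {X : Type*} [NormedAddCommGroup X] [NormedSpace ℂ X]
    [CompleteSpace X] (A : X →ₗ.[ℂ] X) (θ₀ α : ℝ) (hA : HasSectorialResolvent A θ₀) (hα : 0 < α)
    (hθ : 0 ≤ theta1 α θ₀) (s : ℕ) [NeZero s] (rk : RungeKutta s) (hacc : rk.IsStifflyAccurate)
    (hre : ∀ μ ∈ spectrum ℂ rk.mat, 0 < μ.re) (h : ℝ) (hh : 0 < h) (γ : ℝ → ℂ)
    (hγ : IsUpwardContour γ) (hγS : ∀ x, γ x ∈ sector (theta1 α θ₀))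
    (hγσ : ∀ x : ℝ, (h : ℂ) * γ x ∉ spectrum ℂ rk.mat⁻¹) :
    (∀ n : ℕ, MeasureTheory.Integrable (pullback γ (weightKernel rk A α h n))) ∧
    (∀ g : ℝ → X,
      (∀ x : ℝ, ∃! y : ℕ → X, rk.IsTrajectory (RungeKutta.linearField g (γ x)) 0 h y) ∧
      ∀ N : ℕ,
        MeasureTheory.Integrable (pullback γ (cqKernel rk A α h g N)) ∧
        cqApprox rk A α h γ g N =
          (h : ℂ) • ∑ n ∈ Finset.range N, weight rk A α h γ n (rk.G g h (N - 1 - n))) ∧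
    (∃! W, IsCQWeights rk A α h W) ∧
    ((∀ μ ∈ spectrum ℂ rk.mat⁻¹, RightOf γ (μ / h)) →
      ∀ W, IsCQWeights rk A α h W →
        (∀ n : ℕ, lastRow (W n) = weight rk A α h γ n) ∧
        ∀ (g : ℝ → X) (N : ℕ),
          (h : ℂ) • (∑ n ∈ Finset.range N, W n (rk.G g h (N - 1 - n))) (lastStage s) =
              cqApprox rk A α h γ g N ∧
          (h : ℂ) • (∑ n ∈ Finset.range N, W n (rk.G g h (N - 1 - n))) (lastStage s) =
            (h : ℂ) • ∑ n ∈ Finset.range N, weight rk A α h γ n (rk.G g h (N - 1 - n))) := by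
  have hdet := isUnit_det_of_forall_re_pos hre
  have hint := hA.integrable_weightKernel hα hacc hdet hh.ne' hγ hγS hγσ
  have hcq := cqApprox_eq hdet hγσ hint
  refine ⟨hint, fun g => ⟨fun x => RungeKutta.existsUnique_trajectory hdet (hγσ x) g,
    fun N => ⟨integrable_cqKernel hdet hγσ hint g N, hcq g N⟩⟩, ?_, fun hright W hW => ?_⟩
  · obtain ⟨W, hW⟩ := hA.exists_isCQWeights hα hacc hθ hre hh
    exact ⟨W, hW, fun W' hW' => hW'.unique hh.ne' hW⟩
  · have hrow := hA.lastRow_eq_weight hα hacc hθ hre hh hW hγ hγS hγσ hright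
    have hsum (g : ℝ → X) (N : ℕ) :
        (h : ℂ) • (∑ n ∈ Finset.range N, W n (rk.G g h (N - 1 - n))) (lastStage s) =
          (h : ℂ) • ∑ n ∈ Finset.range N, weight rk A α h γ n (rk.G g h (N - 1 - n)) := by
      rw [Finset.sum_apply]
      simp_rw [← hrow]
      rfl
    exact ⟨hrow, fun g N => ⟨(hsum g N).trans (hcq g N).symm, hsum g N⟩⟩

theorem proposition3p3 {X : Type*} [NormedAddCommGroup X] [NormedSpace ℂ X] [CompleteSpace X]
    (A : X →ₗ.[ℂ] X) (θ₀ α : ℝ) (hA : IsSectorialOp A θ₀) (hα₀ : 0 < α) (hα₁ : α < 1)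
    (s : ℕ) [NeZero s] (rk : RungeKutta s) (hrk : rk.Admissible)
    (h : ℝ) (hh : 0 < h)
    (γ : ℝ → ℂ) (hγ : IsContour (sector (theta1 α θ₀)) γ)
    (hγσ : ∀ x : ℝ, (h : ℂ) * γ x ∉ spectrum ℂ rk.mat⁻¹) :
    -- the Runge–Kutta approximations on the contour are well defined, the integrals converge, and
    -- the convolution quadrature approximation is the discrete convolution with the weights
    (∀ n : ℕ, MeasureTheory.Integrable (pullback γ (weightKernel rk A α h n))) ∧
    (∀ g : ℝ → X,
      (∀ x : ℝ, ∃! y : ℕ → X, rk.IsTrajectory (RungeKutta.linearField g (γ x)) 0 h y) ∧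
      ∀ N : ℕ,
        MeasureTheory.Integrable (pullback γ (cqKernel rk A α h g N)) ∧
        cqApprox rk A α h γ g N =
          (h : ℂ) • ∑ n ∈ Finset.range N, weight rk A α h γ n (rk.G g h (N - 1 - n))) ∧
    -- the generating function has a unique coefficient sequence, and if the poles of the
    -- integrands lie to the right of the contour, the weights are the last rows of its members
    (∃! W, IsCQWeights rk A α h W) ∧
    ((∀ μ ∈ spectrum ℂ rk.mat⁻¹, RightOf γ (μ / h)) →
      ∀ W, IsCQWeights rk A α h W →
        (∀ n : ℕ, lastRow (W n) = weight rk A α h γ n) ∧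
        ∀ (g : ℝ → X) (N : ℕ),
          (h : ℂ) • (∑ n ∈ Finset.range N, W n (rk.G g h (N - 1 - n))) (lastStage s) =
              cqApprox rk A α h γ g N ∧
          (h : ℂ) • (∑ n ∈ Finset.range N, W n (rk.G g h (N - 1 - n))) (lastStage s) =
            (h : ℂ) • ∑ n ∈ Finset.range N, weight rk A α h γ n (rk.G g h (N - 1 - n))) :=
  proposition3p3_general A θ₀ α hA.hasSectorialResolvent hα₀
    (theta1_nonneg hα₀ hα₁.le hA.angle_pos.le) s rk hrk.last_row hrk.eigenvalues h hh γ
    hγ.isUpwardContour hγ.mem hγσ
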